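/- Let $T$ be a closed, densely defined operator in a complex Hilbert space $\mathcal H$ whose spectrum $\sigma(T)$ is real and purely continuous (for $\lambda\in\sigma(T)$ the operator $T-\lambda I$ is injective with dense range). Let $A,B$ be bounded operators in $\mathcal H$, $V=B^*A$ and $L=T+V$ with $D(L)=D(T)$; put $R_0(\lambda)=(T-\lambda I)^{-1}$, $R_V(\lambda)=(L-\lambda I)^{-1}$, and let $R_0^*(\lambda)$, $R_V^*(\lambda)$ be the resolvents of $T^*$, $L^*$. Assume that $A$ is smooth relative to $T$, i.e. $\sup_{\varepsilon>0}\int_{\mathbb R}\|AR_0(k\pm i\varepsilon)\varphi\|^2\,dk<\infty$ for every $\varphi\in\mathcal H$, that $B$ is likewise smooth relative to $T^*$, that $Q_0(\lambda)=AR_0(\lambda)B^*$ is bounded in $\mathbb C\setminus\mathbb R$, and that (i) $R_V(\lambda)$ is meromorphic in $\mathbb C\setminus\sigma(T)$ and its poles are exactly the eigenvalues of $L$ there, each of finite algebraic multiplicity; (ii) the discrete spectrum $\sigma_d(L)$ (the isolated points of $\sigma(L)$ of finite algebraic multiplicity) is a finite set, and $\sigma(L)\setminus\sigma_d(L)=\sigma(T)$;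 (iii) for every $\delta>0$ the function $Q_V(\lambda)=AR_V(\lambda)B^*$ is bounded on the set of non-real $\lambda$ with $\operatorname{dist}(\lambda,\sigma_d(L))\ge\delta$. Let $P$ be the Riesz projection of $L$ corresponding to $\sigma_d(L)$, $\mathcal H_d=P\mathcal H$, $\mathcal H_c=(I-P)\mathcal H$, and let $\mathcal H_d^*,\mathcal H_c^*$ be the corresponding subspaces for $L^*$. Then there are unique bounded operators $W$ and $Z$ with $$(W\varphi,\psi)=(\varphi,\psi)-\frac1{2\pi i}\int_{\mathbb R}\big(AR_0(k+i0)\varphi,BR_V^*(k+i0)\psi\big)\,dk\quad(\varphi\in\mathcal H,\ \psi\in\mathcal H_c^*),\qquad (W\varphi,\psi)=0\quad(\varphi\in\mathcal H,\ \psi\in\mathcal H_d^*),$$ $$(Z\varphi,\psi)=(\varphi,\psi)+\frac1{2\pi i}\int_{\mathbb R}\big(AR_V(s+i0)\varphi,BR_0^*(s+i0)\psi\big)\,ds\quad(\varphi\in\mathcal H_c,\ \psi\in\mathcal H),\qquad (Z\varphi,\psi)=0\quad(\varphi\in\mathcal H_d,\ \psi\in\mathcal H),$$ where the boundary values exist as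 limits in norm for almost all points of $\mathbb R$ and the integrands are integrable. These operators implement a similarity of $T$ and the restriction $L_c=L|\mathcal H_c$: one has $ZW=I$, $WZ=I-P$, $W\mathcal H=\mathcal H_c$, $\ker Z=\mathcal H_d$, the subspace $\mathcal H_c$ is invariant under $L$, and $L_c=WTZ$ on $\mathcal H_c$, including equality of domains: $D(L)\cap\mathcal H_c=\{\varphi\in\mathcal H_c: Z\varphi\in D(T)\}$. In particular $R_V(\lambda)W=WR_0(\lambda)$ for all $\lambda\notin\sigma(L)$. If in addition $T=T^*$, then for all $t\in\mathbb R$ the strong limits $\exp(itT)=\operatorname{s-lim}_{n\to\infty}(I-itT/n)^{-n}$ and $\exp(itL)=\operatorname{s-lim}_{n\to\infty}(I-itL/n)^{-n}$ exist as bounded operators, and $$W=\operatorname*{s-lim}_{t\to\infty}\exp(itL)(I-P)\exp(-itT),\qquad Z=\operatorname*{s-lim}_{t\to\infty}\exp(itT)\exp(-itL)(I-P).$$ -/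

import Mathlib

open Filter Topology MeasureTheory
open scoped NNReal ENNReal LinearPMap

namespace KatoModel

noncomputable section

variable {H : Type*} [NormedAddCommGroup H] [InnerProductSpace ℂ H]

/-! ### Resolvent and spectrum of an unbounded operator -/

/-- The operator `a I + b S` on the domain of `S`. -/
def affine (a b : ℂ) (S : H →ₗ.[ℂ] H) : H →ₗ.[ℂ] H :=
  (a • (LinearMap.id : H →ₗ[ℂ] H)) +ᵥ (b • S)

/-- `R` is an everywhere defined bounded two-sided inverse of the unbounded operator `S`. -/
def IsBoundedInverse (S : H →ₗ.[ℂ] H) (R : H →L[ℂ] H) : Prop :=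
  (∀ x : H, ∃ h : R x ∈ S.domain, S ⟨R x, h⟩ = x) ∧ ∀ x : S.domain, R (S x) = x

open Classical in
/-- The bounded everywhere defined inverse of `S` (and `0` if there is none). -/
def boundedInverse (S : H →ₗ.[ℂ] H) : H →L[ℂ] H :=
  if h : ∃ R : H →L[ℂ] H, IsBoundedInverse S R then h.choose else 0

/-- The spectrum of `S`: all `z` such that `S - z I` has no bounded everywhere defined inverse. -/
def spec (S : H →ₗ.[ℂ] H) : Set ℂ :=
  {z | ¬ ∃ R : H →L[ℂ] H, IsBoundedInverse (affine (-z) 1 S) R}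

/-- The resolvent `(S - z I)⁻¹` (and `0` for `z` in the spectrum). -/
def resolv (S : H →ₗ.[ℂ] H) (z : ℂ) : H →L[ℂ] H :=
  boundedInverse (affine (-z) 1 S)

/-- `z` is an eigenvalue of `S`. -/
def IsEigenvalue (S : H →ₗ.[ℂ] H) (z : ℂ) : Prop :=
  ∃ x : S.domain, (x : H) ≠ 0 ∧ S x = z • (x : H)

/-- The spectrum of `S` is purely continuous: for each `z` in it, `S - z I` is injective and its
range is dense (there is neither point nor residual spectrum). -/
def HasPurelyContinuousSpectrum (S : H →ₗ.[ℂ] H) : Prop :=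
  ∀ z ∈ spec S, ¬ IsEigenvalue S z ∧
    Dense (Set.range fun x : S.domain => S x - z • (x : H))

/-! ### Discrete spectrum and Riesz projections -/

/-- The circle of radius `r > 0` about `z` separates the point `z` of the spectrum of `S` from the
rest of the spectrum. -/
def Separates (S : H →ₗ.[ℂ] H) (z : ℂ) (r : ℝ) : Prop :=
  0 < r ∧ Metric.closedBall z r ∩ spec S = {z}

open Classical in
/-- The Riesz projection `-(2πi)⁻¹ ∮ (S - ζ)⁻¹ dζ` of `S` at an isolated point `z` of its spectrum,
the contour being a positively oriented circle that separates `z` from the rest of the spectrum (by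
Cauchy's theorem the choice of the circle is immaterial); `0` if `z` is not such a point. -/
def rieszProj (S : H →ₗ.[ℂ] H) (z : ℂ) : H →L[ℂ] H :=
  if h : ∃ r : ℝ, Separates S z r then
    -((2 * (Real.pi : ℂ) * Complex.I)⁻¹ • ∮ ζ in C(z, h.choose), resolv S ζ)
  else 0

/-- The discrete spectrum: the isolated points of the spectrum of finite algebraic multiplicity. -/
def discreteSpec (S : H →ₗ.[ℂ] H) : Set ℂ :=
  {z | (∃ r : ℝ, Separates S z r) ∧
    FiniteDimensional ℂ (LinearMap.range (rieszProj S z : H →ₗ[ℂ] H))}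

/-- The Riesz projection of `S` that belongs to its (finite) discrete spectrum; the contour consists
of one small circle about each point. -/
def discreteProj (S : H →ₗ.[ℂ] H) : H →L[ℂ] H :=
  ∑ᶠ z ∈ discreteSpec S, rieszProj S z

/-- The invariant subspace of the discrete spectrum, the range of the Riesz projection. -/
def discreteSubspace (S : H →ₗ.[ℂ] H) : Submodule ℂ H :=
  LinearMap.range (discreteProj S : H →ₗ[ℂ] H)

/-- The invariant subspace of the complementary part of the spectrum, the range of `I - P` for the
Riesz projection `P`. -/
def continuousSubspace (S : H →ₗ.[ℂ] H) : Submodule ℂ H :=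
  LinearMap.range ((1 - discreteProj S : H →L[ℂ] H) : H →ₗ[ℂ] H)

/-! ### Relative smoothness and boundary values -/

/-- The bounded operator `A` is smooth relative to `S`: for each `φ` the vector function
`A (S - z)⁻¹ φ` is in the Hardy classes `H₂` of the upper and of the lower half-plane. -/
def IsSmooth (A : H →L[ℂ] H) (S : H →ₗ.[ℂ] H) : Prop :=
  ∀ φ : H, ∃ C : ℝ≥0, ∀ ε : ℝ, 0 < ε →
    ∫⁻ k : ℝ, ‖A (resolv S ((k : ℂ) + ε * Complex.I) φ)‖ₑ ^ 2 ≤ C ∧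
    ∫⁻ k : ℝ, ‖A (resolv S ((k : ℂ) - ε * Complex.I) φ)‖ₑ ^ 2 ≤ C

/-- The limit `F (k + i0)` exists for almost all real `k`. -/
def HasUpperBoundaryValues (F : ℂ → H) : Prop :=
  ∀ᵐ k : ℝ, ∃ y : H, Tendsto (fun ε : ℝ => F ((k : ℂ) + ε * Complex.I)) (𝓝[>] 0) (𝓝 y)

/-- The boundary value `F (k + i0)`. -/
def upperBoundaryValue (F : ℂ → H) (k : ℝ) : H :=
  limUnder (𝓝[>] (0 : ℝ)) fun ε : ℝ => F ((k : ℂ) + ε * Complex.I)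

/-! ### Stationary wave operators

The scalar product `(x, y)`, linear in `x`, is `inner ℂ y x`. -/

variable [CompleteSpace H]

/-- `W` is the direct wave operator:
`(W φ, ψ) = (φ, ψ) - (2πi)⁻¹ ∫ (A R₀(k+i0) φ, B R_V^*(k+i0) ψ) dk` for `ψ` in the subspace `H_c^*`
of `L^*`, and `(W φ, ψ) = 0` for `ψ` in the subspace `H_d^*` of `L^*`, where `R₀` is the resolvent
of `T` and `R_V^*` is the resolvent of `L^*`. -/
def IsDirectWaveOperator (T L : H →ₗ.[ℂ] H) (A B W : H →L[ℂ] H) : Prop :=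
  (∀ φ : H, ∀ ψ ∈ continuousSubspace L†,
    HasUpperBoundaryValues (fun z => A (resolv T z φ)) ∧
    HasUpperBoundaryValues (fun z => B (resolv L† z ψ)) ∧
    Integrable (fun k : ℝ => inner ℂ
      (upperBoundaryValue (fun z => B (resolv L† z ψ)) k)
      (upperBoundaryValue (fun z => A (resolv T z φ)) k)) ∧
    inner ℂ ψ (W φ) = inner ℂ ψ φ - (2 * (Real.pi : ℂ) * Complex.I)⁻¹ *
      ∫ k : ℝ, inner ℂ
        (upperBoundaryValue (fun z => B (resolv L† z ψ)) k)
        (upperBoundaryValue (fun z => A (resolv T z φ)) k)) ∧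
  (∀ φ : H, ∀ ψ ∈ discreteSubspace L†, inner ℂ ψ (W φ) = 0)

/-- `Z` is the inverse wave operator:
`(Z φ, ψ) = (φ, ψ) + (2πi)⁻¹ ∫ (A R_V(s+i0) φ, B R₀^*(s+i0) ψ) ds` for `φ` in the subspace `H_c`
of `L`, and `(Z φ, ψ) = 0` for `φ` in the subspace `H_d` of `L`, where `R_V` is the resolvent of `L`
and `R₀^*` is the resolvent of `T^*`. -/
def IsInverseWaveOperator (T L : H →ₗ.[ℂ] H) (A B Z : H →L[ℂ] H) : Prop :=
  (∀ φ ∈ continuousSubspace L, ∀ ψ : H,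
    HasUpperBoundaryValues (fun z => A (resolv L z φ)) ∧
    HasUpperBoundaryValues (fun z => B (resolv T† z ψ)) ∧
    Integrable (fun s : ℝ => inner ℂ
      (upperBoundaryValue (fun z => B (resolv T† z ψ)) s)
      (upperBoundaryValue (fun z => A (resolv L z φ)) s)) ∧
    inner ℂ ψ (Z φ) = inner ℂ ψ φ + (2 * (Real.pi : ℂ) * Complex.I)⁻¹ *
      ∫ s : ℝ, inner ℂ
        (upperBoundaryValue (fun z => B (resolv T† z ψ)) s)
        (upperBoundaryValue (fun z => A (resolv L z φ)) s)) ∧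
  (∀ φ ∈ discreteSubspace L, ∀ ψ : H, inner ℂ ψ (Z φ) = 0)

/-- The product `W T Z` on its natural domain, all `x` such that `Z x` is in the domain of `T`. -/
def conjugate (W : H →L[ℂ] H) (T : H →ₗ.[ℂ] H) (Z : H →L[ℂ] H) : H →ₗ.[ℂ] H where
  domain := T.domain.comap (Z : H →ₗ[ℂ] H)
  toFun := (W : H →ₗ[ℂ] H) ∘ₗ T.toFun ∘ₗ
    (Z : H →ₗ[ℂ] H).restrict (p := T.domain.comap (Z : H →ₗ[ℂ] H)) (q := T.domain)
      fun _ hx => hx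

/-! ### Exponentials -/

open Classical in
/-- The operator `(I - c S)⁻¹`, which for `c = 0` is the identity of the whole space. -/
def eulerStep (S : H →ₗ.[ℂ] H) (c : ℂ) : H →L[ℂ] H :=
  if c = 0 then 1 else boundedInverse (affine 1 (-c) S)

/-- `U = exp (i t S)`, that is, `U` is the strong limit of `(I - i t S / n)⁻ⁿ` as `n → ∞`. -/
def IsExp (S : H →ₗ.[ℂ] H) (t : ℝ) (U : H →L[ℂ] H) : Prop :=
  ∀ φ : H, Tendsto (fun n : ℕ => (eulerStep S (Complex.I * t / n) ^ n) φ) atTop (𝓝 (U φ))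

end

end KatoModel

open KatoModel

/-! This is Kato's stationary method, carried out in the Hardy space `H₂` of the upper half-plane.
Write `X^#(z) = X(z̄)^*` and split `R_V = Q + N` with `Q = R_V (I - P)` and `N = R_V P`. The part
`Q` extends holomorphically over the discrete spectrum, and `N` is bounded away from it. Smoothness
makes `A R₀ x` and `B R₀^# y` Hardy functions; the second resolvent identity and (iii) carry this
over to `A Q x` and `B Q^# y`. By the closed graph theorem the boundary functions of these four
families define bounded operators `a`, `b`, `a'`, `b'` from `H` to `L²(ℝ; H)`. Then `W = I - P -
(2πi)⁻¹ b'^* a` and `Z = I - P + (2πi)⁻¹ b^* a'` satisfy the stationary formulas. Uniqueness holds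
because `H_c^* + H_d^*` and `H_c + H_d` are the whole space.

The algebra is checked on the Cauchy kernels `κ(k) = (k - w̄)⁻¹ u`. Those with `Im w > 0` span the
Hardy space and reproduce values at `w`; those with `Im w < 0` are orthogonal to it. Under `a`, the
operator `R₀(w)` becomes multiplication by `(k - w)⁻¹` up to a kernel orthogonal to the Hardy space,
and this gives `W R₀ = Q W` (`WaveOps.W_R`).

For `W Z = I - P` (`WaveOps.W_Z`), the identity `⟨κ, a Z x⟩ = ⟨(1 + B R₀^# A^*) κ, a' x⟩` is
verified on kernels and extended to all Hardy functions by `inner_bdry_eq_of_kern`. It is then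
applied to `B Q^# y`, which `1 + B R₀^# A^*` sends to `B R₀^# (I - P^*) y`.

Since `W (Z W - I) = 0`, the relation `Z W = I` reduces to the injectivity of `W`. If `W x = 0` and
`P x = 0`, a duality identity for `Q`, together with `(1 - B R_V^# A^*)(1 + B R₀^# A^*) = 1` on the
boundary, shows that `a x` is orthogonal to every kernel; hence `a x = 0` and `x = 0`. So `P` embeds
`ker W` into a finite-dimensional space. As `ker W` is invariant under `R₀(i)`, it would contain an
eigenvector if it were nonzero, which the purely continuous spectrum forbids. The similarity of `T`
and `L_c` follows from these relations at a single regular point (`Intertwines`).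

For selfadjoint `T` the Euler steps are commuting contractions and converge on the domain of `T²`.
Under `a` they become compressions of multiplication operators to the Hardy space, for which the
kernels are decaying eigenvectors; hence `a exp(-itT) x → 0`. A contour integral then gives `P
exp(-itT) x → 0`, so `(W - I) exp(-itT) → 0` strongly. With `exp(itL)(I - P) = W exp(itT) Z` both
limits follow. -/

namespace KatoModel

/-! ### Resolvents described by graphs: resolvent identities, Neumann series, adjoints,
perturbations. -/

section Resolvent

variable {H : Type*} [NormedAddCommGroup H] [InnerProductSpace ℂ H]

/-- `R` is the resolvent of `S` at `z`, in terms of the graph of `S`. -/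
def IsResolventAt (S : H →ₗ.[ℂ] H) (z : ℂ) (R : H →L[ℂ] H) : Prop :=
  (∀ x, (R x, x + z • R x) ∈ S.graph) ∧ ∀ x y, (x, y) ∈ S.graph → R (y - z • x) = x

theorem mem_graph_of_mem {S : H →ₗ.[ℂ] H} {x y : H} (h : x ∈ S.domain) (hy : S ⟨x, h⟩ = y) :
    (x, y) ∈ S.graph := by
  rw [LinearPMap.mem_graph_iff]
  exact ⟨⟨x, h⟩, rfl, hy⟩

theorem exists_of_mem_graph {S : H →ₗ.[ℂ] H} {x y : H} (h : (x, y) ∈ S.graph) :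
    ∃ h : x ∈ S.domain, S ⟨x, h⟩ = y := by
  rw [LinearPMap.mem_graph_iff] at h
  obtain ⟨u, hu, hy⟩ := h
  simp only at hu hy
  subst hu
  exact ⟨u.2, hy⟩

/-- The hypothesis on `a` says that the operator is `b (S - z)`. This form covers both `S - z`
(resolvents) and `1 - c S` (Euler steps). -/
theorem isBoundedInverse_affine_iff {S : H →ₗ.[ℂ] H} {a b z : ℂ} (hb : b ≠ 0) (ha : a = -(b * z))
    {R : H →L[ℂ] H} : IsBoundedInverse (affine a b S) R ↔ IsResolventAt S z (b • R) := by
  have happ : ∀ x : S.domain, (affine a b S) x = a • (x : H) + b • S x := fun x => rfl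
  subst ha
  constructor
  · rintro ⟨h1, h2⟩
    refine ⟨fun x => ?_, fun x y hxy => ?_⟩
    · obtain ⟨h, hx⟩ := h1 x
      have h' : R x ∈ S.domain := h
      have hx' : -(b * z) • R x + b • S ⟨R x, h'⟩ = x := hx
      have := S.graph.smul_mem b (mem_graph_of_mem h' rfl)
      convert this using 1
      refine Prod.ext rfl ?_
      change x + z • b • R x = b • S ⟨R x, h'⟩
      nth_rewrite 1 [← hx']
      module
    · obtain ⟨h, rfl⟩ := exists_of_mem_graph hxy
      have h3 : R (-(b * z) • x + b • S ⟨x, h⟩) = x := h2 ⟨x, h⟩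
      calc (b • R) (S ⟨x, h⟩ - z • x) = R (-(b * z) • x + b • S ⟨x, h⟩) := by
            rw [smul_apply, ← map_smul]; congr 1; module
        _ = x := h3
  · rintro ⟨h1, h2⟩
    refine ⟨fun x => ?_, fun x => ?_⟩
    · have h3 := S.graph.smul_mem b⁻¹ (h1 x)
      have h4 : b⁻¹ • ((b • R) x, x + z • (b • R) x) = (R x, b⁻¹ • x + z • R x) := by
        refine Prod.ext ?_ ?_
        · simp [smul_smul, hb]
        · simp only [smul_apply, Prod.smul_mk, smul_add, smul_smul]
          congr 2
          field_simp
      rw [h4] at h3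
      obtain ⟨h, hx⟩ := exists_of_mem_graph h3
      refine ⟨h, ?_⟩
      change -(b * z) • R x + b • S ⟨R x, h⟩ = x
      rw [hx, smul_add, smul_smul, mul_inv_cancel₀ hb]
      module
    · have h3 := h2 x (S x) (mem_graph_of_mem x.2 rfl)
      change R (-(b * z) • (x : H) + b • S x) = x
      refine Eq.trans ?_ h3
      simp only [smul_apply, map_add, map_sub, map_smul]
      module

theorem isBoundedInverse_affine_neg_one_iff {S : H →ₗ.[ℂ] H} {z : ℂ} {R : H →L[ℂ] H} :
    IsBoundedInverse (affine (-z) 1 S) R ↔ IsResolventAt S z R := by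
  simpa using isBoundedInverse_affine_iff (S := S) (R := R) (a := -z) (b := 1) (z := z)
    one_ne_zero (by simp)

namespace IsResolventAt

variable {S : H →ₗ.[ℂ] H} {z w : ℂ} {R Q : H →L[ℂ] H}

theorem sub_eq (hR : IsResolventAt S z R) (hQ : IsResolventAt S w Q) :
    R - Q = (z - w) • (R ∘L Q) := by
  ext x
  have h := hR.2 _ _ (hQ.1 x)
  have h' : R (x + w • Q x - z • Q x) = R x - (z - w) • R (Q x) := by
    simp only [map_add, map_sub, map_smul]; module
  rw [h'] at h
  simp only [sub_apply, smul_apply, ContinuousLinearMap.comp_apply]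
  nth_rewrite 1 [← h]
  abel

theorem unique (hR : IsResolventAt S z R) (hQ : IsResolventAt S z Q) : R = Q := by
  simpa [sub_eq_zero] using hR.sub_eq hQ

theorem comm (hR : IsResolventAt S z R) (hQ : IsResolventAt S w Q) : R ∘L Q = Q ∘L R := by
  by_cases h : z = w
  · subst h
    rw [hR.unique hQ]
  · have h1 := hR.sub_eq hQ
    have h2 := hQ.sub_eq hR
    have h3 : (z - w) • (R ∘L Q) = (z - w) • (Q ∘L R) := by
      rw [← h1, ← neg_sub Q R, h2]; module
    exact smul_right_injective _ (sub_ne_zero.2 h) h3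

/-- A converse of the resolvent identity, producing resolvents at new points. Both orders are
needed: `h2` puts the range of `R` into the domain and gives the right inverse, `h1` gives the left
inverse. -/
theorem of_eq (hQ : IsResolventAt S w Q) (h1 : R = Q + (z - w) • (R ∘L Q))
    (h2 : R = Q + (z - w) • (Q ∘L R)) : IsResolventAt S z R := by
  have h1' : ∀ x, R x = Q x + (z - w) • R (Q x) := fun x => by
    nth_rewrite 1 [h1]; rfl
  have h2' : ∀ x, R x = Q (x + (z - w) • R x) := fun x => by
    nth_rewrite 1 [h2]; simp
  refine ⟨fun x => ?_, fun x y hxy => ?_⟩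
  · have := hQ.1 (x + (z - w) • R x)
    rw [← h2' x] at this
    convert this using 2
    module
  · have h3 := hQ.2 x y hxy
    have h4 := h1' (y - w • x)
    rw [h3] at h4
    have h5 : R (y - z • x) = R (y - w • x) - (z - w) • R x := by
      rw [← map_smul, ← map_sub]; congr 1; module
    rw [h5, h4]
    abel

end IsResolventAt

theorem notMem_spec_iff {S : H →ₗ.[ℂ] H} {z : ℂ} : z ∉ spec S ↔ ∃ R, IsResolventAt S z R := by
  simp only [spec, Set.mem_ofPred_eq, not_not, isBoundedInverse_affine_neg_one_iff]

theorem isResolventAt_resolv {S : H →ₗ.[ℂ] H} {z : ℂ} (hz : z ∉ spec S) :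
    IsResolventAt S z (resolv S z) := by
  have h : ∃ R, IsBoundedInverse (affine (-z) 1 S) R := by
    simpa [spec] using hz
  rw [← isBoundedInverse_affine_neg_one_iff, resolv, boundedInverse, dif_pos h]
  exact h.choose_spec

namespace IsResolventAt

variable {S : H →ₗ.[ℂ] H} {z w : ℂ} {R Q : H →L[ℂ] H}

theorem notMem_spec (hR : IsResolventAt S z R) : z ∉ spec S := notMem_spec_iff.2 ⟨R, hR⟩

theorem resolv_eq (hR : IsResolventAt S z R) : resolv S z = R :=
  (isResolventAt_resolv hR.notMem_spec).unique hR

end IsResolventAt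

theorem resolv_sub {S : H →ₗ.[ℂ] H} {z w : ℂ} (hz : z ∉ spec S) (hw : w ∉ spec S) :
    resolv S z - resolv S w = (z - w) • (resolv S z ∘L resolv S w) :=
  (isResolventAt_resolv hz).sub_eq (isResolventAt_resolv hw)

theorem eulerStep_eq {S : H →ₗ.[ℂ] H} {c : ℂ} (hc : c ≠ 0) (h : c⁻¹ ∉ spec S) :
    eulerStep S c = -c⁻¹ • resolv S c⁻¹ := by
  have h1 : ∀ R, IsBoundedInverse (affine 1 (-c) S) R ↔ IsResolventAt S c⁻¹ (-c • R) := fun R =>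
    isBoundedInverse_affine_iff (neg_ne_zero.2 hc) (by simp [hc])
  have h2 : IsBoundedInverse (affine 1 (-c) S) (-c⁻¹ • resolv S c⁻¹) := by
    rw [h1, smul_smul]
    simpa [hc] using isResolventAt_resolv h
  have h3 : ∃ R, IsBoundedInverse (affine 1 (-c) S) R := ⟨_, h2⟩
  rw [eulerStep, if_neg hc, boundedInverse, dif_pos h3]
  have h4 := ((h1 _).1 h3.choose_spec).unique ((h1 _).1 h2)
  exact smul_right_injective _ (neg_ne_zero.2 hc) h4

section Complete

variable [CompleteSpace H]

/-- For `z` close to `w` the operator `1 - (z - w) R(w)` is invertible by the Neumann series, and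
its inverse times `R(w)` satisfies both orders of the resolvent identity. -/
theorem eventually_resolv_eq {S : H →ₗ.[ℂ] H} {w : ℂ} (hw : w ∉ spec S) :
    ∀ᶠ z in 𝓝 w, z ∉ spec S ∧
      resolv S z = Ring.inverse (1 - (z - w) • resolv S w) * resolv S w := by
  set Q := resolv S w with hQ
  have hcont : Tendsto (fun z : ℂ => ‖(z - w) • Q‖) (𝓝 w) (𝓝 0) := by
    have : Continuous fun z : ℂ => ‖(z - w) • Q‖ := by fun_prop
    simpa using this.tendsto w
  filter_upwards [hcont.eventually (gt_mem_nhds zero_lt_one)] with z hz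
  have hu : IsUnit (1 - (z - w) • Q) := (Units.oneSub _ hz).isUnit
  set U := Ring.inverse (1 - (z - w) • Q)
  have e1 : U * (1 - (z - w) • Q) = 1 := Ring.inverse_mul_cancel _ hu
  have e2 : (1 - (z - w) • Q) * U = 1 := Ring.mul_inverse_cancel _ hu
  have e1' : U = 1 + (z - w) • (U * Q) := by
    rw [mul_sub, mul_one, sub_eq_iff_eq_add, mul_smul_comm] at e1; exact e1
  have e2' : U = 1 + (z - w) • (Q * U) := by
    rw [sub_mul, one_mul, sub_eq_iff_eq_add, smul_mul_assoc] at e2; exact e2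
  have hres : IsResolventAt S z (U * Q) := by
    refine (isResolventAt_resolv hw).of_eq ?_ ?_
    · change U * Q = Q + (z - w) • (U * Q * Q)
      nth_rewrite 1 [e1']
      rw [add_mul, one_mul, smul_mul_assoc]
    · change U * Q = Q + (z - w) • (Q * (U * Q))
      nth_rewrite 1 [e2']
      rw [add_mul, one_mul, smul_mul_assoc, mul_assoc]
  exact ⟨hres.notMem_spec, hres.resolv_eq⟩

theorem isOpen_compl_spec (S : H →ₗ.[ℂ] H) : IsOpen (spec S)ᶜ := by
  rw [isOpen_iff_mem_nhds]
  intro w hw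
  filter_upwards [eventually_resolv_eq hw] with z hz using hz.1

theorem differentiableAt_resolv {S : H →ₗ.[ℂ] H} {w : ℂ} (hw : w ∉ spec S) :
    DifferentiableAt ℂ (resolv S) w := by
  have h : resolv S =ᶠ[𝓝 w] fun z => Ring.inverse (1 - (z - w) • resolv S w) * resolv S w := by
    filter_upwards [eventually_resolv_eq hw] with z hz using hz.2
  refine DifferentiableAt.congr_of_eventuallyEq ?_ h
  refine DifferentiableAt.mul ?_ (differentiableAt_const _)
  have h1 : DifferentiableAt ℂ Ring.inverse (1 - (w - w) • resolv S w) := by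
    refine differentiableAt_inverse ?_
    simp
  exact h1.comp w (f := fun z : ℂ => 1 - (z - w) • resolv S w) (by fun_prop)

theorem mem_graph_adjoint_iff {S : H →ₗ.[ℂ] H} (hS : Dense (S.domain : Set H)) {x y : H} :
    (x, y) ∈ S†.graph ↔ ∀ a b, (a, b) ∈ S.graph → inner ℂ y a = inner ℂ x b := by
  constructor
  · intro h a b hab
    obtain ⟨hx, rfl⟩ := exists_of_mem_graph h
    obtain ⟨ha, rfl⟩ := exists_of_mem_graph hab
    exact LinearPMap.adjoint_isFormalAdjoint hS ⟨x, hx⟩ ⟨a, ha⟩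
  · intro h
    have h1 : ∀ a : S.domain, inner ℂ y (a : H) = inner ℂ x (S a) := fun a =>
      h a (S a) (mem_graph_of_mem a.2 rfl)
    have hx : x ∈ S†.domain := LinearPMap.mem_adjoint_domain_of_exists x ⟨y, h1⟩
    exact mem_graph_of_mem hx (LinearPMap.adjoint_apply_eq hS ⟨x, hx⟩ h1)

open ContinuousLinearMap in
theorem IsResolventAt.adjoint {S : H →ₗ.[ℂ] H} (hS : Dense (S.domain : Set H)) {z : ℂ}
    {R : H →L[ℂ] H} (hR : IsResolventAt S z R) :
    IsResolventAt S† (starRingEnd ℂ z) (ContinuousLinearMap.adjoint R) := by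
  refine ⟨fun x => ?_, fun x y hxy => ?_⟩
  · rw [mem_graph_adjoint_iff hS]
    intro a b hab
    have h1 : R b = a + z • R a := by
      have h := hR.2 a b hab
      rw [map_sub, map_smul, sub_eq_iff_eq_add] at h
      exact h
    rw [adjoint_inner_left, h1, inner_add_left, inner_smul_left, inner_add_right, inner_smul_right,
      adjoint_inner_left]
    simp
  · refine ext_inner_right ℂ fun v => ?_
    have h1 := (mem_graph_adjoint_iff hS).1 hxy _ _ (hR.1 v)
    rw [adjoint_inner_left, inner_sub_left, inner_smul_left, h1, inner_add_right, inner_smul_right]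
    simp

/-- One regular point `w` replaces the relation `S†† = S`. A resolvent of `S†` at `conj z` is tied
to `R(w)^*` by the resolvent identity; taking adjoints and using `of_eq` gives a resolvent of `S` at
`z`. -/
theorem mem_spec_adjoint_iff {S : H →ₗ.[ℂ] H} (hS : Dense (S.domain : Set H))
    (hne : ∃ w, w ∉ spec S) {z : ℂ} : starRingEnd ℂ z ∈ spec S† ↔ z ∈ spec S := by
  rw [← not_iff_not]
  constructor
  · intro h
    obtain ⟨w, hw⟩ := hne
    have hR := isResolventAt_resolv h
    have hQ := isResolventAt_resolv hw
    have h1 := hR.sub_eq (hQ.adjoint hS)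
    have h2 := h1
    rw [hR.comm (hQ.adjoint hS)] at h2
    rw [sub_eq_iff_eq_add', ← map_sub] at h1 h2
    refine IsResolventAt.notMem_spec (R := ContinuousLinearMap.adjoint (resolv S† (starRingEnd ℂ z)))
      (hQ.of_eq ?_ ?_)
    · have := congrArg ContinuousLinearMap.adjoint h2
      simpa [map_add, map_smulₛₗ, ContinuousLinearMap.adjoint_comp] using this
    · have := congrArg ContinuousLinearMap.adjoint h1
      simpa [map_add, map_smulₛₗ, ContinuousLinearMap.adjoint_comp] using this
  · intro h
    exact ((isResolventAt_resolv h).adjoint hS).notMem_spec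

theorem resolv_adjoint {S : H →ₗ.[ℂ] H} (hS : Dense (S.domain : Set H)) {z : ℂ} (hz : z ∉ spec S) :
    resolv S† (starRingEnd ℂ z) = ContinuousLinearMap.adjoint (resolv S z) :=
  ((isResolventAt_resolv hz).adjoint hS).resolv_eq

end Complete

theorem mem_graph_vadd_iff {T : H →ₗ.[ℂ] H} {V : H →L[ℂ] H} {x y : H} :
    (x, y) ∈ ((V : H →ₗ[ℂ] H) +ᵥ T).graph ↔ (x, y - V x) ∈ T.graph := by
  constructor
  · intro h
    obtain ⟨hx, rfl⟩ := exists_of_mem_graph h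
    exact mem_graph_of_mem (S := T) hx (by simp [LinearPMap.vadd_apply])
  · intro h
    obtain ⟨hx, hy⟩ := exists_of_mem_graph h
    refine mem_graph_of_mem (S := (V : H →ₗ[ℂ] H) +ᵥ T) hx ?_
    rw [LinearPMap.vadd_apply]
    change V x + T ⟨x, hx⟩ = y
    rw [hy]; abel

/-- The second resolvent identity. Here the perturbed resolvent acts as left inverse on the range of
`Q`; in `vadd_right` the roles are exchanged. -/
theorem IsResolventAt.vadd_left {T : H →ₗ.[ℂ] H} {V R Q : H →L[ℂ] H} {z : ℂ}
    (hQ : IsResolventAt T z Q) (hR : IsResolventAt ((V : H →ₗ[ℂ] H) +ᵥ T) z R) :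
    Q - R = R ∘L V ∘L Q := by
  ext x
  have h1 : (Q x, x + z • Q x + V (Q x)) ∈ ((V : H →ₗ[ℂ] H) +ᵥ T).graph := by
    rw [mem_graph_vadd_iff]; simpa using hQ.1 x
  have h2 := hR.2 _ _ h1
  have h3 : R (x + z • Q x + V (Q x) - z • Q x) = R x + R (V (Q x)) := by
    rw [← map_add]; congr 1; abel
  rw [h3] at h2
  simp only [sub_apply, ContinuousLinearMap.comp_apply]
  nth_rewrite 1 [← h2]
  abel

theorem IsResolventAt.vadd_right {T : H →ₗ.[ℂ] H} {V R Q : H →L[ℂ] H} {z : ℂ}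
    (hQ : IsResolventAt T z Q) (hR : IsResolventAt ((V : H →ₗ[ℂ] H) +ᵥ T) z R) :
    Q - R = Q ∘L V ∘L R := by
  ext x
  have h1 := mem_graph_vadd_iff.1 (hR.1 x)
  have h2 := hQ.2 _ _ h1
  have h3 : Q (x + z • R x - V (R x) - z • R x) = Q x - Q (V (R x)) := by
    rw [← map_sub]; congr 1; abel
  rw [h3] at h2
  simp only [sub_apply, ContinuousLinearMap.comp_apply]
  nth_rewrite 1 [← h2]
  abel

end Resolvent

/-! ### Riesz projections at isolated points of the spectrum. -/

section Riesz

open Metric Complex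

theorem circleIntegral_clm_comp {E F : Type*} [NormedAddCommGroup E] [NormedSpace ℂ E]
    [CompleteSpace E] [NormedAddCommGroup F] [NormedSpace ℂ F] [CompleteSpace F]
    (Φ : E →L[ℂ] F) {f : ℂ → E} {c : ℂ} {r : ℝ} (hf : CircleIntegrable f c r) :
    ∮ z in C(c, r), Φ (f z) = Φ (∮ z in C(c, r), f z) := by
  rw [circleIntegral, circleIntegral, ← ContinuousLinearMap.intervalIntegral_comp_comm Φ hf.out]
  simp

theorem circleIntegral_eq_zero_of_bddAbove {E : Type*} [NormedAddCommGroup E] [NormedSpace ℂ E]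
    [CompleteSpace E] {f : ℂ → E} {c : ℂ} {r : ℝ} (hr : 0 < r) {s : Set ℂ} (hs : IsOpen s)
    (hrs : closedBall c r ⊆ s) (hd : DifferentiableOn ℂ f (s \ {c}))
    {C : ℝ} (hC : ∀ᶠ z in 𝓝[≠] c, ‖f z‖ ≤ C) :
    ∮ z in C(c, r), f z = 0 := by
  obtain ⟨ε, hε, hε'⟩ := Metric.eventually_nhds_iff_ball.1 (eventually_nhdsWithin_iff.1 hC)
  have hcs : c ∈ s := hrs (mem_closedBall_self hr.le)
  set g := Function.update f c (limUnder (𝓝[≠] c) f) with hg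
  have hgd : DifferentiableOn ℂ g s := by
    have h1 : DifferentiableOn ℂ g (s ∩ ball c ε) := by
      refine differentiableOn_update_limUnder_of_bddAbove ?_ (hd.mono ?_) ⟨C, ?_⟩
      · exact inter_mem (hs.mem_nhds hcs) (ball_mem_nhds c hε)
      · rintro z ⟨hz, hz'⟩
        exact ⟨hz.1, hz'⟩
      · rintro _ ⟨z, ⟨hz, hz'⟩, rfl⟩
        exact hε' z hz.2 hz'
    intro z hz
    by_cases hzc : z = c
    · subst hzc
      exact (h1.differentiableAt (inter_mem (hs.mem_nhds hcs)
        (ball_mem_nhds z hε))).differentiableWithinAt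
    · have h2 : DifferentiableAt ℂ f z := hd.differentiableAt
        ((hs.sdiff isClosed_singleton).mem_nhds ⟨hz, hzc⟩)
      refine (h2.congr_of_eventuallyEq ?_).differentiableWithinAt
      filter_upwards [isOpen_ne.mem_nhds hzc] with y hy
      simp [hg, Function.update_of_ne (show y ≠ c from hy)]
  have h3 : ∮ z in C(c, r), f z = ∮ z in C(c, r), g z := by
    refine circleIntegral.integral_congr hr.le fun z hz => ?_
    have : z ≠ c := by
      rintro rfl
      simp [hr.ne'.symm] at hz
    simp [hg, Function.update_of_ne this]
  rw [h3]
  exact (hgd.diffContOnCl_ball hrs).circleIntegral_eq_zero hr.le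

variable {H : Type*} [NormedAddCommGroup H] [InnerProductSpace ℂ H] {S : H →ₗ.[ℂ] H}
  {z w : ℂ} {r : ℝ}

theorem Separates.mem_spec (h : Separates S z r) : z ∈ spec S :=
  ((Set.ext_iff.1 h.2 z).2 rfl).2

theorem Separates.notMem (h : Separates S z r) (hw : w ∈ closedBall z r) (hwz : w ≠ z) :
    w ∉ spec S := fun hws => hwz ((Set.ext_iff.1 h.2 w).1 ⟨hw, hws⟩)

theorem Separates.notMem_of_mem_sphere (h : Separates S z r) (hw : w ∈ sphere z r) : w ∉ spec S :=
  h.notMem (sphere_subset_closedBall hw) fun h' => by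
    subst h'; simp [h.1.ne] at hw

theorem Separates.mono (h : Separates S z r) {r' : ℝ} (h0 : 0 < r') (hr : r' ≤ r) :
    Separates S z r' := by
  refine ⟨h0, Set.Subset.antisymm ?_ ?_⟩
  · rw [← h.2]
    exact Set.inter_subset_inter_left _ (closedBall_subset_closedBall hr)
  · rintro _ rfl
    exact ⟨mem_closedBall_self h0.le, h.mem_spec⟩

variable [CompleteSpace H]

theorem continuousOn_resolv {s : Set ℂ} (hs : ∀ z ∈ s, z ∉ spec S) : ContinuousOn (resolv S) s :=
  fun z hz => (differentiableAt_resolv (hs z hz)).continuousAt.continuousWithinAt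

theorem Separates.circleIntegrable (h : Separates S z r) : CircleIntegrable (resolv S) z r :=
  (continuousOn_resolv fun _ hw => h.notMem_of_mem_sphere hw).circleIntegrable h.1.le

/-- Removes the dependence on the chosen radius: the resolvent is holomorphic on the annulus between
two separating circles. -/
theorem rieszProj_eq (h : Separates S z r) :
    rieszProj S z = -((2 * (Real.pi : ℂ) * I)⁻¹ • ∮ ζ in C(z, r), resolv S ζ) := by
  have key : ∀ r₁ r₂, Separates S z r₁ → Separates S z r₂ → r₁ ≤ r₂ →
      (∮ ζ in C(z, r₂), resolv S ζ) = ∮ ζ in C(z, r₁), resolv S ζ := by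
    intro r₁ r₂ h1 h2 hle
    refine circleIntegral_eq_of_differentiable_on_annulus_off_countable h1.1 hle
      Set.countable_empty (continuousOn_resolv fun w hw => ?_) fun w hw => ?_
    · refine h2.notMem hw.1 ?_
      rintro rfl
      exact hw.2 (mem_ball_self h1.1)
    · refine differentiableAt_resolv (h2.notMem (ball_subset_closedBall hw.1.1) ?_)
      rintro rfl
      exact hw.1.2 (mem_closedBall_self h1.1.le)
  have hex : ∃ r, Separates S z r := ⟨r, h⟩
  rw [rieszProj, dif_pos hex]
  congr 2
  rcases le_total r hex.choose with hle | hle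
  · exact key _ _ h hex.choose_spec hle
  · exact (key _ _ hex.choose_spec h hle).symm

theorem mul_rieszProj (h : Separates S z r) (X : H →L[ℂ] H) :
    X ∘L rieszProj S z = -((2 * (Real.pi : ℂ) * I)⁻¹ • ∮ ζ in C(z, r), X ∘L resolv S ζ) := by
  have h1 := circleIntegral_clm_comp (ContinuousLinearMap.compL ℂ H H H X) h.circleIntegrable
  simp only [ContinuousLinearMap.compL_apply] at h1
  rw [rieszProj_eq h, h1]
  simp

theorem rieszProj_mul (h : Separates S z r) (X : H →L[ℂ] H) :
    rieszProj S z ∘L X = -((2 * (Real.pi : ℂ) * I)⁻¹ • ∮ ζ in C(z, r), resolv S ζ ∘L X) := by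
  have h1 := circleIntegral_clm_comp ((ContinuousLinearMap.compL ℂ H H H).flip X)
    h.circleIntegrable
  simp only [ContinuousLinearMap.compL_apply, ContinuousLinearMap.flip_apply] at h1
  rw [rieszProj_eq h, h1]
  simp

omit [CompleteSpace H] in
theorem rieszProj_of_not (h : ¬ ∃ r, Separates S z r) : rieszProj S z = 0 := by
  rw [rieszProj, dif_neg h]

theorem resolv_comm_rieszProj (hw : w ∉ spec S) :
    resolv S w ∘L rieszProj S z = rieszProj S z ∘L resolv S w := by
  by_cases h : ∃ r, Separates S z r
  · obtain ⟨r, h⟩ := h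
    rw [mul_rieszProj h, rieszProj_mul h]
    congr 2
    refine circleIntegral.integral_congr h.1.le fun ζ hζ => ?_
    exact (isResolventAt_resolv hw).comm (isResolventAt_resolv (h.notMem_of_mem_sphere hζ))
  · simp [rieszProj_of_not h]

/-- Integrates `R(w) R(ζ) = (ζ - w)⁻¹ (R(ζ) - R(w))` around the circle. The scalar integral in the
first term is `0` or `2πi` according to the side on which `w` lies; this is the source of the next
two bounds. -/
theorem resolv_mul_rieszProj (h : Separates S z r) (hw : w ∉ spec S) (hwr : w ∉ sphere z r) :
    resolv S w ∘L rieszProj S z =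
      (2 * (Real.pi : ℂ) * I)⁻¹ • ((∮ ζ in C(z, r), (ζ - w)⁻¹) • resolv S w) -
      (2 * (Real.pi : ℂ) * I)⁻¹ • ∮ ζ in C(z, r), (ζ - w)⁻¹ • resolv S ζ := by
  have hne : ∀ ζ ∈ sphere z r, ζ - w ≠ 0 := fun ζ hζ h' => hwr (by rwa [← sub_eq_zero.1 h'])
  have hc : ContinuousOn (fun ζ : ℂ => (ζ - w)⁻¹) (sphere z r) :=
    ContinuousOn.inv₀ (by fun_prop) hne
  have hi : CircleIntegrable (fun ζ => (ζ - w)⁻¹ • resolv S ζ) z r :=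
    (hc.smul (continuousOn_resolv fun _ hw => h.notMem_of_mem_sphere hw)).circleIntegrable h.1.le
  have hi' : CircleIntegrable (fun ζ => (ζ - w)⁻¹ • resolv S w) z r :=
    (hc.smul continuousOn_const).circleIntegrable h.1.le
  have h2 : (∮ ζ in C(z, r), resolv S w ∘L resolv S ζ) =
      (∮ ζ in C(z, r), (ζ - w)⁻¹ • resolv S ζ) - (∮ ζ in C(z, r), (ζ - w)⁻¹) • resolv S w := by
    rw [← circleIntegral.integral_smul_const, ← circleIntegral.integral_sub hi hi']
    refine circleIntegral.integral_congr h.1.le fun ζ hζ => ?_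
    have h3 := (isResolventAt_resolv (h.notMem_of_mem_sphere hζ))
    have h4 := isResolventAt_resolv hw
    rw [← h3.comm h4, ← smul_sub, h3.sub_eq h4, smul_smul, inv_mul_cancel₀ (hne ζ hζ), one_smul]
  rw [mul_rieszProj h, h2, smul_sub]
  abel

/-- For `w` outside the circle only the Cauchy integral of `R` over the circle remains, with kernel
at most `(δ - r)⁻¹`. -/
theorem norm_resolv_mul_rieszProj_le (h : Separates S z r) {δ : ℝ} (hδ : r < δ) :
    ∃ C, ∀ w, w ∉ spec S → δ ≤ dist w z → ‖resolv S w ∘L rieszProj S z‖ ≤ C := by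
  obtain ⟨M, hM⟩ := ((isCompact_sphere z r).image_of_continuousOn
    (continuousOn_resolv fun _ hw => h.notMem_of_mem_sphere hw)).isBounded.exists_norm_le
  refine ⟨r * ((δ - r)⁻¹ * M), fun w hw hwz => ?_⟩
  have hwb : w ∉ closedBall z r := fun h' => by
    rw [mem_closedBall] at h'; linarith
  have h0 : (∮ ζ in C(z, r), (ζ - w)⁻¹) = 0 := by
    refine DiffContOnCl.circleIntegral_eq_zero h.1.le ?_
    refine DifferentiableOn.diffContOnCl_ball (U := {w}ᶜ) ?_ ?_
    · intro ζ hζ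
      have : ζ - w ≠ 0 := sub_ne_zero.2 hζ
      exact DifferentiableAt.differentiableWithinAt (by fun_prop (disch := assumption))
    · rintro ζ hζ rfl
      exact hwb hζ
  rw [resolv_mul_rieszProj h hw fun h' => hwb (sphere_subset_closedBall h'), h0, zero_smul,
    smul_zero, zero_sub, norm_neg]
  refine circleIntegral.norm_two_pi_i_inv_smul_integral_le_of_norm_le_const h.1.le fun ζ hζ => ?_
  rw [norm_smul, norm_inv]
  have h1 : δ - r ≤ ‖ζ - w‖ := by
    have := dist_triangle w ζ z
    rw [mem_sphere.1 hζ] at this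
    rw [← dist_eq_norm, dist_comm]
    linarith
  have h2 : 0 < δ - r := by linarith
  gcongr
  exact hM _ (Set.mem_image_of_mem _ hζ)

/-- For `w` inside the circle the scalar integral is `2πi`, so the term `R(w)` cancels in `R(w)(1 -
P)` and a Cauchy integral over the circle remains. -/
theorem norm_resolv_mul_one_sub_rieszProj_le (h : Separates S z r) {δ : ℝ} (hδ : δ < r) :
    ∃ C, ∀ w, w ≠ z → dist w z ≤ δ → ‖resolv S w ∘L (1 - rieszProj S z)‖ ≤ C := by
  obtain ⟨M, hM⟩ := ((isCompact_sphere z r).image_of_continuousOn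
    (continuousOn_resolv fun _ hw => h.notMem_of_mem_sphere hw)).isBounded.exists_norm_le
  refine ⟨r * ((r - δ)⁻¹ * M), fun w hwz hwd => ?_⟩
  have hwb : w ∈ ball z r := by rw [mem_ball]; linarith
  have hw : w ∉ spec S := h.notMem (ball_subset_closedBall hwb) hwz
  have h0 := circleIntegral.integral_sub_inv_of_mem_ball hwb
  have hpi : (2 * (Real.pi : ℂ) * I) ≠ 0 := two_pi_I_ne_zero
  have h3 : resolv S w ∘L (1 - rieszProj S z) =
      (2 * (Real.pi : ℂ) * I)⁻¹ • ∮ ζ in C(z, r), (ζ - w)⁻¹ • resolv S ζ := by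
    rw [ContinuousLinearMap.comp_sub, resolv_mul_rieszProj h hw fun h' => by
      rw [mem_sphere] at h'; rw [mem_ball] at hwb; linarith, h0, smul_smul, inv_mul_cancel₀ hpi,
      one_smul, ContinuousLinearMap.one_def, ContinuousLinearMap.comp_id]
    abel
  rw [h3]
  refine circleIntegral.norm_two_pi_i_inv_smul_integral_le_of_norm_le_const h.1.le fun ζ hζ => ?_
  rw [norm_smul, norm_inv]
  have h1 : r - δ ≤ ‖ζ - w‖ := by
    have := dist_triangle ζ w z
    rw [mem_sphere.1 hζ] at this
    rw [← dist_eq_norm]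
    linarith
  have h2 : 0 < r - δ := by linarith
  gcongr
  exact hM _ (Set.mem_image_of_mem _ hζ)

theorem Separates.exists_lt (h : Separates S z r) : ∃ r', r < r' ∧ Separates S z r' := by
  have h1 : IsOpen ((spec S)ᶜ ∪ ball z r) := (isOpen_compl_spec S).union isOpen_ball
  have h2 : closedBall z r ⊆ (spec S)ᶜ ∪ ball z r := fun w hw => by
    by_cases hwz : w = z
    · exact Or.inr (hwz ▸ mem_ball_self h.1)
    · exact Or.inl (h.notMem hw hwz)
  obtain ⟨δ, hδ, hδ'⟩ := (isCompact_closedBall z r).exists_cthickening_subset_open h1 h2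
  refine ⟨r + δ, by linarith, by linarith [h.1], Set.Subset.antisymm ?_ ?_⟩
  · rintro w ⟨hw, hws⟩
    rw [add_comm, ← cthickening_closedBall hδ.le h.1.le] at hw
    rcases hδ' hw with h3 | h3
    · exact absurd hws h3
    · by_contra hwz
      exact h.notMem (ball_subset_closedBall h3) hwz hws
  · rintro _ rfl
    exact ⟨mem_closedBall_self (by linarith [h.1]), h.mem_spec⟩

/-- If `R X` stays bounded at `z`, the singularity is removable and the contour integral vanishes.
This replaces double contour integrals in the proofs that Riesz projections are idempotent and
mutually annihilating. -/
theorem circleIntegral_resolv_mul_eq_zero (h : Separates S z r) (X : H →L[ℂ] H) {C : ℝ}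
    (hC : ∀ᶠ w in 𝓝[≠] z, ‖resolv S w ∘L X‖ ≤ C) :
    rieszProj S z ∘L X = 0 := by
  rw [rieszProj_mul h]
  obtain ⟨r', hr, h'⟩ := h.exists_lt
  rw [circleIntegral_eq_zero_of_bddAbove h.1 (isOpen_ball (x := z) (ε := r'))
    (closedBall_subset_ball hr) ?_ hC, smul_zero, neg_zero]
  intro w hw
  have h1 : w ∉ spec S := h'.notMem (ball_subset_closedBall hw.1) hw.2
  exact ((differentiableAt_resolv h1).clm_comp
    (differentiableAt_const X)).differentiableWithinAt

theorem rieszProj_mul_self (z : ℂ) : rieszProj S z ∘L rieszProj S z = rieszProj S z := by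
  by_cases h : ∃ r, Separates S z r
  · obtain ⟨r, h⟩ := h
    obtain ⟨C, hC⟩ := norm_resolv_mul_one_sub_rieszProj_le h (δ := r / 2) (by linarith [h.1])
    have h1 : rieszProj S z ∘L (1 - rieszProj S z) = 0 := by
      refine circleIntegral_resolv_mul_eq_zero h _ (C := C) ?_
      filter_upwards [self_mem_nhdsWithin, mem_nhdsWithin_of_mem_nhds
        (closedBall_mem_nhds z (half_pos h.1))] with w hw hw' using hC w hw hw'
    rw [ContinuousLinearMap.comp_sub, sub_eq_zero] at h1
    exact h1.symm
  · simp [rieszProj_of_not h]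

theorem rieszProj_mul_of_ne (hzw : z ≠ w) : rieszProj S z ∘L rieszProj S w = 0 := by
  by_cases h : ∃ r, Separates S z r
  swap
  · simp [rieszProj_of_not h]
  by_cases h' : ∃ r, Separates S w r
  swap
  · simp [rieszProj_of_not h']
  obtain ⟨r, h⟩ := h
  obtain ⟨r', h'⟩ := h'
  have hd : 0 < dist z w := dist_pos.2 hzw
  -- A circle about `w` small enough that all points within `dist z w / 2` of `z` keep a fixed
  -- distance from it.
  set ρ := min r' (dist z w / 4)
  have hρ : 0 < ρ := lt_min h'.1 (by linarith)
  have hρ' : ρ ≤ dist z w / 4 := min_le_right _ _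
  obtain ⟨C, hC⟩ := norm_resolv_mul_rieszProj_le (h'.mono hρ (min_le_left _ _))
    (δ := dist z w / 2) (by linarith)
  refine circleIntegral_resolv_mul_eq_zero h _ (C := C) ?_
  filter_upwards [self_mem_nhdsWithin, mem_nhdsWithin_of_mem_nhds (closedBall_mem_nhds z h.1),
    mem_nhdsWithin_of_mem_nhds (closedBall_mem_nhds z (half_pos hd))] with x hx hx' hx''
  refine hC x (h.notMem hx' hx) ?_
  have := dist_triangle z x w
  rw [dist_comm z x] at this
  rw [mem_closedBall] at hx''
  linarith

theorem separates_adjoint_iff (hS : Dense (S.domain : Set H)) (hne : ∃ w, w ∉ spec S) :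
    Separates S† (starRingEnd ℂ z) r ↔ Separates S z r := by
  refine and_congr_right fun hr => ?_
  rw [Set.ext_iff, Set.ext_iff]
  have key : ∀ w, (starRingEnd ℂ w ∈ closedBall (starRingEnd ℂ z) r ∩ spec S† ↔
      starRingEnd ℂ w ∈ ({starRingEnd ℂ z} : Set ℂ)) ↔
      (w ∈ closedBall z r ∩ spec S ↔ w ∈ ({z} : Set ℂ)) := by
    intro w
    rw [Set.mem_inter_iff, Set.mem_inter_iff, mem_spec_adjoint_iff hS hne, mem_closedBall,
      mem_closedBall, Complex.dist_conj_conj, Set.mem_singleton_iff, Set.mem_singleton_iff,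
      (starRingEnd ℂ).injective.eq_iff]
  constructor
  · intro h w
    exact (key w).1 (h _)
  · intro h w
    have := (key (starRingEnd ℂ w)).2 (h _)
    simpa only [Complex.conj_conj] using this

open ContinuousLinearMap in
-- Conjugation reverses the orientation of the circle and also conjugates the factor `2πi`; the two
-- signs cancel.
theorem rieszProj_adjoint (hS : Dense (S.domain : Set H)) (hne : ∃ w, w ∉ spec S) (z : ℂ) :
    rieszProj S† (starRingEnd ℂ z) = adjoint (rieszProj S z) := by
  have hsep := fun r => separates_adjoint_iff (z := z) (r := r) hS hne
  by_cases h : ∃ r, Separates S z r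
  · obtain ⟨r, h⟩ := h
    rw [rieszProj_eq h, rieszProj_eq ((hsep r).2 h)]
    have hint : ∀ f : ℂ → H →L[ℂ] H, ∀ c : ℂ, (∮ ζ in C(c, r), f ζ) =
        ∫ θ in Set.Ioc 0 (2 * Real.pi), deriv (circleMap c r) θ • f (circleMap c r θ) := by
      intro f c
      rw [circleIntegral, intervalIntegral.integral_of_le Real.two_pi_pos.le]
    have h1 := h.circleIntegrable.out
    rw [intervalIntegrable_iff_integrableOn_Ioc_of_le Real.two_pi_pos.le] at h1
    have h2 := (adjoint (𝕜 := ℂ) (E := H) (F := H)).toContinuousLinearEquiv.toContinuousLinearMap.integral_comp_commSL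
      (by simp) h1
    have h3 : adjoint (∮ ζ in C(z, r), resolv S ζ) =
        ∫ θ in Set.Ioc 0 (2 * Real.pi),
          adjoint (deriv (circleMap z r) θ • resolv S (circleMap z r θ)) := by
      rw [hint]
      exact h2.symm
    rw [map_neg, map_smulₛₗ, h3]
    have h4 : ∀ θ, adjoint (deriv (circleMap z r) θ • resolv S (circleMap z r θ)) =
        -(deriv (circleMap (starRingEnd ℂ z) r) (-θ) •
          resolv S† (circleMap (starRingEnd ℂ z) r (-θ))) := by
      intro θ
      have h5 : circleMap (starRingEnd ℂ z) r (-θ) = starRingEnd ℂ (circleMap z r θ) := by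
        simp [circleMap, ← Complex.exp_conj]
      have h6 : deriv (circleMap (starRingEnd ℂ z) r) (-θ) =
          -starRingEnd ℂ (deriv (circleMap z r) θ) := by
        simp [deriv_circleMap, circleMap, ← Complex.exp_conj]
      rw [h5, h6, resolv_adjoint hS (h.notMem_of_mem_sphere (circleMap_mem_sphere z h.1.le θ)),
        map_smulₛₗ]
      simp
    simp_rw [h4]
    rw [integral_neg, ← intervalIntegral.integral_of_le Real.two_pi_pos.le]
    -- The substitution `θ ↦ -θ` moves the interval to `[-2π, 0]`; periodicity moves it back to `[0,
    -- 2π]`.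
    have h7 : Function.Periodic (fun θ => deriv (circleMap (starRingEnd ℂ z) r) θ •
        resolv S† (circleMap (starRingEnd ℂ z) r θ)) (2 * Real.pi) := by
      intro θ
      simp only [deriv_circleMap, periodic_circleMap _ _ θ]
    rw [intervalIntegral.integral_comp_neg (fun θ => deriv (circleMap (starRingEnd ℂ z) r) θ •
        resolv S† (circleMap (starRingEnd ℂ z) r θ)), neg_zero]
    have h8 := h7.intervalIntegral_add_eq (-(2 * Real.pi)) 0
    rw [neg_add_cancel, zero_add] at h8
    rw [h8, circleIntegral, smul_neg, neg_neg, ← neg_smul]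
    congr 2
    simp [Complex.conj_ofNat]
  · rw [rieszProj_of_not h, rieszProj_of_not fun ⟨r, hr⟩ => h ⟨r, (hsep r).1 hr⟩, map_zero]

end Riesz

/-! ### The mean value inequality over circles and discs. -/

section MeanValue

open Metric Complex

theorem enorm_le_lintegral_polar {g : ℂ → ℂ} {z : ℂ} {s : ℝ} (hs : 0 < s)
    (hd : DifferentiableOn ℂ g (closedBall z s)) :
    ENNReal.ofReal (2 * Real.pi) * ‖g z‖ₑ ≤
      ∫⁻ θ in Set.Ioo (-Real.pi) Real.pi, ‖g (z + Complex.polarCoord.symm (s, θ))‖ₑ := by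
  have h1 : Real.circleAverage g z s = g z := by
    refine DiffContOnCl.circleAverage ?_
    rw [abs_of_pos hs]
    exact hd.diffContOnCl_ball subset_rfl
  rw [Real.circleAverage_eq_integral_add (-Real.pi),
    intervalIntegral.integral_comp_add_right (fun θ => g (circleMap z s θ))] at h1
  have h2 : (2 * Real.pi) * ‖g z‖ = ‖∫ θ in (0 + -Real.pi)..(2 * Real.pi + -Real.pi),
      g (circleMap z s θ)‖ := by
    rw [← h1, norm_smul, Real.norm_of_nonneg (by positivity), ← mul_assoc,
      mul_inv_cancel₀ (by positivity), one_mul]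
  have h3 : ENNReal.ofReal (2 * Real.pi) * ‖g z‖ₑ = ‖∫ θ in (-Real.pi)..(Real.pi),
      g (circleMap z s θ)‖ₑ := by
    rw [← ofReal_norm, ← ofReal_norm, ← ENNReal.ofReal_mul (by positivity), h2]
    congr 4 <;> ring
  rw [h3, intervalIntegral.integral_of_le (by linarith [Real.pi_pos]),
    MeasureTheory.integral_Ioc_eq_integral_Ioo]
  refine (enorm_integral_le_lintegral_enorm _).trans (le_of_eq ?_)
  refine lintegral_congr fun θ => ?_
  congr 2
  simp [circleMap, Complex.exp_mul_I]

/-- Only the radii between `ρ / 2` and `ρ` are used. There the polar weight is at least `ρ / 2`, and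
the interval of radii has length `ρ / 2`; the constant is not sharp. -/
theorem enorm_le_lintegral_ball {g : ℂ → ℂ} {z : ℂ} {ρ : ℝ} (hρ : 0 < ρ)
    (hd : DifferentiableOn ℂ g (closedBall z ρ)) :
    ENNReal.ofReal (ρ / 2) * ENNReal.ofReal (ρ / 2) * ENNReal.ofReal (2 * Real.pi) * ‖g z‖ₑ ≤
      ∫⁻ ζ in ball z ρ, ‖g ζ‖ₑ := by
  set φ : ℂ → ℝ≥0∞ := (ball (0 : ℂ) ρ).indicator fun ζ => ‖g (z + ζ)‖ₑ with hφ
  have hmaps : Set.MapsTo (fun ζ => z + ζ) (ball (0 : ℂ) ρ) (closedBall z ρ) := fun ζ hζ => by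
    rw [mem_ball_zero_iff] at hζ
    simpa [mem_closedBall] using hζ.le
  have hmeas : Measurable φ := by
    classical
    rw [hφ, ← Set.piecewise_eq_indicator]
    refine ContinuousOn.measurable_piecewise ?_ continuousOn_const measurableSet_ball
    exact (hd.continuousOn.comp (by fun_prop) hmaps).enorm
  have h1 : ∫⁻ ζ in ball z ρ, ‖g ζ‖ₑ = ∫⁻ ζ, φ ζ := by
    rw [hφ, lintegral_indicator measurableSet_ball, ← lintegral_indicator measurableSet_ball,
      ← lintegral_indicator measurableSet_ball, ← lintegral_add_left_eq_self _ z]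
    refine lintegral_congr fun ζ => ?_
    simp [Set.indicator, mem_ball, dist_eq_norm]
  rw [h1, ← Complex.lintegral_comp_polarCoord_symm, polarCoord_target,
    Measure.volume_eq_prod, ← Measure.prod_restrict, lintegral_prod]
  swap
  · refine Measurable.aemeasurable ?_
    have : Measurable fun p : ℝ × ℝ => Complex.polarCoord.symm p := by
      simp_rw [Complex.polarCoord_symm_apply]
      fun_prop
    exact (ENNReal.measurable_ofReal.comp measurable_fst).smul (hmeas.comp this)
  calc _ = ∫⁻ _ in Set.Ioo (ρ / 2) ρ,
        ENNReal.ofReal (ρ / 2) * (ENNReal.ofReal (2 * Real.pi) * ‖g z‖ₑ) := by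
        rw [setLIntegral_const, Real.volume_Ioo, show ρ - ρ / 2 = ρ / 2 by ring]
        ring
    _ ≤ ∫⁻ s in Set.Ioo (ρ / 2) ρ, ∫⁻ θ in Set.Ioo (-Real.pi) Real.pi,
        ENNReal.ofReal s • φ (Complex.polarCoord.symm (s, θ)) := by
        refine setLIntegral_mono' measurableSet_Ioo fun s hs => ?_
        have hs0 : 0 < s := by linarith [hs.1]
        simp_rw [smul_eq_mul]
        rw [lintegral_const_mul' _ _ ENNReal.ofReal_ne_top]
        gcongr
        · exact hs.1.le
        refine (enorm_le_lintegral_polar hs0 (hd.mono (closedBall_subset_closedBall hs.2.le))).trans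
          (le_of_eq ?_)
        refine lintegral_congr fun θ => ?_
        rw [hφ, Set.indicator_of_mem]
        rw [mem_ball_zero_iff, Complex.norm_polarCoord_symm]
        simpa [abs_of_pos hs0] using hs.2
    _ ≤ _ := lintegral_mono_set fun s hs => show 0 < s by linarith [hs.1]

end MeanValue

/-! ### From bounds on horizontal lines to bounds on discs. -/

section Hardy

open Metric Complex

variable {E : Type*} [NormedAddCommGroup E]

theorem lintegral_ball_le_of_lines {φ : ℂ → ℝ≥0∞} {z : ℂ} {ρ : ℝ}
    (hφ : ContinuousOn φ (ball z ρ)) {C : ℝ≥0∞}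
    (hC : ∀ y, |y - z.im| < ρ → ∫⁻ x : ℝ, φ (x + y * I) ≤ C) :
    ∫⁻ ζ in ball z ρ, φ ζ ≤ ENNReal.ofReal (2 * ρ) * C := by
  have hmeas : Measurable ((ball z ρ).indicator φ) := by
    classical
    rw [← Set.piecewise_eq_indicator]
    exact ContinuousOn.measurable_piecewise hφ continuousOn_const measurableSet_ball
  rw [← lintegral_indicator measurableSet_ball,
    ← volume_preserving_equiv_real_prod.symm.lintegral_comp_emb
    measurableEquivRealProd.symm.measurableEmbedding, Measure.volume_eq_prod,
    lintegral_prod_symm' (fun p => (ball z ρ).indicator φ (measurableEquivRealProd.symm p))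
      (hmeas.comp measurableEquivRealProd.symm.measurable)]
  have key : ∀ x y : ℝ, measurableEquivRealProd.symm (x, y) = x + y * I := fun x y => by
    apply Complex.ext <;> simp
  calc _ ≤ ∫⁻ y : ℝ, (Set.Ioo (z.im - ρ) (z.im + ρ)).indicator (fun _ => C) y := by
        refine lintegral_mono fun y => ?_
        by_cases hy : |y - z.im| < ρ
        · rw [Set.indicator_of_mem (by rw [abs_lt] at hy; constructor <;> linarith)]
          refine le_trans (lintegral_mono fun x => ?_) (hC y hy)
          rw [key]
          exact Set.indicator_le_self _ _ _
        · rw [Set.indicator_of_notMem (fun h => hy (by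
            rw [abs_lt]; constructor <;> linarith [h.1, h.2]))]
          refine le_of_eq ((lintegral_congr fun x => ?_).trans lintegral_zero)
          rw [key, Set.indicator_of_notMem]
          intro h
          refine hy (lt_of_le_of_lt ?_ h)
          rw [dist_eq_norm]
          simpa using Complex.abs_im_le_norm (x + y * I - z)
    _ = _ := by
        rw [lintegral_indicator measurableSet_Ioo, setLIntegral_const, Real.volume_Ioo, mul_comm]
        congr 2
        ring

end Hardy

/-! ### Cauchy's theorem in the upper half-plane and the class `H₂`. -/

section Hardy

open Metric Complex

theorem integrable_inv_sq_add_sq (a : ℝ) {y : ℝ} (hy : y ≠ 0) :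
    Integrable fun x : ℝ => ((x - a) ^ 2 + y ^ 2)⁻¹ := by
  have h := ((integrable_inv_one_add_sq.comp_div hy).comp_sub_right a).const_mul (y ^ 2)⁻¹
  refine h.congr (ae_of_all _ fun x => ?_)
  simp only
  rw [← mul_inv]
  congr 1
  field_simp
  ring

theorem integral_inv_sq_add_sq (a : ℝ) {y : ℝ} (hy : 0 < y) :
    ∫ x : ℝ, ((x - a) ^ 2 + y ^ 2)⁻¹ = Real.pi / y := by
  have h : ∀ x : ℝ, ((x - a) ^ 2 + y ^ 2)⁻¹ = (y ^ 2)⁻¹ * (1 + ((x - a) / y) ^ 2)⁻¹ := fun x => by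
    rw [← mul_inv]
    congr 1
    field_simp
    ring
  simp_rw [h]
  rw [integral_const_mul, integral_sub_right_eq_self (fun x => (1 + (x / y) ^ 2)⁻¹) a,
    Measure.integral_comp_div (fun x => (1 + x ^ 2)⁻¹) y, integral_univ_inv_one_add_sq,
    abs_of_pos hy, smul_eq_mul]
  field_simp

theorem norm_sub_sq_eq (x y : ℝ) (w : ℂ) :
    ‖(x + y * I : ℂ) - w‖ ^ 2 = (x - w.re) ^ 2 + (y - w.im) ^ 2 := by
  rw [← Complex.normSq_eq_norm_sq, Complex.normSq_apply]
  simp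
  ring

theorem norm_ofReal_sub_sq_eq (x : ℝ) (w : ℂ) :
    ‖(x : ℂ) - w‖ ^ 2 = (x - w.re) ^ 2 + w.im ^ 2 := by
  simpa using norm_sub_sq_eq x 0 w

theorem ofReal_sub_ne_zero (x : ℝ) {w : ℂ} (hw : w.im ≠ 0) : (x : ℂ) - w ≠ 0 := fun h =>
  hw (by rw [← sub_eq_zero.1 h]; simp)

variable {E : Type*} [NormedAddCommGroup E]

/-- Cauchy's theorem for the upper half-plane. -/
theorem integral_eq_zero_of_differentiableAt_upper [NormedSpace ℂ E] {g : ℂ → E}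
    (hd : ∀ z : ℂ, 0 ≤ z.im → DifferentiableAt ℂ g z) (hi : Integrable fun x : ℝ => g x)
    (hi' : ∀ᶠ R : ℝ in atTop, Integrable fun x : ℝ => g (x + R * I))
    (hv : ∀ R : ℝ, 0 < R → ∀ ε : ℝ, 0 < ε → ∀ᶠ x : ℝ in cocompact ℝ, ∀ y : ℝ, 0 ≤ y → y ≤ R →
      ‖g (x + y * I)‖ ≤ ε)
    (htop : Tendsto (fun R : ℝ => ∫ x : ℝ, g (x + R * I)) atTop (𝓝 0)) :
    ∫ x : ℝ, g x = 0 := by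
  -- The integral over the line of height `R` equals the one over the real line, by Cauchy's theorem
  -- on rectangles whose vertical sides contribute nothing in the limit; letting `R → ∞` finishes.
  suffices h : ∀ᶠ R : ℝ in atTop, ∫ x : ℝ, g (x + R * I) = ∫ x : ℝ, g x from
    tendsto_nhds_unique (tendsto_const_nhds.congr' (h.mono fun R hR => hR.symm)) htop
  filter_upwards [hi', eventually_gt_atTop 0] with R hR hR0
  have h1 : ∀ X : ℝ, (∫ x : ℝ in -X..X, g x) - (∫ x : ℝ in -X..X, g (x + R * I)) =
      I • (∫ y : ℝ in (0 : ℝ)..R, g ((-X : ℝ) + y * I)) -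
      I • (∫ y : ℝ in (0 : ℝ)..R, g (X + y * I)) := by
    intro X
    have := integral_boundary_rect_eq_zero_of_differentiableOn g (-X : ℝ) (X + R * I) (by
      intro z hz
      refine (hd z ?_).differentiableWithinAt
      rw [mem_reProdIm] at hz
      have h2 := hz.2
      simp only [ofReal_im, add_im, mul_im, ofReal_re, I_im, mul_one, I_re, mul_zero, add_zero,
        zero_add, Set.uIcc_of_le hR0.le] at h2
      exact h2.1)
    simp only [ofReal_im, ofReal_re, add_im, add_re, mul_im, mul_re, I_im, I_re, mul_one, mul_zero,
      add_zero, zero_add, sub_zero, ofReal_zero, zero_mul] at this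
    rw [sub_eq_sub_iff_add_eq_add] at *
    rw [sub_eq_zero, ← eq_sub_iff_add_eq] at this
    rw [sub_eq_iff_eq_add] at this
    rw [this]
    abel
  have h2 : Tendsto (fun X : ℝ => (∫ x : ℝ in -X..X, g x) - ∫ x : ℝ in -X..X, g (x + R * I)) atTop
      (𝓝 ((∫ x : ℝ, g x) - ∫ x : ℝ, g (x + R * I))) :=
    (intervalIntegral_tendsto_integral hi tendsto_neg_atTop_atBot tendsto_id).sub
      (intervalIntegral_tendsto_integral hR tendsto_neg_atTop_atBot tendsto_id)
  have h3 : Tendsto (fun X : ℝ => ∫ y : ℝ in (0 : ℝ)..R, g (X + y * I)) (cocompact ℝ) (𝓝 0) := by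
    rw [tendsto_zero_iff_norm_tendsto_zero]
    refine Metric.tendsto_nhds.2 fun ε hε => ?_
    filter_upwards [hv R hR0 (ε / (2 * R)) (by positivity)] with X hX
    rw [dist_zero_right, norm_norm]
    have := intervalIntegral.norm_integral_le_of_norm_le_const (a := 0) (b := R)
      (f := fun y : ℝ => g (X + y * I)) (C := ε / (2 * R)) (fun y hy => by
        rw [Set.uIoc_of_le hR0.le] at hy
        exact hX y hy.1.le hy.2)
    rw [sub_zero, abs_of_pos hR0] at this
    refine this.trans_lt ?_
    field_simp
    linarith
  have h4 : Tendsto (fun X : ℝ => (∫ x : ℝ in -X..X, g x) - ∫ x : ℝ in -X..X, g (x + R * I)) atTop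
      (𝓝 0) := by
    simp_rw [h1]
    have h5 := h3.comp ((tendsto_neg_atTop_atBot (G := ℝ)).mono_right atBot_le_cocompact)
    have h6 := h3.comp ((tendsto_id (α := ℝ) (x := atTop)).mono_right atTop_le_cocompact)
    simpa using (h5.const_smul I).sub (h6.const_smul I)
  exact (sub_eq_zero.1 (tendsto_nhds_unique h2 h4)).symm

variable [InnerProductSpace ℂ E]

/-- The Hardy class `H₂` of the upper half-plane. -/
def IsHardy (F : ℂ → E) : Prop :=
  DifferentiableOn ℂ F {z | 0 < z.im} ∧
    ∃ C : ℝ≥0, ∀ ε : ℝ, 0 < ε → ∫⁻ k : ℝ, ‖F ((k : ℂ) + ε * I)‖ₑ ^ 2 ≤ C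

theorem isOpen_upperHalfPlane : IsOpen {z : ℂ | 0 < z.im} :=
  isOpen_lt continuous_const Complex.continuous_im

theorem IsHardy.differentiableAt {F : ℂ → E} (hF : IsHardy F) {z : ℂ} (hz : 0 < z.im) :
    DifferentiableAt ℂ F z := hF.1.differentiableAt (isOpen_upperHalfPlane.mem_nhds hz)

/-- The mean value inequality on discs of radius `c / 2`, which stay in the half-plane, combined
with the uniform `L²` bound on horizontal lines. -/
theorem IsHardy.bounded {F : ℂ → E} (hF : IsHardy F) {c : ℝ} (hc : 0 < c) :
    ∃ M, ∀ z : ℂ, c ≤ z.im → ‖F z‖ ≤ M := by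
  obtain ⟨C, hC⟩ := hF.2
  set ρ := c / 2 with hρ
  have hρ0 : 0 < ρ := half_pos hc
  set K : ℝ := ρ / 2 * (ρ / 2) * (2 * Real.pi) with hK
  have hK0 : 0 < K := by have := Real.pi_pos; positivity
  refine ⟨Real.sqrt (2 * ρ * C / K), fun z hz => Real.le_sqrt_of_sq_le ?_⟩
  have hsub : closedBall z ρ ⊆ {z : ℂ | 0 < z.im} := by
    intro ζ hζ
    rw [mem_closedBall, dist_eq_norm] at hζ
    have := (Complex.abs_im_le_norm (ζ - z)).trans hζ
    rw [abs_le, sub_im] at this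
    change 0 < ζ.im
    linarith [this.1]
  have hdF := hF.1.mono hsub
  -- The vector case is reduced to the scalar function `ζ ↦ (F ζ, F z)²`. Its value at `z` is `‖F
  -- z‖⁴` in modulus and it is dominated by `‖F z‖² ‖F ζ‖²`, so a factor `‖F z‖²` cancels at the
  -- end.
  have h1 := enorm_le_lintegral_ball hρ0 (g := fun ζ => innerSL ℂ (F z) (F ζ) ^ 2)
    (((innerSL ℂ (F z)).differentiable.comp_differentiableOn hdF).pow 2)
  have h2 : ∫⁻ ζ in ball z ρ, ‖F ζ‖ₑ ^ 2 ≤ ENNReal.ofReal (2 * ρ) * C := by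
    refine lintegral_ball_le_of_lines ?_ fun y hy => hC y ?_
    · exact (ENNReal.continuous_pow 2).comp_continuousOn
        (hdF.continuousOn.mono ball_subset_closedBall).enorm
    · rw [abs_lt] at hy; linarith [hy.1]
  have h3 : ∫⁻ ζ in ball z ρ, ‖innerSL ℂ (F z) (F ζ) ^ 2‖ₑ ≤
      ‖F z‖ₑ ^ 2 * (ENNReal.ofReal (2 * ρ) * C) := by
    refine le_trans ?_ (mul_le_mul_right h2 _)
    rw [← lintegral_const_mul' _ _ (by simp)]
    refine lintegral_mono fun ζ => ?_
    rw [enorm_pow, ← mul_pow]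
    gcongr
    rw [← ofReal_norm, ← ofReal_norm, ← ofReal_norm, ← ENNReal.ofReal_mul (norm_nonneg _)]
    exact ENNReal.ofReal_le_ofReal (norm_inner_le_norm _ _)
  have h4 := h1.trans h3
  have h5 : ‖innerSL ℂ (F z) (F z) ^ 2‖ₑ = ‖F z‖ₑ ^ 2 * ‖F z‖ₑ ^ 2 := by
    rw [← ofReal_norm, ← ofReal_norm, ← ENNReal.ofReal_pow (norm_nonneg _),
      ← ENNReal.ofReal_mul (by positivity), innerSL_apply_apply, inner_self_eq_norm_sq_to_K]
    congr 1
    simp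
    ring
  rw [h5, ← ENNReal.ofReal_mul (by positivity), ← ENNReal.ofReal_mul (by positivity), ← hK,
    ← ofReal_norm, ← ENNReal.ofReal_pow (norm_nonneg _), ← ENNReal.ofReal_coe_nnreal,
    ← ENNReal.ofReal_mul (by positivity), ← ENNReal.ofReal_mul (by positivity),
    ← ENNReal.ofReal_mul (by positivity), ← ENNReal.ofReal_mul (by positivity),
    ENNReal.ofReal_le_ofReal_iff (by positivity)] at h4
  rw [le_div_iff₀ hK0]
  rcases (sq_nonneg ‖F z‖).eq_or_lt with h0 | h0
  · rw [← h0]; simp; positivity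
  · refine le_of_mul_le_mul_left ?_ h0
    linarith

theorem norm_kernel_sq (k : ℝ) (w : ℂ) (u : E) :
    ‖((k : ℂ) - w)⁻¹ • u‖ ^ 2 = ((k - w.re) ^ 2 + w.im ^ 2)⁻¹ * ‖u‖ ^ 2 := by
  rw [norm_smul, mul_pow, norm_inv, inv_pow, norm_ofReal_sub_sq_eq]

theorem memLp_kernel {w : ℂ} (hw : w.im ≠ 0) (u : E) :
    MemLp (fun k : ℝ => ((k : ℂ) - w)⁻¹ • u) 2 := by
  have hc : Continuous fun k : ℝ => ((k : ℂ) - w)⁻¹ • u :=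
    (Continuous.inv₀ (by fun_prop) fun k => ofReal_sub_ne_zero k hw).smul continuous_const
  rw [memLp_two_iff_integrable_sq_norm hc.aestronglyMeasurable]
  simp_rw [norm_kernel_sq]
  exact (integrable_inv_sq_add_sq w.re hw).mul_const _

end Hardy

/-! ### Cauchy's formula for functions holomorphic up to the real line. -/

section Hardy

open Metric Complex

variable {E : Type*} [NormedAddCommGroup E] [InnerProductSpace ℂ E]

theorem continuous_horizontal {G : ℂ → E} {y : ℝ}
    (hd : ∀ z : ℂ, z.im = y → DifferentiableAt ℂ G z) : Continuous fun x : ℝ => G (x + y * I) := by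
  rw [continuous_iff_continuousAt]
  intro x
  exact ContinuousAt.comp (f := fun x : ℝ => (x + y * I : ℂ)) (hd (x + y * I) (by simp)).continuousAt
    (by fun_prop)

omit [InnerProductSpace ℂ E] in
theorem memLp_of_lintegral_sq_le {f : ℝ → E} (hf : AEStronglyMeasurable f) {C : ℝ≥0}
    (hC : ∫⁻ k : ℝ, ‖f k‖ₑ ^ 2 ≤ C) : MemLp f 2 ∧ ∫ k : ℝ, ‖f k‖ ^ 2 ≤ C := by
  have h1 : ∀ k, ‖f k‖ₑ ^ 2 = ENNReal.ofReal (‖f k‖ ^ 2) := fun k => by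
    rw [← ofReal_norm, ENNReal.ofReal_pow (norm_nonneg _)]
  simp_rw [h1] at hC
  have hm : AEStronglyMeasurable (fun k => ‖f k‖ ^ 2) := hf.norm.pow 2
  constructor
  · rw [memLp_two_iff_integrable_sq_norm hf]
    refine ⟨hm, ?_⟩
    rw [hasFiniteIntegral_iff_ofReal (ae_of_all _ fun k => by positivity)]
    exact hC.trans_lt ENNReal.coe_lt_top
  · rw [integral_eq_lintegral_of_nonneg_ae (ae_of_all _ fun k => by positivity) hm]
    exact ENNReal.toReal_le_coe_of_le_coe hC

/-- The weighted inequality between arithmetic and geometric means, in place of Cauchy–Schwarz. The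
free weight `t` is later taken to be `√R`. -/
theorem norm_integral_smul_le {a : ℝ → ℂ} {b : ℝ → E} (ha : MemLp a 2) (hb : MemLp b 2)
    {t : ℝ} (ht : 0 < t) :
    ‖∫ k, a k • b k‖ ≤ t / 2 * (∫ k, ‖a k‖ ^ 2) + (2 * t)⁻¹ * ∫ k, ‖b k‖ ^ 2 := by
  have ha' := (memLp_two_iff_integrable_sq_norm ha.1).1 ha
  have hb' := (memLp_two_iff_integrable_sq_norm hb.1).1 hb
  rw [← integral_const_mul, ← integral_const_mul,
    ← integral_add (ha'.const_mul _) (hb'.const_mul _)]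
  refine norm_integral_le_of_norm_le ((ha'.const_mul _).add (hb'.const_mul _))
    (ae_of_all _ fun k => ?_)
  rw [norm_smul]
  have h := sq_nonneg (t * ‖a k‖ - ‖b k‖)
  have h2 : t / 2 * ‖a k‖ ^ 2 + (2 * t)⁻¹ * ‖b k‖ ^ 2 - ‖a k‖ * ‖b k‖ =
      (2 * t)⁻¹ * (t * ‖a k‖ - ‖b k‖) ^ 2 := by
    field_simp
    ring
  have h3 : 0 ≤ (2 * t)⁻¹ * (t * ‖a k‖ - ‖b k‖) ^ 2 := by positivity
  linarith

theorem integrable_smul_of_memLp {a : ℝ → ℂ} {b : ℝ → E} (ha : MemLp a 2) (hb : MemLp b 2) :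
    Integrable fun k => a k • b k :=
  memLp_one_iff_integrable.1 (MemLp.smul (r := 1) hb ha)

theorem memLp_inv_sub {w : ℂ} (hw : w.im ≠ 0) : MemLp (fun k : ℝ => ((k : ℂ) - w)⁻¹) 2 := by
  simpa using memLp_kernel hw (1 : ℂ)

theorem integral_norm_inv_sub_sq {w : ℂ} (hw : w.im ≠ 0) :
    ∫ k : ℝ, ‖((k : ℂ) - w)⁻¹‖ ^ 2 = Real.pi / |w.im| := by
  have h : ∀ k : ℝ, ‖((k : ℂ) - w)⁻¹‖ ^ 2 = ((k - w.re) ^ 2 + |w.im| ^ 2)⁻¹ := fun k => by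
    rw [norm_inv, inv_pow, norm_ofReal_sub_sq_eq, sq_abs]
  simp_rw [h]
  exact integral_inv_sq_add_sq _ (abs_pos.2 hw)

theorem eventually_le_abs_sub (a M : ℝ) : ∀ᶠ x : ℝ in cocompact ℝ, M ≤ |x - a| := by
  have h : Tendsto (fun x : ℝ => |x - a|) (cocompact ℝ) atTop := by
    have := tendsto_norm_cocompact_atTop (E := ℝ)
    refine this.comp ((Homeomorph.subRight a).isClosedEmbedding.tendsto_cocompact)
  exact h.eventually_ge_atTop M

theorem abs_sub_re_le_norm (x y : ℝ) (w : ℂ) : |x - w.re| ≤ ‖(x + y * I : ℂ) - w‖ := by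
  simpa using Complex.abs_re_le_norm ((x + y * I : ℂ) - w)

/-- For `w` below the real axis the integrand has no pole in the closed upper half-plane. -/
theorem cauchy_lower {G : ℂ → E} (hd : ∀ z : ℂ, 0 ≤ z.im → DifferentiableAt ℂ G z) {M : ℝ}
    (hM : ∀ z : ℂ, 0 ≤ z.im → ‖G z‖ ≤ M) {C : ℝ≥0}
    (hC : ∀ y : ℝ, 0 ≤ y → ∫⁻ x : ℝ, ‖G (x + y * I)‖ₑ ^ 2 ≤ C) {w : ℂ} (hw : w.im < 0) :
    ∫ k : ℝ, ((k : ℂ) - w)⁻¹ • G k = 0 := by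
  have hcont : ∀ y : ℝ, 0 ≤ y → Continuous fun x : ℝ => G (x + y * I) := fun y hy =>
    continuous_horizontal fun z hz => hd z (hz ▸ hy)
  have hline := fun y hy => memLp_of_lintegral_sq_le (hcont y hy).aestronglyMeasurable (hC y hy)
  have hshift : ∀ x y : ℝ, (x + y * I : ℂ) - w = x - (w - y * I) := fun x y => by ring
  have hne : ∀ y : ℝ, 0 ≤ y → (w - y * I).im ≠ 0 := fun y hy => by simp; linarith
  have hprod : ∀ y : ℝ, 0 ≤ y → Integrable fun x : ℝ => ((x + y * I : ℂ) - w)⁻¹ • G (x + y * I) :=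
    fun y hy => by
      simp_rw [hshift]
      exact integrable_smul_of_memLp (memLp_inv_sub (hne y hy)) (hline y hy).1
  refine integral_eq_zero_of_differentiableAt_upper (g := fun z => (z - w)⁻¹ • G z) ?_ ?_ ?_ ?_ ?_
  · intro z hz
    have : z - w ≠ 0 := fun h => by
      have := congrArg Complex.im h
      simp at this
      linarith
    exact ((differentiableAt_id.sub_const w).inv this).smul (hd z hz)
  · simpa using hprod 0 le_rfl
  · filter_upwards [eventually_ge_atTop 0] with R hR using hprod R hR
  · intro R hR ε hε
    have hM0 : 0 ≤ M := (norm_nonneg _).trans (hM 0 (by simp))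
    filter_upwards [eventually_le_abs_sub w.re ((M + 1) / ε)] with x hx y hy hyR
    have h1 := hx.trans (abs_sub_re_le_norm x y w)
    have h0 : 0 < (M + 1) / ε := by positivity
    rw [norm_smul, norm_inv]
    calc _ ≤ ((M + 1) / ε)⁻¹ * M := by
          gcongr
          exact hM _ (by simpa using hy)
      _ ≤ ε := by
          rw [inv_div, div_mul_eq_mul_div, div_le_iff₀ (by positivity)]
          nlinarith
  -- On the line of height `R` the kernel has squared norm at most `π / R`, so the weight `t = √R`
  -- makes both terms of order `R^(-1/2)`.
  · refine squeeze_zero_norm' (a := fun R : ℝ => (Real.pi / 2 + C / 2) * (Real.sqrt R)⁻¹) ?_ ?_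
    · filter_upwards [eventually_gt_atTop 0] with R hR
      have hs : 0 < Real.sqrt R := Real.sqrt_pos.2 hR
      simp_rw [hshift]
      refine (norm_integral_smul_le (memLp_inv_sub (hne R hR.le)) (hline R hR.le).1 hs).trans ?_
      rw [integral_norm_inv_sub_sq (hne R hR.le)]
      have h1 : R ≤ |(w - R * I).im| := by
        simp only [sub_im, mul_im, ofReal_re, I_im, mul_one, ofReal_im, I_re, mul_zero, add_zero]
        rw [abs_of_neg (by linarith)]
        linarith
      have h2 := Real.mul_self_sqrt hR.le
      calc _ ≤ Real.sqrt R / 2 * (Real.pi / R) + (2 * Real.sqrt R)⁻¹ * C := by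
            gcongr
            exact (hline R hR.le).2
        _ = _ := by
            nth_rewrite 2 [← h2]
            field_simp
    · have := (tendsto_inv_atTop_zero.comp Real.tendsto_sqrt_atTop).const_mul (Real.pi / 2 + C / 2 : ℝ)
      simpa using this

theorem dslope_norm_le {G : ℂ → E} {M : ℝ} (hM : ∀ z : ℂ, 0 ≤ z.im → ‖G z‖ ≤ M) {w z : ℂ}
    (hw : 0 ≤ w.im) (hz : 0 ≤ z.im) (hne : z ≠ w) : ‖dslope G w z‖ ≤ ‖z - w‖⁻¹ * (2 * M) := by
  rw [dslope_of_ne _ hne, slope_def_module, norm_smul, norm_inv]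
  gcongr
  refine (norm_sub_le _ _).trans ?_
  linarith [hM z hz, hM w hw]

theorem integral_poissonKernel {w : ℂ} (hw : 0 < w.im) :
    ∫ k : ℝ, (((k : ℂ) - w)⁻¹ - ((k : ℂ) - starRingEnd ℂ w)⁻¹) = 2 * Real.pi * I := by
  have h : ∀ k : ℝ, ((k : ℂ) - w)⁻¹ - ((k : ℂ) - starRingEnd ℂ w)⁻¹ =
      (2 * w.im * I) * (((k - w.re) ^ 2 + w.im ^ 2)⁻¹ : ℝ) := by
    intro k
    have h1 := ofReal_sub_ne_zero k hw.ne'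
    have h2 : (k : ℂ) - starRingEnd ℂ w ≠ 0 := ofReal_sub_ne_zero k (by simpa using hw.ne')
    have h3 : ((((k - w.re) ^ 2 + w.im ^ 2 : ℝ)) : ℂ) = (k - w) * (k - starRingEnd ℂ w) := by
      apply Complex.ext <;> simp [pow_two]
      ring
    rw [ofReal_inv, h3, inv_sub_inv h1 h2, ← div_eq_mul_inv]
    congr 1
    apply Complex.ext <;> simp
    ring
  simp_rw [h]
  rw [integral_const_mul, integral_complex_ofReal, integral_inv_sq_add_sq _ hw]
  push_cast
  have : (w.im : ℂ) ≠ 0 := by exact_mod_cast hw.ne'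
  field_simp

/-- The pole is removed by the divided difference of `G` at `w`, and the extra factor `(w - w̄) / (z
- w̄)` makes the integrand decay quadratically. On the real line it splits into the two Cauchy
integrands at `w` and `w̄` and a Poisson kernel times `G w`. The integral at `w̄` vanishes by
`cauchy_lower`, and the Poisson kernel gives `2πi`. -/
theorem cauchy_upper [CompleteSpace E] {G : ℂ → E}
    (hd : ∀ z : ℂ, 0 ≤ z.im → DifferentiableAt ℂ G z) {M : ℝ}
    (hM : ∀ z : ℂ, 0 ≤ z.im → ‖G z‖ ≤ M) {C : ℝ≥0}
    (hC : ∀ y : ℝ, 0 ≤ y → ∫⁻ x : ℝ, ‖G (x + y * I)‖ₑ ^ 2 ≤ C) {w : ℂ} (hw : 0 < w.im) :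
    ∫ k : ℝ, ((k : ℂ) - w)⁻¹ • G k = (2 * Real.pi * I : ℂ) • G w := by
  have hM0 : 0 ≤ M := (norm_nonneg _).trans (hM 0 (by simp))
  set cw := starRingEnd ℂ w with hcw
  have hcwim : cw.im < 0 := by simpa [hcw] using hw
  have hlow := cauchy_lower hd hM hC hcwim
  have hcont : Continuous fun x : ℝ => G x := by
    rw [continuous_iff_continuousAt]
    intro x
    exact (hd x (by simp)).continuousAt.comp (by fun_prop)
  have hG2 : MemLp (fun x : ℝ => G x) 2 :=
    (memLp_of_lintegral_sq_le hcont.aestronglyMeasurable (by simpa using hC 0 le_rfl)).1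
  have hne : ∀ z : ℂ, 0 ≤ z.im → z - cw ≠ 0 := fun z hz h => by
    have := congrArg Complex.im h
    simp only [sub_im, zero_im] at this
    linarith
  have hdds : ∀ z : ℂ, 0 ≤ z.im → DifferentiableAt ℂ (dslope G w) z := by
    intro z hz
    by_cases hzw : z = w
    · subst hzw
      have h1 : DifferentiableOn ℂ G {z | 0 < z.im} := fun y hy =>
        (hd y (le_of_lt hy)).differentiableWithinAt
      exact (((Complex.differentiableOn_dslope (isOpen_upperHalfPlane.mem_nhds hw)).2
        h1).differentiableAt (isOpen_upperHalfPlane.mem_nhds hw))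
    · exact (differentiableAt_dslope_of_ne hzw).2 (hd z hz)
  set g : ℂ → E := fun z => ((w - cw) * (z - cw)⁻¹) • dslope G w z with hg
  have hgd : ∀ z : ℂ, 0 ≤ z.im → DifferentiableAt ℂ g z := fun z hz =>
    (((differentiableAt_id.sub_const cw).inv (hne z hz)).const_mul _).smul (hdds z hz)
  have hgcont : ∀ y : ℝ, 0 ≤ y → Continuous fun x : ℝ => g (x + y * I) := fun y hy =>
    continuous_horizontal fun z hz => hgd z (hz ▸ hy)
  have hbound : ∀ x y : ℝ, 0 ≤ y → y ≠ w.im → ‖g (x + y * I)‖ ≤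
      (‖w - cw‖ * (2 * M)) * ((x - w.re) ^ 2 + (y - w.im) ^ 2)⁻¹ := by
    intro x y hy hyw
    have hz : 0 ≤ (x + y * I : ℂ).im := by simpa using hy
    have hzw : (x + y * I : ℂ) ≠ w := fun h => hyw (by rw [← h]; simp)
    have h0 : 0 < ‖(x + y * I : ℂ) - w‖ := norm_pos_iff.2 (sub_ne_zero.2 hzw)
    have h1 : ‖(x + y * I : ℂ) - w‖ ≤ ‖(x + y * I : ℂ) - cw‖ := by
      rw [← sq_le_sq₀ (norm_nonneg _) (norm_nonneg _), norm_sub_sq_eq, norm_sub_sq_eq]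
      simp only [hcw, conj_re, conj_im]
      nlinarith
    rw [hg, norm_smul, norm_mul, norm_inv, ← norm_sub_sq_eq]
    calc _ ≤ (‖w - cw‖ * ‖(x + y * I : ℂ) - w‖⁻¹) * (‖(x + y * I : ℂ) - w‖⁻¹ * (2 * M)) := by
          gcongr
          exact dslope_norm_le hM hw.le hz hzw
      _ = _ := by ring
  have hgi : ∀ y : ℝ, 0 ≤ y → y ≠ w.im → Integrable fun x : ℝ => g (x + y * I) := fun y hy hyw =>
    Integrable.mono' ((integrable_inv_sq_add_sq w.re (sub_ne_zero.2 hyw)).const_mul _)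
      (hgcont y hy).aestronglyMeasurable (ae_of_all _ fun x => hbound x y hy hyw)
  have h0 : ∫ k : ℝ, g k = 0 := by
    refine integral_eq_zero_of_differentiableAt_upper hgd ?_ ?_ ?_ ?_
    · simpa using hgi 0 le_rfl hw.ne
    · filter_upwards [eventually_gt_atTop w.im] with R hR using hgi R (hw.trans hR).le hR.ne'
    · intro R hR ε hε
      have h00 : 0 ≤ ‖w - cw‖ * (2 * M) := by positivity
      filter_upwards [eventually_le_abs_sub w.re 1,
        eventually_le_abs_sub w.re ((‖w - cw‖ * (2 * M) + 1) / ε)] with x hx1 hx y hy hyR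
      have hz : 0 ≤ (x + y * I : ℂ).im := by simpa using hy
      have h1 := abs_sub_re_le_norm x y w
      have h2 : |x - w.re| ≤ ‖(x + y * I : ℂ) - cw‖ := by simpa [hcw] using abs_sub_re_le_norm x y cw
      have hzw : (x + y * I : ℂ) ≠ w := fun h => by
        rw [h, sub_self, norm_zero] at h1
        linarith
      have hK : 0 < (‖w - cw‖ * (2 * M) + 1) / ε := by positivity
      rw [hg, norm_smul, norm_mul, norm_inv]
      calc _ ≤ (‖w - cw‖ * 1⁻¹) * (((‖w - cw‖ * (2 * M) + 1) / ε)⁻¹ * (2 * M)) := by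
            gcongr
            · exact hx1.trans h2
            · refine (dslope_norm_le hM hw.le hz hzw).trans ?_
              gcongr
              exact hx.trans h1
        _ ≤ ε := by
            rw [inv_div, inv_one, mul_one, div_mul_eq_mul_div, ← mul_div_assoc,
              div_le_iff₀ (by positivity)]
            nlinarith
    · refine squeeze_zero_norm' (a := fun R : ℝ => (‖w - cw‖ * (2 * M)) * (Real.pi / (R - w.im)))
        ?_ ?_
      · filter_upwards [eventually_gt_atTop w.im] with R hR
        rw [← integral_inv_sq_add_sq w.re (sub_pos.2 hR), ← integral_const_mul]
        exact norm_integral_le_of_norm_le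
          ((integrable_inv_sq_add_sq w.re (sub_pos.2 hR).ne').const_mul _)
          (ae_of_all _ fun x => hbound x R (hw.trans hR).le hR.ne')
      · have h1 : Tendsto (fun R : ℝ => R - w.im) atTop atTop :=
          tendsto_atTop_add_const_right _ _ tendsto_id
        simpa using (h1.const_div_atTop Real.pi).const_mul (‖w - cw‖ * (2 * M))
  have hgk : ∀ k : ℝ, g k = ((k : ℂ) - w)⁻¹ • G k - ((k : ℂ) - cw)⁻¹ • G k -
      (((k : ℂ) - w)⁻¹ - ((k : ℂ) - cw)⁻¹) • G w := by
    intro k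
    have h1 := ofReal_sub_ne_zero k hw.ne'
    have h2 : (k : ℂ) - cw ≠ 0 := ofReal_sub_ne_zero k hcwim.ne
    rw [hg]
    simp only
    rw [dslope_of_ne _ (sub_ne_zero.1 h1), slope_def_module, ← sub_smul, ← smul_sub, smul_smul,
      inv_sub_inv h1 h2]
    congr 1
    field_simp
    ring
  have i1 : Integrable fun k : ℝ => ((k : ℂ) - w)⁻¹ • G k :=
    integrable_smul_of_memLp (memLp_inv_sub hw.ne') hG2
  have i2 : Integrable fun k : ℝ => ((k : ℂ) - cw)⁻¹ • G k :=
    integrable_smul_of_memLp (memLp_inv_sub hcwim.ne) hG2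
  have i3 : Integrable fun k : ℝ => (((k : ℂ) - w)⁻¹ - ((k : ℂ) - cw)⁻¹) • G w := by
    have i4 := (i1.sub i2).sub (by simpa using hgi 0 le_rfl hw.ne : Integrable fun k : ℝ => g k)
    refine i4.congr (ae_of_all _ fun k => ?_)
    simp only [Pi.sub_apply, hgk]
    abel
  simp_rw [hgk] at h0
  have i12 : Integrable fun k : ℝ => ((k : ℂ) - w)⁻¹ • G k - ((k : ℂ) - cw)⁻¹ • G k := i1.sub i2
  rw [integral_sub i12 i3, integral_sub i1 i2, hlow, sub_zero, integral_smul_const,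
    integral_poissonKernel hw, sub_eq_zero] at h0
  exact h0

end Hardy

/-! ### Fatou's theorem: Poisson integrals at Lebesgue points. -/

section Poisson

open Metric

theorem lintegral_Ioi_two_mul_div_sq {a : ℝ} (ha : 0 ≤ a) :
    ∫⁻ s in Set.Ioi a, ENNReal.ofReal (2 * s / (1 + s ^ 2) ^ 2) =
      ENNReal.ofReal ((1 + a ^ 2)⁻¹) := by
  have hder : ∀ x ∈ Set.Ici a, HasDerivAt (fun s : ℝ => -(1 + s ^ 2)⁻¹)
      (2 * x / (1 + x ^ 2) ^ 2) x := by
    intro x _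
    have h1 : HasDerivAt (fun s : ℝ => 1 + s ^ 2) (2 * x) x := by
      simpa using (hasDerivAt_pow 2 x).const_add 1
    refine (h1.fun_inv (by positivity)).fun_neg.congr_deriv ?_
    ring
  have hpos : ∀ x ∈ Set.Ioi a, 0 ≤ 2 * x / (1 + x ^ 2) ^ 2 := fun x hx => by
    have : 0 < x := ha.trans_lt hx
    positivity
  have hlim : Tendsto (fun s : ℝ => -(1 + s ^ 2)⁻¹) atTop (𝓝 0) := by
    rw [← neg_zero]
    refine Tendsto.neg (tendsto_inv_atTop_zero.comp ?_)
    exact tendsto_atTop_add_const_left _ _ (tendsto_pow_atTop two_ne_zero)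
  have hint := integrableOn_Ioi_deriv_of_nonneg' hder hpos hlim
  rw [← ofReal_integral_eq_lintegral_ofReal hint
    ((ae_restrict_iff' measurableSet_Ioi).2 (ae_of_all _ hpos)),
    integral_Ioi_of_hasDerivAt_of_nonneg' hder hpos hlim]
  simp

/-- The Poisson kernel is a superposition of indicators of balls. The Poisson integral is therefore
a weighted mean of the ball averages at radius `ε s`, with integrable weight independent of `ε`, and
dominated convergence applies. -/
theorem tendsto_lintegral_poisson {φ : ℝ → ℝ≥0∞} (hφ : Measurable φ) {x : ℝ}
    (h0 : Tendsto (fun r : ℝ => (∫⁻ y in closedBall x r, φ y) / ENNReal.ofReal (2 * r))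
      (𝓝[>] 0) (𝓝 0))
    {B : ℝ≥0} (hB : ∀ r : ℝ, 0 < r → (∫⁻ y in closedBall x r, φ y) / ENNReal.ofReal (2 * r) ≤ B) :
    Tendsto (fun ε : ℝ => ∫⁻ y, ENNReal.ofReal (ε / ((y - x) ^ 2 + ε ^ 2)) * φ y)
      (𝓝[>] 0) (𝓝 0) := by
  set avg : ℝ → ℝ≥0∞ := fun r => (∫⁻ y in closedBall x r, φ y) / ENNReal.ofReal (2 * r) with havg
  -- Layer-cake form: `ε / (d² + ε²) = ε⁻¹ ∫_{d/ε}^∞ 2s / (1 + s²)² ds` with `d = |y - x|`, followed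
  -- by an exchange of integrals.
  have key : ∀ ε : ℝ, 0 < ε → ∫⁻ y, ENNReal.ofReal (ε / ((y - x) ^ 2 + ε ^ 2)) * φ y =
      ∫⁻ s in Set.Ioi (0 : ℝ), ENNReal.ofReal (4 * s ^ 2 / (1 + s ^ 2) ^ 2) * avg (ε * s) := by
    intro ε hε
    have h1 : ∀ y, ENNReal.ofReal (ε / ((y - x) ^ 2 + ε ^ 2)) * φ y =
        ∫⁻ s in Set.Ioi (0 : ℝ), ENNReal.ofReal (ε⁻¹ * (2 * s / (1 + s ^ 2) ^ 2)) *
          ({p : ℝ × ℝ | |p.1 - x| < ε * p.2}.indicator (fun p => φ p.1) (y, s)) := by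
      intro y
      have h2 : ∀ s, ENNReal.ofReal (ε⁻¹ * (2 * s / (1 + s ^ 2) ^ 2)) *
          ({p : ℝ × ℝ | |p.1 - x| < ε * p.2}.indicator (fun p => φ p.1) (y, s)) =
          (Set.Ioi (|y - x| / ε)).indicator
            (fun s => ENNReal.ofReal (ε⁻¹ * (2 * s / (1 + s ^ 2) ^ 2)) * φ y) s := by
        intro s
        by_cases hs : |y - x| < ε * s
        · rw [Set.indicator_of_mem (show (y, s) ∈ {p : ℝ × ℝ | |p.1 - x| < ε * p.2} from hs),
            Set.indicator_of_mem (by rw [Set.mem_Ioi, div_lt_iff₀ hε]; linarith)]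
        · rw [Set.indicator_of_notMem (show (y, s) ∉ {p : ℝ × ℝ | |p.1 - x| < ε * p.2} from hs),
            Set.indicator_of_notMem (by rw [Set.mem_Ioi, div_lt_iff₀ hε]; linarith), mul_zero]
      have ha : 0 ≤ |y - x| / ε := by positivity
      simp_rw [h2]
      rw [setLIntegral_indicator measurableSet_Ioi,
        Set.inter_eq_left.2 (Set.Ioi_subset_Ioi ha), lintegral_mul_const _ (by fun_prop)]
      congr 1
      simp_rw [ENNReal.ofReal_mul (inv_nonneg.2 hε.le)]
      rw [lintegral_const_mul _ (by fun_prop), lintegral_Ioi_two_mul_div_sq ha,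
        ← ENNReal.ofReal_mul (inv_nonneg.2 hε.le)]
      congr 1
      rw [div_pow, sq_abs]
      field_simp
      ring
    simp_rw [h1]
    rw [lintegral_lintegral_swap]
    swap
    · refine Measurable.aemeasurable (Measurable.mul ?_ ?_)
      · fun_prop
      · exact (hφ.comp measurable_fst).indicator
          (measurableSet_lt (by fun_prop) (by fun_prop))
    refine setLIntegral_congr_fun measurableSet_Ioi fun s hs => ?_
    have hs0 : 0 < s := hs
    rw [lintegral_const_mul]
    swap
    · exact ((hφ.comp measurable_fst).indicator
          (measurableSet_lt (by fun_prop) (by fun_prop))).comp (measurable_id.prodMk measurable_const)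
    have h3 : ∫⁻ y, {p : ℝ × ℝ | |p.1 - x| < ε * p.2}.indicator (fun p => φ p.1) (y, s) =
        ∫⁻ y in closedBall x (ε * s), φ y := by
      have h4 : ∀ y, {p : ℝ × ℝ | |p.1 - x| < ε * p.2}.indicator (fun p => φ p.1) (y, s) =
          (ball x (ε * s)).indicator φ y := by
        intro y
        by_cases hy : |y - x| < ε * s
        · rw [Set.indicator_of_mem (show (y, s) ∈ {p : ℝ × ℝ | |p.1 - x| < ε * p.2} from hy),
            Set.indicator_of_mem (by rw [mem_ball, Real.dist_eq]; exact hy)]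
        · rw [Set.indicator_of_notMem (show (y, s) ∉ {p : ℝ × ℝ | |p.1 - x| < ε * p.2} from hy),
            Set.indicator_of_notMem (by rw [mem_ball, Real.dist_eq]; exact hy)]
      simp_rw [h4]
      rw [lintegral_indicator measurableSet_ball, Real.ball_eq_Ioo, Real.closedBall_eq_Icc]
      exact setLIntegral_congr Ioo_ae_eq_Icc
    rw [h3, havg]
    simp only
    rw [ENNReal.div_eq_inv_mul, ← mul_assoc]
    congr 1
    rw [← ENNReal.ofReal_inv_of_pos (by positivity), ← ENNReal.ofReal_mul (by positivity)]
    congr 1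
    field_simp
    ring
  have hfun : (fun ε : ℝ => ∫⁻ s in Set.Ioi (0 : ℝ),
      ENNReal.ofReal (4 * s ^ 2 / (1 + s ^ 2) ^ 2) * avg (ε * s)) =ᶠ[𝓝[>] 0]
      fun ε : ℝ => ∫⁻ y, ENNReal.ofReal (ε / ((y - x) ^ 2 + ε ^ 2)) * φ y := by
    filter_upwards [self_mem_nhdsWithin] with ε hε using (key ε hε).symm
  refine Tendsto.congr' hfun ?_
  have hmono : Monotone fun r : ℝ => ∫⁻ y in closedBall x r, φ y := fun r r' h =>
    lintegral_mono_set (closedBall_subset_closedBall h)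
  have havgm : Measurable avg := hmono.measurable.div (by fun_prop)
  rw [show (0 : ℝ≥0∞) = ∫⁻ s in Set.Ioi (0 : ℝ), 0 by simp]
  refine tendsto_lintegral_filter_of_dominated_convergence'
    (fun s => ENNReal.ofReal (4 * (1 + s ^ 2)⁻¹) * B) ?_ ?_ ?_ ?_
  · refine Eventually.of_forall fun ε => Measurable.aemeasurable ?_
    exact Measurable.mul (by fun_prop) (havgm.comp (by fun_prop))
  · filter_upwards [self_mem_nhdsWithin] with ε hε
    refine (ae_restrict_iff' measurableSet_Ioi).2 (ae_of_all _ fun s hs => ?_)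
    refine mul_le_mul' (ENNReal.ofReal_le_ofReal ?_) (hB _ (mul_pos hε hs))
    rw [div_le_iff₀ (by positivity), pow_two (1 + s ^ 2), mul_assoc, ← mul_assoc (_)⁻¹,
      inv_mul_cancel₀ (by positivity)]
    nlinarith [sq_nonneg s]
  · rw [lintegral_mul_const _ (by fun_prop)]
    refine ENNReal.mul_ne_top ?_ ENNReal.coe_ne_top
    have := (integrable_inv_one_add_sq.const_mul 4).integrableOn (s := Set.Ioi 0)
    exact (this.lintegral_lt_top).ne
  · refine (ae_restrict_iff' measurableSet_Ioi).2 (ae_of_all _ fun s hs => ?_)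
    have h1 : Tendsto (fun ε : ℝ => ε * s) (𝓝[>] 0) (𝓝[>] 0) := by
      refine tendsto_nhdsWithin_iff.2 ⟨?_, ?_⟩
      · have : Tendsto (fun ε : ℝ => ε * s) (𝓝 0) (𝓝 (0 * s)) := by
          exact (continuous_mul_const s).tendsto 0
        rw [zero_mul] at this
        exact this.mono_left nhdsWithin_le_nhds
      · filter_upwards [self_mem_nhdsWithin] with ε hε using mul_pos hε (show 0 < s from hs)
    have h2 := ENNReal.Tendsto.const_mul (a := ENNReal.ofReal (4 * s ^ 2 / (1 + s ^ 2) ^ 2))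
      (h0.comp h1) (Or.inr ENNReal.ofReal_ne_top)
    simpa using h2

variable {E : Type*} [NormedAddCommGroup E]

/-- At a Lebesgue point the averages of `‖f y - f x‖` tend to `0`. The uniform bound on them comes
from this limit for small radii and from the `L²` norm for large ones. -/
theorem tendsto_lintegral_poisson_ae {f : ℝ → E} (hf : StronglyMeasurable f)
    (hf2 : MemLp f 2) : ∀ᵐ x : ℝ, Tendsto
      (fun ε : ℝ => ∫⁻ y, ENNReal.ofReal (ε / ((y - x) ^ 2 + ε ^ 2)) * ‖f y - f x‖ₑ)
      (𝓝[>] 0) (𝓝 0) := by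
  have hloc : LocallyIntegrable f := hf2.locallyIntegrable (by norm_num)
  filter_upwards [IsUnifLocDoublingMeasure.ae_tendsto_average_norm_sub volume hloc 1] with x hx
  have hx1 := hx (fun _ : ℝ => x) (fun r : ℝ => r) (l := 𝓝[>] 0) tendsto_id (by
    filter_upwards [self_mem_nhdsWithin] with r hr
    have : (0 : ℝ) < r := hr
    simp [this.le])
  have hmeas : Measurable fun y => ‖f y - f x‖ₑ := (hf.sub stronglyMeasurable_const).enorm
  have hvol : ∀ r : ℝ, volume (closedBall x r) = ENNReal.ofReal (2 * r) := fun r => by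
    rw [Real.volume_closedBall]
  have h0 : Tendsto (fun r : ℝ => (∫⁻ y in closedBall x r, ‖f y - f x‖ₑ) / ENNReal.ofReal (2 * r))
      (𝓝[>] 0) (𝓝 0) := by
    have h1 := (ENNReal.continuous_ofReal.tendsto 0).comp hx1
    rw [ENNReal.ofReal_zero] at h1
    refine h1.congr' ?_
    filter_upwards [self_mem_nhdsWithin] with r hr
    have hr0 : (0 : ℝ) < r := hr
    have hi : IntegrableOn (fun y => ‖f y - f x‖) (closedBall x r) :=
      ((hloc.integrableOn_isCompact (isCompact_closedBall x r)).sub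
        (integrableOn_const (by rw [hvol]; exact ENNReal.ofReal_ne_top))).norm
    simp only [Function.comp_apply]
    rw [setAverage_eq, measureReal_def, hvol, ENNReal.toReal_ofReal (by positivity), smul_eq_mul,
      ENNReal.ofReal_mul (by positivity), ENNReal.ofReal_inv_of_pos (by positivity),
      ofReal_integral_eq_lintegral_ofReal hi (ae_of_all _ fun y => norm_nonneg _),
      ENNReal.div_eq_inv_mul]
    simp_rw [ofReal_norm]
  obtain ⟨δ, hδ, hδ1⟩ : ∃ δ : ℝ, 0 < δ ∧ ∀ r : ℝ, 0 < r → r < δ →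
      (∫⁻ y in closedBall x r, ‖f y - f x‖ₑ) / ENNReal.ofReal (2 * r) ≤ 1 := by
    have := h0.eventually (gt_mem_nhds zero_lt_one)
    rw [eventually_nhdsWithin_iff] at this
    obtain ⟨δ, hδ, h⟩ := Metric.eventually_nhds_iff.1 this
    refine ⟨δ, hδ, fun r hr hrδ => (h (y := r) ?_ hr).le⟩
    rwa [Real.dist_eq, sub_zero, abs_of_pos hr]
  obtain ⟨C, hC⟩ : ∃ C : ℝ≥0, ∫⁻ y, ‖f y‖ₑ ^ 2 ≤ C := by
    have h1 := ((memLp_two_iff_integrable_sq_norm hf2.1).1 hf2).lintegral_lt_top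
    refine ⟨(∫⁻ y, ENNReal.ofReal (‖f y‖ ^ 2)).toNNReal, ?_⟩
    rw [ENNReal.coe_toNNReal h1.ne]
    refine le_of_eq (lintegral_congr fun y => ?_)
    rw [← ofReal_norm, ENNReal.ofReal_pow (norm_nonneg _)]
  refine tendsto_lintegral_poisson hmeas h0 (B := 1 + (C / Real.toNNReal (2 * δ) + 1 + ‖f x‖₊))
    fun r hr => ?_
  push_cast
  by_cases hrδ : r < δ
  · exact (hδ1 r hr hrδ).trans le_self_add
  · rw [not_lt] at hrδ
    refine le_trans ?_ le_add_self
    have h2r : ENNReal.ofReal (2 * r) ≠ 0 := by simpa using hr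
    refine ENNReal.div_le_of_le_mul ?_
    calc ∫⁻ y in closedBall x r, ‖f y - f x‖ₑ
        ≤ ∫⁻ y in closedBall x r, (‖f y‖ₑ ^ 2 + (1 + ‖f x‖ₑ)) := by
          refine lintegral_mono fun y => ?_
          -- The bound `‖f‖ ≤ ‖f‖² + 1` turns the global `L²` bound into a bound for averages over
          -- balls of radius at least `δ`.
          have h1 : ‖f y - f x‖ ≤ ‖f y‖ ^ 2 + (1 + ‖f x‖) := by
            have := norm_sub_le (f y) (f x)
            nlinarith [sq_nonneg (‖f y‖ - 1)]
          calc ‖f y - f x‖ₑ = ENNReal.ofReal ‖f y - f x‖ := (ofReal_norm _).symm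
            _ ≤ ENNReal.ofReal (‖f y‖ ^ 2 + (1 + ‖f x‖)) := ENNReal.ofReal_le_ofReal h1
            _ = _ := by
              rw [ENNReal.ofReal_add (by positivity) (by positivity),
                ENNReal.ofReal_add zero_le_one (norm_nonneg _), ENNReal.ofReal_pow (norm_nonneg _),
                ofReal_norm, ofReal_norm, ENNReal.ofReal_one]
      _ ≤ C + (1 + ‖f x‖ₑ) * ENNReal.ofReal (2 * r) := by
          rw [lintegral_add_right _ measurable_const, setLIntegral_const, hvol]
          gcongr
          exact (setLIntegral_le_lintegral _ _).trans hC
      _ ≤ (C / ENNReal.ofReal (2 * δ)) * ENNReal.ofReal (2 * r) +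
          (1 + ‖f x‖ₑ) * ENNReal.ofReal (2 * r) := by
          gcongr
          calc (C : ℝ≥0∞) = (C / ENNReal.ofReal (2 * δ)) * ENNReal.ofReal (2 * δ) :=
                (ENNReal.div_mul_cancel (by simpa using hδ) ENNReal.ofReal_ne_top).symm
            _ ≤ _ := by gcongr
      _ = _ := by
          rw [ENNReal.coe_div (by simpa using hδ)]
          rw [← add_mul, ← add_assoc]
          rfl

variable [NormedSpace ℝ E] [CompleteSpace E]

theorem tendsto_integral_poisson_ae {f : ℝ → E} (hf : StronglyMeasurable f) (hf2 : MemLp f 2)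
    (hint : ∀ x ε : ℝ, 0 < ε → Integrable fun y => (ε / ((y - x) ^ 2 + ε ^ 2)) • f y) :
    ∀ᵐ x : ℝ, Tendsto (fun ε : ℝ => ∫ y, (ε / ((y - x) ^ 2 + ε ^ 2)) • f y)
      (𝓝[>] 0) (𝓝 (Real.pi • f x)) := by
  filter_upwards [tendsto_lintegral_poisson_ae hf hf2] with x hx
  rw [tendsto_iff_edist_tendsto_0]
  refine tendsto_of_tendsto_of_tendsto_of_le_of_le' tendsto_const_nhds hx
    (Eventually.of_forall fun _ => zero_le) ?_
  filter_upwards [self_mem_nhdsWithin] with ε hε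
  have hε0 : (0 : ℝ) < ε := hε
  have h1 : Real.pi • f x = ∫ y, (ε / ((y - x) ^ 2 + ε ^ 2)) • f x := by
    rw [integral_smul_const]
    congr 1
    simp_rw [div_eq_mul_inv]
    rw [integral_const_mul, integral_inv_sq_add_sq x hε0]
    field_simp
  have hic : Integrable fun y : ℝ => (ε / ((y - x) ^ 2 + ε ^ 2)) • f x := by
    simp_rw [div_eq_mul_inv]
    exact ((integrable_inv_sq_add_sq x hε0.ne').const_mul ε).smul_const _
  rw [edist_eq_enorm_sub, h1, ← integral_sub (hint x ε hε0) hic]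
  refine (enorm_integral_le_lintegral_enorm _).trans (lintegral_mono fun y => ?_)
  rw [← smul_sub, enorm_smul, Real.enorm_eq_ofReal (by positivity)]

end Poisson

/-! ### Cauchy kernels in `L²` and boundary functions. -/

section Hardy

open Metric Complex

variable {E : Type*} [NormedAddCommGroup E] [InnerProductSpace ℂ E]

open Classical in
/-- The Cauchy kernel `k ↦ (k - conj w)⁻¹ u` as an element of `L²(ℝ; E)`, for non-real `w`. -/
noncomputable def kern (w : ℂ) (u : E) : Lp E 2 (volume : Measure ℝ) :=
  if h : (starRingEnd ℂ w).im ≠ 0 then (memLp_kernel h u).toLp _ else 0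

theorem coeFn_kern {w : ℂ} (hw : w.im ≠ 0) (u : E) :
    kern w u =ᵐ[volume] fun k : ℝ => ((k : ℂ) - starRingEnd ℂ w)⁻¹ • u := by
  have h : (starRingEnd ℂ w).im ≠ 0 := by simpa using hw
  rw [kern, dif_pos h]
  exact MemLp.coeFn_toLp _

theorem integrable_inv_sub_smul (f : Lp E 2 (volume : Measure ℝ)) {w : ℂ} (hw : w.im ≠ 0) :
    Integrable fun k : ℝ => ((k : ℂ) - w)⁻¹ • f k :=
  integrable_smul_of_memLp (memLp_inv_sub hw) (Lp.memLp f)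

theorem inner_kern_left [CompleteSpace E] {w : ℂ} (hw : w.im ≠ 0) (u : E)
    (f : Lp E 2 (volume : Measure ℝ)) :
    inner ℂ (kern w u) f = inner ℂ u (∫ k : ℝ, ((k : ℂ) - w)⁻¹ • f k) := by
  rw [L2.inner_def, ← integral_inner (integrable_inv_sub_smul f hw)]
  refine integral_congr_ae ?_
  filter_upwards [coeFn_kern hw u] with k hk
  rw [hk, inner_smul_left, inner_smul_right]
  simp

/-- `f` is the boundary function of `F`. -/
def HasBdry (F : ℂ → E) (f : Lp E 2 (volume : Measure ℝ)) : Prop :=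
  ∀ᵐ k : ℝ, Tendsto (fun ε : ℝ => F ((k : ℂ) + ε * I)) (𝓝[>] 0) (𝓝 (f k))

omit [InnerProductSpace ℂ E] in
theorem HasBdry.unique {F : ℂ → E} {f g : Lp E 2 (volume : Measure ℝ)} (hf : HasBdry F f)
    (hg : HasBdry F g) : f = g := by
  refine Lp.ext ?_
  filter_upwards [hf, hg] with k h1 h2 using tendsto_nhds_unique h1 h2

omit [InnerProductSpace ℂ E] in
theorem HasBdry.add {F G : ℂ → E} {f g : Lp E 2 (volume : Measure ℝ)} (hf : HasBdry F f)
    (hg : HasBdry G g) : HasBdry (fun z => F z + G z) (f + g) := by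
  filter_upwards [hf, hg, Lp.coeFn_add f g] with k h1 h2 h3
  rw [h3]
  exact h1.add h2

omit [InnerProductSpace ℂ E] in
theorem HasBdry.sub {F G : ℂ → E} {f g : Lp E 2 (volume : Measure ℝ)} (hf : HasBdry F f)
    (hg : HasBdry G g) : HasBdry (fun z => F z - G z) (f - g) := by
  filter_upwards [hf, hg, Lp.coeFn_sub f g] with k h1 h2 h3
  rw [h3]
  exact h1.sub h2

theorem HasBdry.const_smul {F : ℂ → E} {f : Lp E 2 (volume : Measure ℝ)} (hf : HasBdry F f)
    (c : ℂ) : HasBdry (fun z => c • F z) (c • f) := by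
  filter_upwards [hf, Lp.coeFn_smul c f] with k h1 h3
  rw [h3]
  exact Tendsto.const_smul h1 c

omit [InnerProductSpace ℂ E] in
theorem HasBdry.congr {F G : ℂ → E} {f : Lp E 2 (volume : Measure ℝ)} (hf : HasBdry F f)
    (h : ∀ᵐ k : ℝ, ∀ᶠ ε : ℝ in 𝓝[>] 0, F ((k : ℂ) + ε * I) = G ((k : ℂ) + ε * I)) :
    HasBdry G f := by
  filter_upwards [hf, h] with k h1 h2 using h1.congr' h2

omit [InnerProductSpace ℂ E] in
theorem HasBdry.congr_upper {F G : ℂ → E} {f : Lp E 2 (volume : Measure ℝ)} (hf : HasBdry F f)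
    (h : ∀ z : ℂ, 0 < z.im → F z = G z) : HasBdry G f :=
  hf.congr <| ae_of_all _ fun k => by
    filter_upwards [self_mem_nhdsWithin] with ε hε
    exact h _ (by simpa using hε)

theorem tendsto_add_mul_I (k : ℝ) :
    Tendsto (fun ε : ℝ => (k : ℂ) + ε * I) (𝓝[>] 0) (𝓝 (k : ℂ)) := by
  have h : Continuous fun ε : ℝ => (k : ℂ) + ε * I := by fun_prop
  have := h.tendsto 0
  simp only [ofReal_zero, zero_mul, add_zero] at this
  exact this.mono_left nhdsWithin_le_nhds

theorem hasBdry_kern {w : ℂ} (hw : w.im ≠ 0) (u : E) :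
    HasBdry (fun z => (z - starRingEnd ℂ w)⁻¹ • u) (kern w u) := by
  filter_upwards [coeFn_kern hw u] with k hk
  rw [hk]
  have h1 : (k : ℂ) - starRingEnd ℂ w ≠ 0 := ofReal_sub_ne_zero k (by simpa using hw)
  exact (((tendsto_add_mul_I k).sub_const _).inv₀ h1).smul_const u

theorem isHardy_kern {w : ℂ} (hw : 0 < w.im) (u : E) :
    IsHardy fun z => (z - starRingEnd ℂ w)⁻¹ • u := by
  have him : ∀ z : ℂ, 0 ≤ z.im → z - starRingEnd ℂ w ≠ 0 := fun z hz h => by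
    have := congrArg Complex.im h
    simp at this
    linarith
  refine ⟨fun z hz => ?_, Real.toNNReal (Real.pi / w.im * ‖u‖ ^ 2), fun ε hε => ?_⟩
  · have := him z (le_of_lt hz)
    exact DifferentiableAt.differentiableWithinAt (by fun_prop (disch := assumption))
  · have h1 : ∀ k : ℝ, ((k : ℂ) + ε * I) - starRingEnd ℂ w =
        k - (starRingEnd ℂ w - ε * I) := fun k => by ring
    simp_rw [h1]
    have h2 : (starRingEnd ℂ w - ε * I).im ≠ 0 := by simp; linarith
    have h3 := (memLp_two_iff_integrable_sq_norm (memLp_kernel h2 u).1).1 (memLp_kernel h2 u)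
    have h4 : ∀ k : ℝ, ‖((k : ℂ) - (starRingEnd ℂ w - ε * I))⁻¹ • u‖ₑ ^ 2 =
        ENNReal.ofReal (‖((k : ℂ) - (starRingEnd ℂ w - ε * I))⁻¹ • u‖ ^ 2) := fun k => by
      rw [← ofReal_norm, ENNReal.ofReal_pow (norm_nonneg _)]
    simp_rw [h4]
    rw [← ofReal_integral_eq_lintegral_ofReal h3 (ae_of_all _ fun k => by positivity)]
    refine ENNReal.ofReal_le_ofReal ?_
    simp_rw [norm_smul, mul_pow]
    rw [integral_mul_const, integral_norm_inv_sub_sq h2]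
    gcongr
    rw [le_abs]
    right
    simp
    linarith

variable [CompleteSpace E]

/-- The Cauchy kernels at `x + iε` and `x - iε` differ by `2i` times the Poisson kernel, so the jump
of the Cauchy integral across the real line recovers `f`. -/
theorem tendsto_cauchy_sub_ae (f : Lp E 2 (volume : Measure ℝ)) : ∀ᵐ x : ℝ,
    Tendsto (fun ε : ℝ => (2 * Real.pi * I : ℂ)⁻¹ •
      ((∫ k : ℝ, ((k : ℂ) - (x + ε * I))⁻¹ • f k) -
        ∫ k : ℝ, ((k : ℂ) - starRingEnd ℂ (x + ε * I))⁻¹ • f k)) (𝓝[>] 0) (𝓝 (f x)) := by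
  have hker : ∀ (x ε : ℝ), 0 < ε → ∀ k : ℝ, (ε / ((k - x) ^ 2 + ε ^ 2)) • f k =
      (2 * I)⁻¹ • (((k : ℂ) - (x + ε * I))⁻¹ • f k -
        ((k : ℂ) - starRingEnd ℂ (x + ε * I))⁻¹ • f k) := by
    intro x ε hε k
    have n1 : (k : ℂ) - (x + ε * I) ≠ 0 := ofReal_sub_ne_zero k (by simpa using hε.ne')
    have n2 : (k : ℂ) - starRingEnd ℂ (x + ε * I) ≠ 0 :=
      ofReal_sub_ne_zero k (by simpa using hε.ne')
    have h3 : (((k - x) ^ 2 + ε ^ 2 : ℝ) : ℂ) =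
        (k - (x + ε * I)) * (k - starRingEnd ℂ (x + ε * I)) := by
      simp only [map_add, map_mul, conj_ofReal, conj_I]
      push_cast
      ring_nf
      rw [I_sq]
      ring
    rw [← sub_smul, smul_smul, inv_sub_inv n1 n2, ← h3, ← Complex.coe_smul]
    congr 1
    have : (((k - x) ^ 2 + ε ^ 2 : ℝ) : ℂ) ≠ 0 := by
      rw [h3]; exact mul_ne_zero n1 n2
    have hI := I_ne_zero
    rw [ofReal_div]
    field_simp
    simp only [map_add, map_mul, conj_ofReal, conj_I]
    ring
  have him : ∀ x ε : ℝ, 0 < ε →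
      ((x + ε * I : ℂ)).im ≠ 0 ∧ (starRingEnd ℂ (x + ε * I : ℂ)).im ≠ 0 :=
    fun x ε hε => ⟨by simpa using hε.ne', by simpa using hε.ne'⟩
  have hint : ∀ x ε : ℝ, 0 < ε → Integrable fun y => (ε / ((y - x) ^ 2 + ε ^ 2)) • f y := by
    intro x ε hε
    simp_rw [hker x ε hε]
    exact ((integrable_inv_sub_smul f (him x ε hε).1).sub
      (integrable_inv_sub_smul f (him x ε hε).2)).smul _
  filter_upwards [tendsto_integral_poisson_ae (Lp.stronglyMeasurable f) (Lp.memLp f) hint]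
    with x hx
  have h2 := hx.const_smul (Real.pi : ℝ)⁻¹
  rw [smul_smul, inv_mul_cancel₀ Real.pi_ne_zero, one_smul] at h2
  refine h2.congr' ?_
  filter_upwards [self_mem_nhdsWithin] with ε hε
  have hε0 : (0 : ℝ) < ε := hε
  simp_rw [hker x ε hε0]
  rw [integral_smul, integral_sub (integrable_inv_sub_smul f (him x ε hε0).1)
    (integrable_inv_sub_smul f (him x ε hε0).2), ← Complex.coe_smul, smul_smul]
  congr 1
  push_cast
  field_simp

/-- The kernels with poles on both sides are total in `L²`: if all Cauchy integrals of `f` vanish,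
so does their jump, which is `f`. -/
theorem eq_zero_of_inner_kern {f : Lp E 2 (volume : Measure ℝ)}
    (h : ∀ w : ℂ, w.im ≠ 0 → ∀ u : E, inner ℂ (kern w u) f = 0) : f = 0 := by
  have h1 : ∀ w : ℂ, w.im ≠ 0 → ∫ k : ℝ, ((k : ℂ) - w)⁻¹ • f k = 0 := fun w hw => by
    refine ext_inner_left ℂ fun u => ?_
    rw [← inner_kern_left hw, h w hw u, inner_zero_right]
  refine Lp.ext ?_
  filter_upwards [tendsto_cauchy_sub_ae f, Lp.coeFn_zero E 2 (volume : Measure ℝ)] with x hx h0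
  rw [h0]
  refine tendsto_nhds_unique hx (tendsto_const_nhds.congr' ?_)
  filter_upwards [self_mem_nhdsWithin] with ε hε
  have hε0 : (0 : ℝ) < ε := hε
  rw [h1 _ (by simpa using hε0.ne'), h1 _ (by simpa using hε0.ne')]
  simp

omit [CompleteSpace E] in
-- Weak compactness of balls, along an ultrafilter so that no separability is needed.
theorem exists_tendsto_inner_of_norm_le {K : Type*} [NormedAddCommGroup K] [InnerProductSpace ℂ K]
    [CompleteSpace K] {ι : Type*} {l : Filter ι} [l.NeBot] (g : ι → K) {M : ℝ}
    (hg : ∀ i, ‖g i‖ ≤ M) : ∃ U : Ultrafilter ι, ↑U ≤ l ∧ ∃ f : K, ∀ h : K,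
      Tendsto (fun i => inner ℂ h (g i)) U (𝓝 (inner ℂ h f)) := by
  obtain ⟨U, hU⟩ := Ultrafilter.exists_le l
  refine ⟨U, hU, ?_⟩
  let φ : ι → WeakDual ℂ K := fun i => StrongDual.toWeakDual (InnerProductSpace.toDual ℂ K (g i))
  obtain ⟨x, -, hx⟩ := (WeakDual.isCompact_closedBall (𝕜 := ℂ) (E := K) 0 M).ultrafilter_le_nhds
    (U.map φ) (by
      simp only [le_principal_iff]
      refine Ultrafilter.mem_map.2 (univ_mem' fun i => ?_)
      simpa [φ] using hg i)
  obtain ⟨f, hf⟩ := (InnerProductSpace.toDual ℂ K).surjective (WeakDual.toStrongDual x)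
  refine ⟨f, fun h => ?_⟩
  have h1 : Tendsto (fun i => φ i h) U (𝓝 (x h)) :=
    ((WeakDual.eval_continuous h).tendsto x).comp hx
  have h2 : x h = inner ℂ f h := by
    have : (InnerProductSpace.toDual ℂ K f) h = x h := by rw [hf]; rfl
    rw [← this]; rfl
  rw [h2] at h1
  have h3 := (Complex.continuous_conj.tendsto _).comp h1
  rw [inner_conj_symm] at h3
  refine h3.congr fun i => ?_
  simp only [Function.comp_apply]
  exact inner_conj_symm _ _

/-- The function `f` is a weak limit of the slices `F(· + ic)` as `c → 0`. Each shifted function is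
bounded and holomorphic up to the real line, so both Cauchy formulas hold for it and pass to the
limit. -/
theorem IsHardy.exists_repr {F : ℂ → E} (hF : IsHardy F) :
    ∃ f : Lp E 2 (volume : Measure ℝ),
      (∀ w : ℂ, 0 < w.im → ∀ u, inner ℂ (kern w u) f = 2 * Real.pi * I * inner ℂ u (F w)) ∧
      (∀ w : ℂ, w.im < 0 → ∀ u, inner ℂ (kern w u) f = 0) := by
  obtain ⟨C, hC⟩ := hF.2
  have him : ∀ (c : ℝ) (x : ℝ), ((x : ℂ) + c * I).im = c := fun c x => by simp
  have hcont : ∀ c : ℝ, 0 < c → Continuous fun x : ℝ => F (x + c * I) := fun c hc =>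
    continuous_horizontal fun z hz => hF.differentiableAt (hz ▸ hc)
  have hmem := fun c hc => memLp_of_lintegral_sq_le (hcont c hc).aestronglyMeasurable (hC c hc)
  let g : {c : ℝ // 0 < c} → Lp E 2 (volume : Measure ℝ) := fun c => (hmem c.1 c.2).1.toLp _
  have hg : ∀ c, ‖g c‖ ≤ Real.sqrt C := by
    intro c
    refine Real.le_sqrt_of_sq_le ?_
    have h1 : ((‖g c‖ ^ 2 : ℝ) : ℂ) = ((∫ k : ℝ, ‖F (k + c.1 * I)‖ ^ 2 : ℝ) : ℂ) := by
      rw [ofReal_pow]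
      refine (inner_self_eq_norm_sq_to_K (𝕜 := ℂ) (g c)).symm.trans ?_
      rw [L2.inner_def, ← integral_complex_ofReal]
      refine integral_congr_ae ?_
      filter_upwards [MemLp.coeFn_toLp (hmem c.1 c.2).1] with k hk
      rw [hk, inner_self_eq_norm_sq_to_K]
      simp
    rw [ofReal_inj.1 h1]
    exact (hmem c.1 c.2).2
  have hline : ∀ c : {c : ℝ // 0 < c}, ∀ w : ℂ, w.im ≠ 0 → ∀ u : E,
      inner ℂ (kern w u) (g c) = inner ℂ u (∫ k : ℝ, ((k : ℂ) - w)⁻¹ • F (k + c.1 * I)) := by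
    intro c w hw u
    rw [inner_kern_left hw]
    congr 1
    refine integral_congr_ae ?_
    filter_upwards [MemLp.coeFn_toLp (hmem c.1 c.2).1] with k hk
    rw [hk]
  have hGd : ∀ c : ℝ, 0 < c → ∀ z : ℂ, 0 ≤ z.im → DifferentiableAt ℂ (fun z => F (z + c * I)) z :=
    fun c hc z hz => by
      refine DifferentiableAt.comp z (hF.differentiableAt ?_) (by fun_prop)
      simp; linarith
  have hGC : ∀ c : ℝ, 0 < c → ∀ y : ℝ, 0 ≤ y →
      ∫⁻ x : ℝ, ‖F ((x + y * I : ℂ) + c * I)‖ₑ ^ 2 ≤ C := fun c hc y hy => by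
    have := hC (y + c) (by linarith)
    convert this using 6 with x
    push_cast
    ring
  have hGM : ∀ c : ℝ, 0 < c → ∃ M, ∀ z : ℂ, 0 ≤ z.im → ‖F (z + c * I)‖ ≤ M := fun c hc => by
    obtain ⟨M, hM⟩ := hF.bounded hc
    exact ⟨M, fun z hz => hM _ (by simpa using hz)⟩
  let l : Filter {c : ℝ // 0 < c} := comap (fun c => c.1) (𝓝[>] 0)
  have hlne : l.NeBot := by
    refine comap_neBot_iff.2 fun s hs => ?_
    obtain ⟨a, ha1, ha2⟩ := Filter.nonempty_of_mem (inter_mem hs self_mem_nhdsWithin)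
    exact ⟨⟨a, ha2⟩, ha1⟩
  obtain ⟨U, hU, f, hf⟩ := exists_tendsto_inner_of_norm_le (l := l) g hg
  refine ⟨f, fun w hw u => ?_, fun w hw u => ?_⟩
  · refine tendsto_nhds_unique (hf (kern w u)) ?_
    have h1 : ∀ c : {c : ℝ // 0 < c}, inner ℂ (kern w u) (g c) =
        2 * Real.pi * I * inner ℂ u (F (w + c.1 * I)) := by
      intro c
      obtain ⟨M, hM⟩ := hGM c.1 c.2
      rw [hline c w hw.ne' u, cauchy_upper (hGd c.1 c.2) hM (hGC c.1 c.2) hw, inner_smul_right]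
    simp_rw [h1]
    have h2 : Tendsto (fun c : ℝ => 2 * Real.pi * I * inner ℂ u (F (w + c * I))) (𝓝[>] 0)
        (𝓝 (2 * Real.pi * I * inner ℂ u (F w))) := by
      have h3 : Tendsto (fun c : ℝ => w + c * I) (𝓝[>] 0) (𝓝 w) := by
        have h : Continuous fun ε : ℝ => w + ε * I := by fun_prop
        have := h.tendsto 0
        simp only [ofReal_zero, zero_mul, add_zero] at this
        exact this.mono_left nhdsWithin_le_nhds
      exact (Tendsto.inner tendsto_const_nhds
        ((hF.differentiableAt hw).continuousAt.tendsto.comp h3)).const_mul _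
    exact h2.comp (tendsto_comap.mono_left hU)
  · refine tendsto_nhds_unique (hf (kern w u)) ?_
    refine tendsto_const_nhds.congr fun c => ?_
    obtain ⟨M, hM⟩ := hGM c.1 c.2
    rw [hline c w hw.ne u, cauchy_lower (hGd c.1 c.2) hM (hGC c.1 c.2) hw, inner_zero_right]

end Hardy

/-! ### The Hardy subspace of `L²`, boundary operators and duality. -/

section Hardy

open Metric Complex

variable {E : Type*} [NormedAddCommGroup E] [InnerProductSpace ℂ E] [CompleteSpace E]

/-- The upper Cauchy integral of `f` is `2πi F` and the lower one vanishes, so the jump formula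
gives convergence of `F` itself almost everywhere. -/
theorem hasBdry_of_repr {F : ℂ → E} {f : Lp E 2 (volume : Measure ℝ)}
    (h1 : ∀ w : ℂ, 0 < w.im → ∀ u, inner ℂ (kern w u) f = 2 * Real.pi * I * inner ℂ u (F w))
    (h2 : ∀ w : ℂ, w.im < 0 → ∀ u, inner ℂ (kern w u) f = 0) : HasBdry F f := by
  filter_upwards [tendsto_cauchy_sub_ae f] with x hx
  refine hx.congr' ?_
  filter_upwards [self_mem_nhdsWithin] with ε hε
  have hε0 : (0 : ℝ) < ε := hε
  set z : ℂ := x + ε * I with hz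
  have hzim : 0 < z.im := by simpa [hz] using hε0
  have e1 : ∫ k : ℝ, ((k : ℂ) - z)⁻¹ • f k = (2 * Real.pi * I : ℂ) • F z := by
    refine ext_inner_left ℂ fun u => ?_
    rw [← inner_kern_left hzim.ne', h1 z hzim, inner_smul_right]
  have e2 : ∫ k : ℝ, ((k : ℂ) - starRingEnd ℂ z)⁻¹ • f k = 0 := by
    have : (starRingEnd ℂ z).im < 0 := by simpa using hzim
    refine ext_inner_left ℂ fun u => ?_
    rw [← inner_kern_left this.ne, h2 _ this, inner_zero_right]
  rw [e1, e2, sub_zero, smul_smul, inv_mul_cancel₀ two_pi_I_ne_zero, one_smul]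

variable (E) in
/-- The closed subspace of `L²(ℝ; E)` formed by the boundary functions of the Hardy class. -/
noncomputable def hardySpace : Submodule ℂ (Lp E 2 (volume : Measure ℝ)) :=
  (Submodule.span ℂ {g | ∃ w : ℂ, 0 < w.im ∧ ∃ u : E, g = kern w u}).topologicalClosure

omit [CompleteSpace E] in
theorem kern_mem_hardySpace {w : ℂ} (hw : 0 < w.im) (u : E) : kern w u ∈ hardySpace E :=
  Submodule.le_topologicalClosure _ (Submodule.subset_span ⟨w, hw, u, rfl⟩)

omit [CompleteSpace E] in
theorem inner_eq_zero_of_mem_hardySpace {f g : Lp E 2 (volume : Measure ℝ)} (hf : f ∈ hardySpace E)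
    (h : ∀ w : ℂ, 0 < w.im → ∀ u : E, inner ℂ g (kern w u) = 0) : inner ℂ g f = 0 := by
  have h1 : hardySpace E ≤ LinearMap.ker (innerSL ℂ g : _ →ₗ[ℂ] ℂ) := by
    refine Submodule.topologicalClosure_minimal _ (Submodule.span_le.2 ?_) ?_
    · rintro _ ⟨w, hw, u, rfl⟩
      exact h w hw u
    · exact ContinuousLinearMap.isClosed_ker (innerSL ℂ g)
  exact h1 hf

theorem IsHardy.inner_kern {F : ℂ → E} (hF : IsHardy F) {f : Lp E 2 (volume : Measure ℝ)}
    (hf : HasBdry F f) {w : ℂ} (hw : 0 < w.im) (u : E) :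
    inner ℂ (kern w u) f = 2 * Real.pi * I * inner ℂ u (F w) := by
  obtain ⟨g, h1, h2⟩ := hF.exists_repr
  rw [hf.unique (hasBdry_of_repr h1 h2), h1 w hw u]

theorem IsHardy.inner_kern_lower {F : ℂ → E} (hF : IsHardy F) {f : Lp E 2 (volume : Measure ℝ)}
    (hf : HasBdry F f) {w : ℂ} (hw : w.im < 0) (u : E) : inner ℂ (kern w u) f = 0 := by
  obtain ⟨g, h1, h2⟩ := hF.exists_repr
  rw [hf.unique (hasBdry_of_repr h1 h2), h2 w hw u]

theorem inner_kern_lower_of_mem {f : Lp E 2 (volume : Measure ℝ)} (hf : f ∈ hardySpace E) {w : ℂ}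
    (hw : w.im < 0) (u : E) : inner ℂ (kern w u) f = 0 :=
  inner_eq_zero_of_mem_hardySpace hf fun _ hw' u' =>
    (isHardy_kern hw' u').inner_kern_lower (hasBdry_kern hw'.ne' u') hw u

instance : CompleteSpace (hardySpace E) :=
  (Submodule.isClosed_topologicalClosure _).completeSpace_coe

/-- The difference between `f` and its projection is orthogonal to the upper kernels by construction
and to the lower ones by hypothesis, hence zero by totality. -/
theorem mem_hardySpace_of_lower {f : Lp E 2 (volume : Measure ℝ)}
    (hf : ∀ w : ℂ, w.im < 0 → ∀ u, inner ℂ (kern w u) f = 0) : f ∈ hardySpace E := by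
  set p : Lp E 2 (volume : Measure ℝ) := (hardySpace E).starProjection f with hp
  have hpm : p ∈ hardySpace E := Submodule.starProjection_apply_mem _ _
  have h0 : f - p = 0 := by
    refine eq_zero_of_inner_kern fun w hw u => ?_
    rcases lt_or_gt_of_ne hw with hw | hw
    · rw [inner_sub_right, hf w hw u, inner_kern_lower_of_mem hpm hw, sub_zero]
    · exact Submodule.inner_right_of_mem_orthogonal (kern_mem_hardySpace hw u)
        (Submodule.sub_starProjection_mem_orthogonal f)
  rw [sub_eq_zero.1 h0]
  exact hpm

theorem IsHardy.mem_hardySpace {F : ℂ → E} (hF : IsHardy F) {f : Lp E 2 (volume : Measure ℝ)}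
    (hf : HasBdry F f) : f ∈ hardySpace E :=
  mem_hardySpace_of_lower fun _ hw u => hF.inner_kern_lower hf hw u

open Classical in
/-- The boundary function of `F`. -/
noncomputable def bdry (F : ℂ → E) : Lp E 2 (volume : Measure ℝ) :=
  if h : ∃ f, HasBdry F f then h.choose else 0

theorem IsHardy.hasBdry {F : ℂ → E} (hF : IsHardy F) : HasBdry F (bdry F) := by
  obtain ⟨g, h1, h2⟩ := hF.exists_repr
  have h : ∃ f, HasBdry F f := ⟨g, hasBdry_of_repr h1 h2⟩
  rw [bdry, dif_pos h]
  exact h.choose_spec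

omit [CompleteSpace E] in
omit [InnerProductSpace ℂ E] in
theorem HasBdry.bdry_eq {F : ℂ → E} {f : Lp E 2 (volume : Measure ℝ)} (hf : HasBdry F f) :
    bdry F = f := by
  have h : ∃ f, HasBdry F f := ⟨f, hf⟩
  rw [bdry, dif_pos h]
  exact h.choose_spec.unique hf

theorem eq_zero_of_mem_hardySpace {f : Lp E 2 (volume : Measure ℝ)} (hf : f ∈ hardySpace E)
    (h : ∀ w : ℂ, 0 < w.im → ∀ u : E, inner ℂ (kern w u) f = 0) : f = 0 :=
  eq_zero_of_inner_kern fun w hw u => by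
    rcases lt_or_gt_of_ne hw with hw | hw
    · exact inner_kern_lower_of_mem hf hw u
    · exact h w hw u

omit [CompleteSpace E] in
theorem IsHardy.of_norm_le {F G : ℂ → E} (hF : IsHardy F)
    (hG : DifferentiableOn ℂ G {z | 0 < z.im}) {C : ℝ}
    (h : ∀ z : ℂ, 0 < z.im → ‖G z‖ ≤ C * ‖F z‖) : IsHardy G := by
  obtain ⟨M, hM⟩ := hF.2
  refine ⟨hG, C.toNNReal ^ 2 * M, fun ε hε => ?_⟩
  calc ∫⁻ k : ℝ, ‖G (k + ε * I)‖ₑ ^ 2 ≤ ∫⁻ k : ℝ, (C.toNNReal : ℝ≥0∞) ^ 2 *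
        ‖F (k + ε * I)‖ₑ ^ 2 := by
        refine lintegral_mono fun k => ?_
        rw [← mul_pow]
        gcongr
        have h1 := h (k + ε * I) (by simpa using hε)
        have h2 : ‖G (k + ε * I)‖ ≤ C.toNNReal * ‖F (k + ε * I)‖ :=
          h1.trans (by gcongr; exact Real.le_coe_toNNReal C)
        rw [← ofReal_norm, ← ofReal_norm, ← ENNReal.ofReal_coe_nnreal,
          ← ENNReal.ofReal_mul (by positivity)]
        exact ENNReal.ofReal_le_ofReal h2
    _ ≤ _ := by
        rw [lintegral_const_mul' _ _ (by simp)]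
        push_cast
        gcongr
        exact hM ε hε

omit [CompleteSpace E] in
theorem IsHardy.add {F G : ℂ → E} (hF : IsHardy F) (hG : IsHardy G) :
    IsHardy fun z => F z + G z := by
  obtain ⟨M, hM⟩ := hF.2
  obtain ⟨N, hN⟩ := hG.2
  refine ⟨hF.1.add hG.1, 2 * M + 2 * N, fun ε hε => ?_⟩
  have hcont : Continuous fun x : ℝ => F (x + ε * I) :=
    continuous_horizontal fun z hz => hF.differentiableAt (hz ▸ hε)
  calc ∫⁻ k : ℝ, ‖F (k + ε * I) + G (k + ε * I)‖ₑ ^ 2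
      ≤ ∫⁻ k : ℝ, (2 * ‖F (k + ε * I)‖ₑ ^ 2 + 2 * ‖G (k + ε * I)‖ₑ ^ 2) := by
        refine lintegral_mono fun k => ?_
        rw [← ofReal_norm, ← ofReal_norm, ← ofReal_norm, ← ENNReal.ofReal_pow (norm_nonneg _),
          ← ENNReal.ofReal_pow (norm_nonneg _), ← ENNReal.ofReal_pow (norm_nonneg _),
          ← ENNReal.ofReal_ofNat 2, ← ENNReal.ofReal_mul (by positivity),
          ← ENNReal.ofReal_mul (by positivity), ← ENNReal.ofReal_add (by positivity) (by positivity)]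
        refine ENNReal.ofReal_le_ofReal ?_
        have h1 := norm_add_le (F (k + ε * I)) (G (k + ε * I))
        have h2 := norm_nonneg (F (k + ε * I) + G (k + ε * I))
        nlinarith [sq_nonneg (‖F (k + ε * I)‖ - ‖G (k + ε * I)‖)]
    _ ≤ _ := by
        rw [lintegral_add_left ((hcont.enorm.measurable.pow_const 2).const_mul _), lintegral_const_mul' _ _ (by simp),
          lintegral_const_mul' _ _ (by simp)]
        push_cast
        gcongr
        · exact hM ε hε
        · exact hN ε hε

omit [CompleteSpace E] in
theorem IsHardy.const_smul {F : ℂ → E} (hF : IsHardy F) (c : ℂ) : IsHardy fun z => c • F z :=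
  hF.of_norm_le (hF.1.const_smul c) (C := ‖c‖) fun _ _ => (norm_smul c _).le

omit [CompleteSpace E] in
theorem IsHardy.sub {F G : ℂ → E} (hF : IsHardy F) (hG : IsHardy G) :
    IsHardy fun z => F z - G z := by
  have := hF.add (hG.const_smul (-1))
  simpa [sub_eq_add_neg] using this

omit [CompleteSpace E] in
theorem isHardy_zero : IsHardy fun _ : ℂ => (0 : E) :=
  ⟨differentiableOn_const _, 0, fun _ _ => by simp⟩

omit [CompleteSpace E] in
/-- A function that is bounded near a bounded set and dominated by a Hardy function elsewhere. -/
theorem IsHardy.of_norm_le_off {F G : ℂ → E} (hF : IsHardy F)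
    (hG : DifferentiableOn ℂ G {z | 0 < z.im}) {C M : ℝ} {K : Set ℂ} (hK : Bornology.IsBounded K)
    (h : ∀ z : ℂ, 0 < z.im → z ∉ K → ‖G z‖ ≤ C * ‖F z‖)
    (h' : ∀ z : ℂ, 0 < z.im → z ∈ K → ‖G z‖ ≤ M) : IsHardy G := by
  obtain ⟨B, hB⟩ := hF.2
  obtain ⟨r, hr⟩ := hK.exists_norm_le
  refine ⟨hG, C.toNNReal ^ 2 * B + M.toNNReal ^ 2 * (2 * r).toNNReal, fun ε hε => ?_⟩
  have hcont : Continuous fun x : ℝ => F (x + ε * I) :=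
    continuous_horizontal fun z hz => hF.differentiableAt (hz ▸ hε)
  calc ∫⁻ k : ℝ, ‖G (k + ε * I)‖ₑ ^ 2 ≤ ∫⁻ k : ℝ, ((C.toNNReal : ℝ≥0∞) ^ 2 *
        ‖F (k + ε * I)‖ₑ ^ 2 + (Set.Icc (-r) r).indicator
          (fun _ => (M.toNNReal : ℝ≥0∞) ^ 2) k) := by
        refine lintegral_mono fun k => ?_
        have him : 0 < ((k : ℂ) + ε * I).im := by simpa using hε
        by_cases hk : (k : ℂ) + ε * I ∈ K
        · refine le_trans ?_ le_add_self
          rw [Set.indicator_of_mem]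
          · gcongr
            rw [← ofReal_norm]
            exact ENNReal.ofReal_le_ofReal (h' _ him hk)
          · have h1 := (Complex.abs_re_le_norm _).trans (hr _ hk)
            have h2 : |k| ≤ r := by simpa using h1
            exact ⟨(abs_le.1 h2).1, (abs_le.1 h2).2⟩
        · refine le_trans ?_ le_self_add
          rw [← mul_pow]
          gcongr
          have h2 : ‖G (k + ε * I)‖ ≤ C.toNNReal * ‖F (k + ε * I)‖ :=
            (h _ him hk).trans (by gcongr; exact Real.le_coe_toNNReal C)
          rw [← ofReal_norm, ← ofReal_norm, ← ENNReal.ofReal_coe_nnreal,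
            ← ENNReal.ofReal_mul (by positivity)]
          exact ENNReal.ofReal_le_ofReal h2
    _ ≤ _ := by
        rw [lintegral_add_left ((hcont.enorm.measurable.pow_const 2).const_mul _), lintegral_const_mul' _ _ (by simp),
          lintegral_indicator measurableSet_Icc, setLIntegral_const, Real.volume_Icc]
        push_cast
        gcongr
        · exact hB ε hε
        · rw [show r - -r = 2 * r by ring]
          rfl

omit [CompleteSpace E] in
/-- A bounded holomorphic family of operators acts on the Hardy class. -/
theorem IsHardy.clm_apply {F : ℂ → E} (hF : IsHardy F) {X : ℂ → E →L[ℂ] E}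
    (hX : DifferentiableOn ℂ X {z | 0 < z.im}) {C : ℝ} (hC : ∀ z : ℂ, 0 < z.im → ‖X z‖ ≤ C) :
    IsHardy fun z => X z (F z) :=
  hF.of_norm_le (hX.clm_apply hF.1) (C := C) fun z hz =>
    ((X z).le_opNorm _).trans (by gcongr; exact hC z hz)

omit [InnerProductSpace ℂ E] [CompleteSpace E] in
theorem norm_le_of_bdry {F G : ℂ → E} {f g : Lp E 2 (volume : Measure ℝ)} (hf : HasBdry F f)
    (hg : HasBdry G g) {C : ℝ} (h : ∀ z : ℂ, 0 < z.im → ‖G z‖ ≤ C * ‖F z‖) : ‖g‖ ≤ C * ‖f‖ := by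
  refine Lp.norm_le_mul_norm_of_ae_le_mul ?_
  filter_upwards [hf, hg] with k h1 h2
  refine le_of_tendsto_of_tendsto h2.norm (h1.norm.const_mul C) ?_
  filter_upwards [self_mem_nhdsWithin] with ε hε
  exact h _ (by simpa using hε)

/-- The boundary function depends continuously on the parameter of a linear family. -/
theorem exists_bdry_clm {K : Type*} [NormedAddCommGroup K] [InnerProductSpace ℂ K]
    [CompleteSpace K] {X : ℂ → K →L[ℂ] E} (hX : ∀ φ, IsHardy fun z => X z φ) :
    ∃ 𝔞 : K →L[ℂ] Lp E 2 (volume : Measure ℝ), ∀ φ, HasBdry (fun z => X z φ) (𝔞 φ) := by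
  let Φ : K →ₗ[ℂ] Lp E 2 (volume : Measure ℝ) :=
    { toFun := fun φ => bdry fun z => X z φ
      map_add' := fun φ ψ => by
        refine HasBdry.bdry_eq ?_
        simp_rw [map_add]
        exact (hX φ).hasBdry.add (hX ψ).hasBdry
      map_smul' := fun c φ => by
        refine HasBdry.bdry_eq ?_
        simp_rw [map_smul]
        exact (hX φ).hasBdry.const_smul c }
  have hΦ : ∀ φ, HasBdry (fun z => X z φ) (Φ φ) := fun φ => (hX φ).hasBdry
  have hcl : Continuous Φ := by
    -- Closed graph theorem. Pairing with an upper kernel is evaluation at `w`, which is continuous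
    -- in the parameter, and such pairings determine an element of the Hardy space.
    refine LinearMap.continuous_of_seq_closed_graph Φ fun u x y hu hy => ?_
    have hym : y ∈ hardySpace E :=
      (Submodule.isClosed_topologicalClosure _).mem_of_tendsto hy
        (Eventually.of_forall fun n => (hX (u n)).mem_hardySpace (hΦ (u n)))
    rw [← sub_eq_zero]
    refine eq_zero_of_mem_hardySpace (sub_mem hym ((hX x).mem_hardySpace (hΦ x))) fun w hw v => ?_
    rw [inner_sub_right, sub_eq_zero, (hX x).inner_kern (hΦ x) hw]
    have h1 : Tendsto (fun n => inner ℂ (kern w v) (Φ (u n))) atTop (𝓝 (inner ℂ (kern w v) y)) :=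
      tendsto_const_nhds.inner hy
    refine tendsto_nhds_unique h1 ?_
    have h2 : ∀ n, inner ℂ (kern w v) (Φ (u n)) = 2 * Real.pi * I * inner ℂ v (X w (u n)) :=
      fun n => (hX (u n)).inner_kern (hΦ (u n)) hw v
    simp_rw [h2]
    exact (tendsto_const_nhds.inner (((X w).continuous.tendsto x).comp hu)).const_mul _
  exact ⟨⟨Φ, hcl⟩, hΦ⟩

/-- An identity between scalar products that holds for the Cauchy kernels holds for all
functions of the Hardy class. -/
theorem inner_bdry_eq_of_kern {X : ℂ → E →L[ℂ] E} (hX : DifferentiableOn ℂ X {z | 0 < z.im})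
    {C : ℝ} (hC : ∀ z : ℂ, 0 < z.im → ‖X z‖ ≤ C) {η α : Lp E 2 (volume : Measure ℝ)}
    (hk : ∀ w : ℂ, 0 < w.im → ∀ u : E, inner ℂ (kern w u) η =
      inner ℂ (bdry fun z => X z ((z - starRingEnd ℂ w)⁻¹ • u)) α)
    {G : ℂ → E} (hG : IsHardy G) {g g' : Lp E 2 (volume : Measure ℝ)} (hg : HasBdry G g)
    (hg' : HasBdry (fun z => X z (G z)) g') : inner ℂ g η = inner ℂ g' α := by
  -- On the linear span of the kernels the identity follows by linearity. Each element keeps a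
  -- concrete Hardy representative, so that `X` can be applied to it.
  have hspan : ∀ f ∈ Submodule.span ℂ {g | ∃ w : ℂ, 0 < w.im ∧ ∃ u : E, g = kern w u},
      ∃ F : ℂ → E, IsHardy F ∧ HasBdry F f ∧
        inner ℂ f η = inner ℂ (bdry fun z => X z (F z)) α := by
    intro f hf
    induction hf using Submodule.span_induction with
    | mem f hf =>
      obtain ⟨w, hw, u, rfl⟩ := hf
      exact ⟨_, isHardy_kern hw u, hasBdry_kern hw.ne' u, hk w hw u⟩
    | zero =>
      refine ⟨fun _ => 0, isHardy_zero, ?_, ?_⟩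
      · filter_upwards [Lp.coeFn_zero E 2 (volume : Measure ℝ)] with k h
        rw [h]
        exact tendsto_const_nhds
      · have h0 : HasBdry (fun z => X z (0 : E)) (0 : Lp E 2 (volume : Measure ℝ)) := by
          filter_upwards [Lp.coeFn_zero E 2 (volume : Measure ℝ)] with k h
          rw [h]
          simp
        rw [h0.bdry_eq, inner_zero_left, inner_zero_left]
    | add f f' _ _ h h' =>
      obtain ⟨F, hF, hFf, e⟩ := h
      obtain ⟨F', hF', hFf', e'⟩ := h'
      refine ⟨_, hF.add hF', hFf.add hFf', ?_⟩
      have h1 := (hF.clm_apply hX hC).hasBdry.add (hF'.clm_apply hX hC).hasBdry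
      simp_rw [← map_add] at h1
      rw [h1.bdry_eq, inner_add_left, inner_add_left, e, e']
    | smul c f _ h =>
      obtain ⟨F, hF, hFf, e⟩ := h
      refine ⟨_, hF.const_smul c, hFf.const_smul c, ?_⟩
      have h1 := (hF.clm_apply hX hC).hasBdry.const_smul c
      simp_rw [← map_smul] at h1
      rw [h1.bdry_eq, inner_smul_left, inner_smul_left, e]
  have hgm : g ∈ hardySpace E := hG.mem_hardySpace hg
  have hC0 : 0 ≤ C := (norm_nonneg _).trans (hC I (by simp))
  rw [← sub_eq_zero, ← norm_eq_zero]
  refine le_antisymm (le_of_forall_pos_le_add fun ε hε => ?_) (norm_nonneg _)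
  set δ := ε / (‖η‖ + C * ‖α‖ + 1) with hδ
  have hδ0 : 0 < δ := by positivity
  obtain ⟨f, hf, hfd⟩ := Metric.mem_closure_iff.1 hgm δ hδ0
  obtain ⟨F, hF, hFf, e⟩ := hspan f hf
  have h1 : inner ℂ g η - inner ℂ g' α =
      inner ℂ (g - f) η - inner ℂ (g' - bdry fun z => X z (F z)) α := by
    rw [inner_sub_left, inner_sub_left, e]
    ring
  -- Pointwise application of `X` is bounded by `C` in the boundary norm, so both sides of the
  -- identity are continuous in `g` and density suffices.
  have h2 : ‖g' - bdry fun z => X z (F z)‖ ≤ C * ‖g - f‖ := by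
    refine norm_le_of_bdry (hg.sub hFf) (hg'.sub (hF.clm_apply hX hC).hasBdry) fun z hz => ?_
    rw [← map_sub]
    exact ((X z).le_opNorm _).trans (by gcongr; exact hC z hz)
  rw [dist_eq_norm] at hfd
  rw [h1, zero_add]
  calc _ ≤ ‖g - f‖ * ‖η‖ + (C * ‖g - f‖) * ‖α‖ := by
        refine (norm_sub_le _ _).trans (add_le_add (norm_inner_le_norm _ _)
          ((norm_inner_le_norm _ _).trans ?_))
        gcongr
    _ ≤ δ * (‖η‖ + C * ‖α‖) := by
        have := hfd.le
        calc _ = ‖g - f‖ * (‖η‖ + C * ‖α‖) := by ring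
          _ ≤ _ := by gcongr
    _ ≤ ε := by
        rw [hδ, div_mul_eq_mul_div, div_le_iff₀ (by positivity)]
        nlinarith [norm_nonneg η, mul_nonneg hC0 (norm_nonneg α)]

end Hardy

/-! ### Multiplication by `(k - w)⁻¹` and its relation to resolvents. -/

section Multiplier

open Metric Complex

variable {E : Type*} [NormedAddCommGroup E] [InnerProductSpace ℂ E]

theorem memLp_inv_sub_smul {w : ℂ} (hw : w.im ≠ 0) (f : Lp E 2 (volume : Measure ℝ)) :
    MemLp (fun k : ℝ => ((k : ℂ) - w)⁻¹ • f k) 2 := by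
  refine (Lp.memLp f).of_le_mul (c := |w.im|⁻¹) ((memLp_inv_sub hw).1.smul (Lp.memLp f).1)
    (ae_of_all _ fun k => ?_)
  rw [norm_smul, norm_inv]
  gcongr
  simpa using abs_im_le_norm ((k : ℂ) - w)

open Classical in
/-- The operator of multiplication by `(k - w)⁻¹` in `L²(ℝ; E)`, for non-real `w`. -/
noncomputable def mulInv (w : ℂ) : Lp E 2 (volume : Measure ℝ) →L[ℂ] Lp E 2 (volume : Measure ℝ) :=
  if hw : w.im ≠ 0 then
    LinearMap.mkContinuous
      { toFun := fun f => (memLp_inv_sub_smul hw f).toLp _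
        map_add' := fun f g => by
          refine Lp.ext ?_
          filter_upwards [MemLp.coeFn_toLp (memLp_inv_sub_smul hw (f + g)),
            MemLp.coeFn_toLp (memLp_inv_sub_smul hw f), MemLp.coeFn_toLp (memLp_inv_sub_smul hw g),
            Lp.coeFn_add f g, Lp.coeFn_add ((memLp_inv_sub_smul hw f).toLp _)
              ((memLp_inv_sub_smul hw g).toLp _)] with k h1 h2 h3 h4 h5
          rw [h1, h5, Pi.add_apply, h2, h3, h4, Pi.add_apply, smul_add]
        map_smul' := fun c f => by
          refine Lp.ext ?_
          filter_upwards [MemLp.coeFn_toLp (memLp_inv_sub_smul hw (c • f)),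
            MemLp.coeFn_toLp (memLp_inv_sub_smul hw f),
            Lp.coeFn_smul c f, Lp.coeFn_smul c ((memLp_inv_sub_smul hw f).toLp _)] with k h1 h2 h4 h5
          rw [h1, RingHom.id_apply, h5, Pi.smul_apply, h2, h4, Pi.smul_apply, smul_comm] }
      |w.im|⁻¹ fun f => by
        refine Lp.norm_le_mul_norm_of_ae_le_mul ?_
        filter_upwards [MemLp.coeFn_toLp (memLp_inv_sub_smul hw f)] with k h
        simp only [LinearMap.coe_mk, AddHom.coe_mk]
        rw [h, norm_smul, norm_inv]
        gcongr
        simpa using abs_im_le_norm ((k : ℂ) - w)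
  else 0

theorem coeFn_mulInv {w : ℂ} (hw : w.im ≠ 0) (f : Lp E 2 (volume : Measure ℝ)) :
    mulInv w f =ᵐ[volume] fun k : ℝ => ((k : ℂ) - w)⁻¹ • f k := by
  rw [mulInv, dif_pos hw]
  exact MemLp.coeFn_toLp (memLp_inv_sub_smul hw f)

theorem norm_mulInv_le {w : ℂ} (hw : w.im ≠ 0) (f : Lp E 2 (volume : Measure ℝ)) :
    ‖mulInv w f‖ ≤ |w.im|⁻¹ * ‖f‖ := by
  refine Lp.norm_le_mul_norm_of_ae_le_mul ?_
  filter_upwards [coeFn_mulInv hw f] with k h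
  rw [h, norm_smul, norm_inv]
  gcongr
  simpa using abs_im_le_norm ((k : ℂ) - w)

theorem inner_mulInv {w : ℂ} (hw : w.im ≠ 0) (f g : Lp E 2 (volume : Measure ℝ)) :
    inner ℂ f (mulInv w g) = inner ℂ (mulInv (starRingEnd ℂ w) f) g := by
  rw [L2.inner_def, L2.inner_def]
  have hw' : (starRingEnd ℂ w).im ≠ 0 := by simpa using hw
  refine integral_congr_ae ?_
  filter_upwards [coeFn_mulInv hw g, coeFn_mulInv hw' f] with k h1 h2
  rw [h1, h2, inner_smul_left, inner_smul_right]
  simp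

theorem HasBdry.inv_smul {F : ℂ → E} {f : Lp E 2 (volume : Measure ℝ)} (hf : HasBdry F f) {w : ℂ}
    (hw : w.im ≠ 0) : HasBdry (fun z => (z - w)⁻¹ • F z) (mulInv w f) := by
  filter_upwards [hf, coeFn_mulInv hw f] with k h1 h2
  rw [h2]
  exact (((tendsto_add_mul_I k).sub_const w).inv₀ (ofReal_sub_ne_zero k hw)).smul h1

/-- The boundary function of `z ↦ A R(z) R(w) φ` for a resolvent `R`. -/
theorem HasBdry.resolvent_apply {R : ℂ → E →L[ℂ] E} {A : E →L[ℂ] E} {w : ℂ} (hw : w.im ≠ 0)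
    (hR : ∀ z : ℂ, 0 < z.im → R z - R w = (z - w) • (R z ∘L R w)) {φ : E}
    {f : Lp E 2 (volume : Measure ℝ)} (hf : HasBdry (fun z => A (R z φ)) f) :
    HasBdry (fun z => A (R z (R w φ))) (mulInv w f - kern (starRingEnd ℂ w) (A (R w φ))) := by
  have hw' : (starRingEnd ℂ w).im ≠ 0 := by simpa using hw
  have h1 := (hf.inv_smul hw).sub (hasBdry_kern hw' (A (R w φ)))
  refine h1.congr (ae_of_all _ fun k => ?_)
  have hne : ∀ᶠ ε : ℝ in 𝓝[>] 0, (k : ℂ) + ε * I - w ≠ 0 :=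
    ((tendsto_add_mul_I k).sub_const w).eventually_ne (ofReal_sub_ne_zero k hw)
  filter_upwards [self_mem_nhdsWithin, hne] with ε hε hne
  have h2 := congrArg (fun X => A (X φ)) (hR (k + ε * I) (by simpa using hε))
  simp only [sub_apply, smul_apply, ContinuousLinearMap.comp_apply, map_sub, map_smul] at h2
  rw [starRingEnd_self_apply, ← smul_sub, h2, smul_smul, inv_mul_cancel₀ hne, one_smul]

/-- The function `z ↦ (X (conj z))^*`. -/
noncomputable def sharp [CompleteSpace E] (X : ℂ → E →L[ℂ] E) (z : ℂ) : E →L[ℂ] E :=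
  ContinuousLinearMap.adjoint (X (starRingEnd ℂ z))

theorem inner_sharp [CompleteSpace E] (X : ℂ → E →L[ℂ] E) (z : ℂ) (x y : E) :
    inner ℂ x (sharp X z y) = inner ℂ (X (starRingEnd ℂ z) x) y :=
  ContinuousLinearMap.adjoint_inner_right _ _ _

theorem differentiableAt_sharp [CompleteSpace E] {X : ℂ → E →L[ℂ] E} {z : ℂ}
    (hX : DifferentiableAt ℂ X (starRingEnd ℂ z)) : DifferentiableAt ℂ (sharp X) z := by
  have h := hX.star_conj
  rw [starRingEnd_self_apply] at h
  exact h

theorem sharp_sub [CompleteSpace E] {R : ℂ → E →L[ℂ] E} {z w : ℂ}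
    (h : R (starRingEnd ℂ w) - R (starRingEnd ℂ z) =
      (starRingEnd ℂ w - starRingEnd ℂ z) • (R (starRingEnd ℂ w) ∘L R (starRingEnd ℂ z))) :
    sharp R z - sharp R w = (z - w) • (sharp R z ∘L sharp R w) := by
  have h1 := congrArg ContinuousLinearMap.adjoint h
  rw [map_sub, map_smulₛₗ, ContinuousLinearMap.adjoint_comp, map_sub, starRingEnd_self_apply,
    starRingEnd_self_apply] at h1
  rw [← neg_sub, ← neg_sub w z, neg_smul]
  exact congrArg Neg.neg h1

end Multiplier

/-! ### The operators `W` and `Z` from boundary functions; the intertwining relation. -/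

section WaveData

open Metric Complex ContinuousLinearMap

variable {H : Type*} [NormedAddCommGroup H] [InnerProductSpace ℂ H] [CompleteSpace H]

/-- The analytic data that the stationary wave operators are built from: the resolvent `R` of the
unperturbed operator, the resolvent `Q + N` of the perturbed operator with its regular part
`Q` and its part `N` in the range of the Riesz projection `P`, which is singular in the finite
set `F`. -/
structure WaveData (A B P : H →L[ℂ] H) (R Q N : ℂ → H →L[ℂ] H) (F : Set ℂ) : Prop where
  finite : F.Finite
  proj_proj : ∀ x, P (P x) = P x
  proj_Q : ∀ z : ℂ, z.im ≠ 0 → ∀ x, P (Q z x) = 0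
  Q_proj : ∀ z : ℂ, z.im ≠ 0 → ∀ x, Q z (P x) = 0
  N_of_proj : ∀ z : ℂ, z.im ≠ 0 → z ∉ F → ∀ x, P x = 0 → N z x = 0
  R_sub : ∀ z w : ℂ, z.im ≠ 0 → w.im ≠ 0 → R z - R w = (z - w) • (R z ∘L R w)
  Q_sub : ∀ z w : ℂ, z.im ≠ 0 → w.im ≠ 0 → Q z - Q w = (z - w) • (Q z ∘L Q w)
  R_sub_Q : ∀ z : ℂ, z.im ≠ 0 → ∀ x, Q z (adjoint B (A (R z x))) = R z x - P (R z x) - Q z x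
  R_sub_Q' : ∀ z : ℂ, z.im ≠ 0 → ∀ x, R z (adjoint B (A (Q z x))) = R z x - R z (P x) - Q z x
  R_sub_N : ∀ z : ℂ, z.im ≠ 0 → z ∉ F → ∀ x, N z (adjoint B (A (R z x))) = P (R z x) - N z x
  R_sub_N' : ∀ z : ℂ, z.im ≠ 0 → z ∉ F → ∀ x, R z (adjoint B (A (N z x))) = R z (P x) - N z x
  differentiableAt_R : ∀ z : ℂ, z.im ≠ 0 → DifferentiableAt ℂ R z
  differentiableAt_Q : ∀ z : ℂ, z.im ≠ 0 → DifferentiableAt ℂ Q z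
  continuousAt_N : ∀ z ∉ F, ContinuousAt N z
  hardy_R : ∀ x, IsHardy fun z => A (R z x)
  hardy_Q : ∀ x, IsHardy fun z => A (Q z x)
  hardy_sharp_R : ∀ x, IsHardy fun z => B (sharp R z x)
  hardy_sharp_Q : ∀ x, IsHardy fun z => B (sharp Q z x)
  hardy_proj_R : ∀ x, P x = 0 → IsHardy fun z => A (P (R z x))
  bound_R : ∃ C, ∀ z : ℂ, z.im ≠ 0 → ‖A ∘L R z ∘L adjoint B‖ ≤ C
  bound_Q : ∃ C, ∀ z : ℂ, z.im ≠ 0 → ‖A ∘L Q z ∘L adjoint B‖ ≤ C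

theorem exists_wave_operators {A B P : H →L[ℂ] H} {R Q N : ℂ → H →L[ℂ] H} {F : Set ℂ}
    (h : WaveData A B P R Q N F) : ∃ a a' b b' : H →L[ℂ] Lp H 2 (volume : Measure ℝ),
      (∀ x, HasBdry (fun z => A (R z x)) (a x)) ∧ (∀ x, HasBdry (fun z => A (Q z x)) (a' x)) ∧
      (∀ x, HasBdry (fun z => B (sharp R z x)) (b x)) ∧
      (∀ x, HasBdry (fun z => B (sharp Q z x)) (b' x)) := by
  obtain ⟨a, ha⟩ := exists_bdry_clm (X := fun z => A ∘L R z) h.hardy_R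
  obtain ⟨a', ha'⟩ := exists_bdry_clm (X := fun z => A ∘L Q z) h.hardy_Q
  obtain ⟨b, hb⟩ := exists_bdry_clm (X := fun z => B ∘L sharp R z) h.hardy_sharp_R
  obtain ⟨b', hb'⟩ := exists_bdry_clm (X := fun z => B ∘L sharp Q z) h.hardy_sharp_Q
  exact ⟨a, a', b, b', ha, ha', hb, hb'⟩

/-- The boundary operators of a wave data and the wave operators `W` and `Z`. -/
structure WaveOps (A B P : H →L[ℂ] H) (R Q N : ℂ → H →L[ℂ] H) (F : Set ℂ)
    (a a' b b' : H →L[ℂ] Lp H 2 (volume : Measure ℝ)) (W Z : H →L[ℂ] H) : Prop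
    extends WaveData A B P R Q N F where
  bdry_a : ∀ x, HasBdry (fun z => A (R z x)) (a x)
  bdry_a' : ∀ x, HasBdry (fun z => A (Q z x)) (a' x)
  bdry_b : ∀ x, HasBdry (fun z => B (sharp R z x)) (b x)
  bdry_b' : ∀ x, HasBdry (fun z => B (sharp Q z x)) (b' x)
  inner_W : ∀ x y, inner ℂ y (W x) =
    inner ℂ y (x - P x) - (2 * Real.pi * I : ℂ)⁻¹ * inner ℂ (b' y) (a x)
  inner_Z : ∀ x y, inner ℂ y (Z x) =
    inner ℂ y (x - P x) + (2 * Real.pi * I : ℂ)⁻¹ * inner ℂ (b y) (a' x)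

theorem WaveData.exists_waveOps {A B P : H →L[ℂ] H} {R Q N : ℂ → H →L[ℂ] H} {F : Set ℂ}
    (h : WaveData A B P R Q N F) : ∃ a a' b b' W Z, WaveOps A B P R Q N F a a' b b' W Z := by
  obtain ⟨a, a', b, b', ha, ha', hb, hb'⟩ := exists_wave_operators h
  refine ⟨a, a', b, b', 1 - P - (2 * Real.pi * I : ℂ)⁻¹ • (adjoint b' ∘L a),
    1 - P + (2 * Real.pi * I : ℂ)⁻¹ • (adjoint b ∘L a'), h, ha, ha', hb, hb', fun x y => ?_,
    fun x y => ?_⟩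
  · simp only [sub_apply, smul_apply, one_apply_eq_self, inner_sub_right, inner_smul_right,
      comp_apply, adjoint_inner_right]
  · simp only [add_apply, sub_apply, smul_apply, one_apply_eq_self, inner_sub_right, inner_add_right,
      inner_smul_right, comp_apply, adjoint_inner_right]

namespace WaveOps

variable {A B P : H →L[ℂ] H} {R Q N : ℂ → H →L[ℂ] H} {F : Set ℂ}
    {a a' b b' : H →L[ℂ] Lp H 2 (volume : Measure ℝ)} {W Z : H →L[ℂ] H}

theorem two_pi_I_mul_inv (x : ℂ) : (2 * Real.pi * I : ℂ) * ((2 * Real.pi * I : ℂ)⁻¹ * x) = x := by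
  rw [← mul_assoc, mul_inv_cancel₀ two_pi_I_ne_zero, one_mul]

theorem b'_proj (h : WaveOps A B P R Q N F a a' b b' W Z) (y : H) : b' (adjoint P y) = 0 := by
  refine (h.bdry_b' _).unique ?_
  have h0 : ∀ z : ℂ, 0 < z.im → (0 : H) = B (sharp Q z (adjoint P y)) := fun z hz => by
    have : sharp Q z (adjoint P y) = 0 := ext_inner_left ℂ fun v => by
      rw [inner_sharp, adjoint_inner_right, h.proj_Q _ (by simpa using hz.ne'), inner_zero_left,
        inner_zero_right]
    rw [this, map_zero]
  refine HasBdry.congr_upper (F := fun _ => 0) ?_ h0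
  filter_upwards [Lp.coeFn_zero H 2 (volume : Measure ℝ)] with k hk
  rw [hk]
  exact tendsto_const_nhds

theorem a'_proj (h : WaveOps A B P R Q N F a a' b b' W Z) (y : H) : a' (P y) = 0 := by
  refine (h.bdry_a' _).unique ?_
  have h0 : ∀ z : ℂ, 0 < z.im → (0 : H) = A (Q z (P y)) := fun z hz => by
    rw [h.Q_proj _ hz.ne', map_zero]
  refine HasBdry.congr_upper (F := fun _ => 0) ?_ h0
  filter_upwards [Lp.coeFn_zero H 2 (volume : Measure ℝ)] with k hk
  rw [hk]
  exact tendsto_const_nhds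

theorem proj_W (h : WaveOps A B P R Q N F a a' b b' W Z) (x : H) : P (W x) = 0 := by
  refine ext_inner_left ℂ fun y => ?_
  rw [← adjoint_inner_left, h.inner_W, h.b'_proj, adjoint_inner_left, map_sub, h.proj_proj]
  simp

theorem Z_proj (h : WaveOps A B P R Q N F a a' b b' W Z) (x : H) : Z (P x) = 0 := by
  refine ext_inner_left ℂ fun y => ?_
  rw [h.inner_Z, h.a'_proj, h.proj_proj]
  simp

/-- For `Im w > 0` the correction term is a kernel with `Im (conj w) < 0`, which the Hardy space
does not see; up to it, `a` turns `R(w)` into multiplication by `(k - w)⁻¹`. -/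
theorem a_R (h : WaveOps A B P R Q N F a a' b b' W Z) {w : ℂ} (hw : w.im ≠ 0) (x : H) :
    a (R w x) = mulInv w (a x) - kern (starRingEnd ℂ w) (A (R w x)) :=
  (h.bdry_a _).unique (HasBdry.resolvent_apply hw (fun z hz => h.R_sub z w hz.ne' hw) (h.bdry_a x))

theorem b_R (h : WaveOps A B P R Q N F a a' b b' W Z) {w : ℂ} (hw : w.im ≠ 0) (x : H) :
    b (adjoint (R w) x) = mulInv (starRingEnd ℂ w) (b x) - kern w (B (adjoint (R w) x)) := by
  have hw' : (starRingEnd ℂ w).im ≠ 0 := by simpa using hw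
  have h1 := HasBdry.resolvent_apply hw' (fun z hz => sharp_sub (h.R_sub _ _ (by simpa using hw)
    (by simpa using hz.ne'))) (h.bdry_b x)
  simp only [sharp, starRingEnd_self_apply] at h1
  exact (h.bdry_b _).unique h1

theorem b'_Q (h : WaveOps A B P R Q N F a a' b b' W Z) {w : ℂ} (hw : w.im ≠ 0) (x : H) :
    b' (adjoint (Q w) x) = mulInv (starRingEnd ℂ w) (b' x) - kern w (B (adjoint (Q w) x)) := by
  have hw' : (starRingEnd ℂ w).im ≠ 0 := by simpa using hw
  have h1 := HasBdry.resolvent_apply hw' (fun z hz => sharp_sub (h.Q_sub _ _ (by simpa using hw)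
    (by simpa using hz.ne'))) (h.bdry_b' x)
  simp only [sharp, starRingEnd_self_apply] at h1
  exact (h.bdry_b' _).unique h1

theorem inner_kern_a (h : WaveOps A B P R Q N F a a' b b' W Z) {w : ℂ} (hw : 0 < w.im) (u x : H) :
    inner ℂ (kern w u) (a x) = 2 * Real.pi * I * inner ℂ u (A (R w x)) :=
  (h.hardy_R x).inner_kern (h.bdry_a x) hw u

theorem inner_kern_a' (h : WaveOps A B P R Q N F a a' b b' W Z) {w : ℂ} (hw : 0 < w.im) (u x : H) :
    inner ℂ (kern w u) (a' x) = 2 * Real.pi * I * inner ℂ u (A (Q w x)) :=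
  (h.hardy_Q x).inner_kern (h.bdry_a' x) hw u

/-- `W` intertwines the resolvents. -/
theorem W_R (h : WaveOps A B P R Q N F a a' b b' W Z) {w : ℂ} (hw : 0 < w.im) (x : H) :
    W (R w x) = Q w (W x) := by
  refine ext_inner_left ℂ fun y => ?_
  have hw' : (starRingEnd ℂ w).im < 0 := by simpa using hw
  have e1 : inner ℂ (b' y) (kern (starRingEnd ℂ w) (A (R w x))) = 0 := by
    rw [← inner_conj_symm, (h.hardy_sharp_Q y).inner_kern_lower (h.bdry_b' y) hw', map_zero]
  have e2 := h.R_sub_Q w hw.ne' x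
  -- The multiplications by `(k - w)⁻¹` on the two sides are adjoint and cancel. The kernel coming
  -- from `b'` reproduces `A R(w) x`, and the remaining term `Q B^* A R x` is evaluated by the
  -- second resolvent identity.
  rw [← adjoint_inner_left (Q w), h.inner_W, h.inner_W, h.a_R hw.ne', h.b'_Q hw.ne', inner_sub_left,
    inner_sub_right (b' y), e1, inner_mulInv hw.ne', h.inner_kern_a hw, mul_sub, mul_sub,
    inv_mul_cancel_left₀ two_pi_I_ne_zero,
    adjoint_inner_left, ← adjoint_inner_right B, adjoint_inner_left, e2, map_sub, h.Q_proj _ hw.ne']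
  simp only [inner_sub_right, inner_zero_right]
  ring

theorem adjoint_R_sub_Q (h : WaveOps A B P R Q N F a a' b b' W Z) {z : ℂ} (hz : z.im ≠ 0) (y : H) :
    sharp R z (adjoint A (B (sharp Q z y))) = sharp R z (y - adjoint P y) - sharp Q z y := by
  refine ext_inner_left ℂ fun x => ?_
  have := h.R_sub_Q (starRingEnd ℂ z) (by simpa using hz) x
  rw [inner_sub_right, inner_sharp, inner_sharp, inner_sharp, inner_sub_right, adjoint_inner_right,
    adjoint_inner_right, ← adjoint_inner_left B, inner_sharp, this]
  simp only [inner_sub_left]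

theorem adjoint_R_sub_Q' (h : WaveOps A B P R Q N F a a' b b' W Z) {z : ℂ} (hz : z.im ≠ 0) (y : H) :
    sharp Q z (adjoint A (B (sharp R z y))) = sharp R z y - adjoint P (sharp R z y) -
      sharp Q z y := by
  refine ext_inner_left ℂ fun x => ?_
  have := h.R_sub_Q' (starRingEnd ℂ z) (by simpa using hz) x
  rw [inner_sub_right, inner_sub_right, inner_sharp, inner_sharp, inner_sharp, adjoint_inner_right,
    adjoint_inner_right, ← adjoint_inner_left B, inner_sharp, inner_sharp, this]
  simp only [inner_sub_left]

theorem adjoint_R_sub_N' (h : WaveOps A B P R Q N F a a' b b' W Z) {z : ℂ} (hz : z.im ≠ 0)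
    (hzF : starRingEnd ℂ z ∉ F) (y : H) :
    sharp N z (adjoint A (B (sharp R z y))) = adjoint P (sharp R z y) - sharp N z y := by
  refine ext_inner_left ℂ fun x => ?_
  have := h.R_sub_N' (starRingEnd ℂ z) (by simpa using hz) hzF x
  rw [inner_sub_right, inner_sharp, inner_sharp, adjoint_inner_right,
    adjoint_inner_right, ← adjoint_inner_left B, inner_sharp, inner_sharp, this]
  simp only [inner_sub_left]

/-- The bounded holomorphic family `B R^# A^*`. -/
theorem exists_bound_sharp {X : ℂ → H →L[ℂ] H}
    (h : ∃ C, ∀ z : ℂ, z.im ≠ 0 → ‖A ∘L X z ∘L adjoint B‖ ≤ C) :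
    ∃ C, ∀ z : ℂ, 0 < z.im → ‖B ∘L sharp X z ∘L adjoint A‖ ≤ C := by
  obtain ⟨C, hC⟩ := h
  refine ⟨C, fun z hz => ?_⟩
  refine le_trans (le_of_eq ?_) (hC (starRingEnd ℂ z) (by simpa using hz.ne'))
  rw [← LinearIsometryEquiv.norm_map adjoint, adjoint_comp, adjoint_comp, adjoint_adjoint]
  simp only [sharp, adjoint_adjoint]
  rfl

theorem differentiableOn_sharp {X : ℂ → H →L[ℂ] H}
    (h : ∀ z : ℂ, z.im ≠ 0 → DifferentiableAt ℂ X z) :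
    DifferentiableOn ℂ (fun z => B ∘L sharp X z ∘L adjoint A) {z | 0 < z.im} := fun z hz => by
  have h1 : DifferentiableAt ℂ (sharp X) z :=
    differentiableAt_sharp (h _ (by simpa using (ne_of_gt hz)))
  exact ((differentiableAt_const B).clm_comp
    (h1.clm_comp (differentiableAt_const _))).differentiableWithinAt

end WaveOps

end WaveData

/-! ### The products `W Z` and `Z W`. -/

namespace WaveOps

open Metric Complex ContinuousLinearMap

variable {H : Type*} [NormedAddCommGroup H] [InnerProductSpace ℂ H] [CompleteSpace H]
variable {A B P : H →L[ℂ] H} {R Q N : ℂ → H →L[ℂ] H} {F : Set ℂ}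
    {a a' b b' : H →L[ℂ] Lp H 2 (volume : Measure ℝ)} {W Z : H →L[ℂ] H}

omit [CompleteSpace H] in
theorem tendsto_clm_apply {ι : Type*} {l : Filter ι} {X : ι → H →L[ℂ] H} {X₀ : H →L[ℂ] H}
    {u : ι → H} {u₀ : H} (hX : Tendsto X l (𝓝 X₀)) (hu : Tendsto u l (𝓝 u₀)) :
    Tendsto (fun i => X i (u i)) l (𝓝 (X₀ u₀)) :=
  (isBoundedBilinearMap_apply.continuous.tendsto (X₀, u₀)).comp (hX.prodMk_nhds hu)

theorem inner_b_Z (h : WaveOps A B P R Q N F a a' b b' W Z) (x y : H) :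
    inner ℂ (b y) (a' x) = 2 * Real.pi * I * (inner ℂ y (Z x) - inner ℂ y (x - P x)) := by
  rw [h.inner_Z, add_sub_cancel_left, two_pi_I_mul_inv]

theorem inner_b'_W (h : WaveOps A B P R Q N F a a' b b' W Z) (x y : H) :
    inner ℂ (b' y) (a x) = 2 * Real.pi * I * (inner ℂ y (x - P x) - inner ℂ y (W x)) := by
  rw [h.inner_W, sub_sub_cancel, two_pi_I_mul_inv]

/-- The bounded family `1 + B R^# A^*` is moved across the scalar product: the identity is proved
for kernels and then applied to `B Q^# y`. -/
theorem W_Z (h : WaveOps A B P R Q N F a a' b b' W Z) (x : H) : W (Z x) = x - P x := by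
  obtain ⟨C, hC⟩ := exists_bound_sharp h.bound_R
  have hd := differentiableOn_sharp (A := A) (B := B) h.differentiableAt_R
  have hd' : DifferentiableOn ℂ (fun z => 1 + B ∘L sharp R z ∘L adjoint A) {z | 0 < z.im} :=
    (differentiableOn_const _).add hd
  have hC' : ∀ z : ℂ, 0 < z.im → ‖1 + B ∘L sharp R z ∘L adjoint A‖ ≤ ‖(1 : H →L[ℂ] H)‖ + C :=
    fun z hz => (norm_add_le _ _).trans (by gcongr; exact hC z hz)
  -- On a kernel, `B R^# A^*` acts through `b (A^* u)` multiplied by `(k - w̄)⁻¹`, so both sides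
  -- reduce to values at `w`, where the resolvent identity between `R` and `Q` applies.
  have hk : ∀ w : ℂ, 0 < w.im → ∀ u : H, inner ℂ (kern w u) (a (Z x)) =
      inner ℂ (bdry fun z => (1 + B ∘L sharp R z ∘L adjoint A)
        ((z - starRingEnd ℂ w)⁻¹ • u)) (a' x) := by
    intro w hw u
    have hw' : (starRingEnd ℂ w).im ≠ 0 := by simpa using hw.ne'
    have h1 := (hasBdry_kern hw.ne' u).add ((h.bdry_b (adjoint A u)).inv_smul hw')
    have h2 : (bdry fun z => (1 + B ∘L sharp R z ∘L adjoint A)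
        ((z - starRingEnd ℂ w)⁻¹ • u)) =
        kern w u + mulInv (starRingEnd ℂ w) (b (adjoint A u)) := by
      refine HasBdry.bdry_eq (h1.congr_upper fun z hz => ?_)
      simp
    have h3 := h.b_R hw.ne' (adjoint A u)
    have h4 : mulInv (starRingEnd ℂ w) (b (adjoint A u)) =
        b (adjoint (R w) (adjoint A u)) + kern w (B (adjoint (R w) (adjoint A u))) := by
      rw [h3, sub_add_cancel]
    have e := h.R_sub_Q' w hw.ne' x
    rw [h2, h4, inner_add_left, inner_add_left, h.inner_kern_a hw, h.inner_kern_a' hw,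
      h.inner_kern_a' hw, h.inner_b_Z, ← adjoint_inner_right B, adjoint_inner_left (R w),
      adjoint_inner_left (R w), adjoint_inner_left (R w), adjoint_inner_left A,
      adjoint_inner_left A, adjoint_inner_left A, e]
    simp only [map_sub, inner_sub_right]
    ring
  refine ext_inner_left ℂ fun y => ?_
  -- The second resolvent identity gives `(1 + B R^# A^*) B Q^# y = B R^# (y - P^* y)`, whose
  -- boundary function is `b (y - P^* y)`.
  have key := inner_bdry_eq_of_kern hd' hC' hk (h.hardy_sharp_Q y) (h.bdry_b' y)
    (g' := b (y - adjoint P y)) ((h.bdry_b _).congr_upper fun z hz => by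
      simp only [add_apply, one_apply_eq_self, comp_apply]
      rw [h.adjoint_R_sub_Q hz.ne' y, map_sub B]
      abel)
  rw [h.inner_b'_W, h.inner_b_Z] at key
  have key' := mul_left_cancel₀ two_pi_I_ne_zero key
  have e1 : inner ℂ y (Z x - P (Z x)) = inner ℂ (y - adjoint P y) (Z x) := by
    rw [inner_sub_left, adjoint_inner_left, inner_sub_right]
  have e2 : inner ℂ (y - adjoint P y) (x - P x) = inner ℂ y (x - P x) := by
    rw [inner_sub_left, adjoint_inner_left, map_sub, h.proj_proj, sub_self, inner_zero_right,
      sub_zero]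
  rw [e1, e2] at key'
  exact (sub_right_inj.1 key')

/-- The kernel of `W` meets the complementary subspace only in `0`. -/
theorem eq_zero_of_W_eq_zero (h : WaveOps A B P R Q N F a a' b b' W Z) {x : H} (hW : W x = 0)
    (hP : P x = 0) : x = 0 := by
  have hb' : ∀ y, inner ℂ (b' y) (a x) = 2 * Real.pi * I * inner ℂ y x := fun y => by
    rw [h.inner_b'_W, hW, hP, sub_zero, inner_zero_right, sub_zero]
  suffices ha : a x = 0 by
    refine ext_inner_left ℂ fun y => ?_
    have := hb' y
    rw [ha, inner_zero_right] at this
    rw [inner_zero_right]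
    exact (mul_eq_zero.1 this.symm).resolve_left two_pi_I_ne_zero
  -- `η` is the boundary function of `A (I - P) R x`, hence of `A (Q B^* A R x + Q x)`. It serves as
  -- the dual partner of `B Q^# A^*` acting on test functions.
  have hηH : IsHardy fun z => A (R z x) - A (P (R z x)) := (h.hardy_R x).sub (h.hardy_proj_R x hP)
  set η := bdry fun z => A (R z x) - A (P (R z x)) with hη
  have hηb : HasBdry (fun z => A (R z x) - A (P (R z x))) η := hηH.hasBdry
  obtain ⟨C, hC⟩ := exists_bound_sharp h.bound_Q
  have hd := differentiableOn_sharp (A := A) (B := B) h.differentiableAt_Q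
  obtain ⟨C', hC'⟩ := exists_bound_sharp h.bound_R
  have hd' := differentiableOn_sharp (A := A) (B := B) h.differentiableAt_R
  have hk : ∀ w : ℂ, 0 < w.im → ∀ u : H, inner ℂ (kern w u) η =
      inner ℂ (bdry fun z => (B ∘L sharp Q z ∘L adjoint A)
        ((z - starRingEnd ℂ w)⁻¹ • u)) (a x) := by
    intro w hw u
    have hw' : (starRingEnd ℂ w).im ≠ 0 := by simpa using hw.ne'
    have h2 : (bdry fun z => (B ∘L sharp Q z ∘L adjoint A)
        ((z - starRingEnd ℂ w)⁻¹ • u)) = mulInv (starRingEnd ℂ w) (b' (adjoint A u)) := by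
      refine HasBdry.bdry_eq (((h.bdry_b' (adjoint A u)).inv_smul hw').congr_upper fun z hz => ?_)
      simp
    have h4 : mulInv (starRingEnd ℂ w) (b' (adjoint A u)) =
        b' (adjoint (Q w) (adjoint A u)) + kern w (B (adjoint (Q w) (adjoint A u))) := by
      rw [h.b'_Q hw.ne', sub_add_cancel]
    have e := h.R_sub_Q w hw.ne' x
    rw [h2, h4, inner_add_left, h.inner_kern_a hw, hb', ← adjoint_inner_right B,
      adjoint_inner_left (Q w), adjoint_inner_left (Q w), adjoint_inner_left A,
      adjoint_inner_left A, e, hηH.inner_kern hηb hw]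
    simp only [map_sub, inner_sub_right]
    ring
  refine eq_zero_of_mem_hardySpace ((h.hardy_R x).mem_hardySpace (h.bdry_a x)) fun w hw u => ?_
  have hw' : (starRingEnd ℂ w).im ≠ 0 := by simpa using hw.ne'
  -- the test function `(1 + B R^# A^*) κ`
  have hκ := isHardy_kern hw u
  have hκb := hasBdry_kern hw.ne' u
  have hRκ : IsHardy fun z => (B ∘L sharp R z ∘L adjoint A) ((z - starRingEnd ℂ w)⁻¹ • u) :=
    hκ.clm_apply hd' hC'
  have hG := hκ.add hRκ
  have hg := hG.hasBdry
  set g := bdry fun z => (z - starRingEnd ℂ w)⁻¹ • u +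
    (B ∘L sharp R z ∘L adjoint A) ((z - starRingEnd ℂ w)⁻¹ • u)
  have hQG := hG.clm_apply hd hC
  have hg' := hQG.hasBdry
  set g' := bdry fun z => (B ∘L sharp Q z ∘L adjoint A) ((z - starRingEnd ℂ w)⁻¹ • u +
    (B ∘L sharp R z ∘L adjoint A) ((z - starRingEnd ℂ w)⁻¹ • u))
  have key := inner_bdry_eq_of_kern hd hC hk hG hg hg'
  -- On the boundary `η = (1 - A N B^*) a x` because `N x = 0`, while `(1 - B N^# A^*) g - g' = κ`
  -- because `(1 - B (Q + N)^# A^*)(1 + B R^# A^*) = 1`. Only the finite set of real points of `F`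
  -- has to be avoided.
  have hae : ∀ᵐ k : ℝ, inner ℂ (g k) (η k) - inner ℂ (g' k) (a x k) =
      inner ℂ (kern w u k) (a x k) := by
    have hF : ∀ᵐ k : ℝ, (k : ℂ) ∉ F := by
      have : ((fun k : ℝ => (k : ℂ)) ⁻¹' F).Finite := h.finite.preimage ofReal_injective.injOn
      exact (this.countable.ae_notMem volume)
    filter_upwards [hF, hg, hg', hηb, h.bdry_a x, hκb] with k hkF t1 t2 t3 t4 t5
    have hlim := tendsto_add_mul_I k
    have hcl : IsClosed F := h.finite.isClosed
    have hnF : ∀ᶠ ε : ℝ in 𝓝[>] 0, (k : ℂ) + ε * I ∉ F :=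
      hlim.eventually (hcl.isOpen_compl.mem_nhds hkF)
    have hlim' : Tendsto (fun ε : ℝ => starRingEnd ℂ ((k : ℂ) + ε * I)) (𝓝[>] 0) (𝓝 (k : ℂ)) := by
      have := (Complex.continuous_conj.tendsto (k : ℂ)).comp hlim
      rwa [conj_ofReal] at this
    have hnF' : ∀ᶠ ε : ℝ in 𝓝[>] 0, starRingEnd ℂ ((k : ℂ) + ε * I) ∉ F :=
      hlim'.eventually (hcl.isOpen_compl.mem_nhds hkF)
    have hN := (h.continuousAt_N k hkF).tendsto.comp hlim
    have hN' := (adjoint (𝕜 := ℂ) (E := H) (F := H)).continuous.continuousAt.tendsto.comp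
      ((h.continuousAt_N k hkF).tendsto.comp hlim')
    -- the boundary value of `η`
    have s1 : Tendsto (fun ε : ℝ => A (N (k + ε * I) (adjoint B (A (R (k + ε * I) x)))))
        (𝓝[>] 0) (𝓝 (A (N k (adjoint B (a x k))))) :=
      (A.continuous.tendsto _).comp (tendsto_clm_apply hN ((adjoint B).continuous.tendsto _ |>.comp t4))
    have s2 : η k = a x k - A (N k (adjoint B (a x k))) := by
      refine tendsto_nhds_unique t3 ((t4.sub s1).congr' ?_)
      filter_upwards [self_mem_nhdsWithin, hnF] with ε hε hn
      have hz : ((k : ℂ) + ε * I).im ≠ 0 := by simpa using (ne_of_gt hε)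
      rw [h.R_sub_N _ hz hn, h.N_of_proj _ hz hn x hP, sub_zero]
    -- the boundary value of `g'`
    have s3 : Tendsto (fun ε : ℝ => B (sharp N (k + ε * I) (adjoint A
        ((((k : ℂ) + ε * I) - starRingEnd ℂ w)⁻¹ • u + (B ∘L sharp R (k + ε * I) ∘L adjoint A)
          ((((k : ℂ) + ε * I) - starRingEnd ℂ w)⁻¹ • u)))))
        (𝓝[>] 0) (𝓝 (B (adjoint (N k) (adjoint A (g k))))) :=
      (B.continuous.tendsto _).comp (tendsto_clm_apply hN' ((adjoint A).continuous.tendsto _ |>.comp t1))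
    have s4 : g k - B (adjoint (N k) (adjoint A (g k))) - g' k = kern w u k := by
      refine tendsto_nhds_unique (((t1.sub s3).sub t2).congr' ?_) t5
      filter_upwards [self_mem_nhdsWithin, hnF'] with ε hε hn
      have hz : ((k : ℂ) + ε * I).im ≠ 0 := by simpa using (ne_of_gt hε)
      generalize (((k : ℂ) + ε * I) - starRingEnd ℂ w)⁻¹ • u = v
      generalize (k : ℂ) + ε * I = z at hz hn
      simp only [comp_apply, map_add]
      rw [h.adjoint_R_sub_Q' hz, h.adjoint_R_sub_N' hz hn]
      simp only [map_sub]
      abel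
    rw [← s4, s2, inner_sub_left, inner_sub_left, inner_sub_right, ← adjoint_inner_right B,
      adjoint_inner_left (N k), adjoint_inner_left A]
  rw [L2.inner_def, ← integral_congr_ae hae, integral_sub (L2.integrable_inner g η)
    (L2.integrable_inner g' (a x)), ← L2.inner_def, ← L2.inner_def, key, sub_self]

/-- `P` is injective on `ker W`, so this kernel is finite-dimensional. It is invariant under `R(i)`,
and an eigenvector there contradicts `hR`. -/
theorem W_injective (h : WaveOps A B P R Q N F a a' b b' W Z)
    (hfin : FiniteDimensional ℂ (LinearMap.range (P : H →ₗ[ℂ] H)))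
    (hR : ∀ w : ℂ, 0 < w.im → ∀ (μ : ℂ) (x : H), R w x = μ • x → x = 0) {x : H} (hx : W x = 0) :
    x = 0 := by
  set K : Submodule ℂ H := LinearMap.ker (W : H →ₗ[ℂ] H) with hK
  let p : K →ₗ[ℂ] LinearMap.range (P : H →ₗ[ℂ] H) := (P : H →ₗ[ℂ] H).rangeRestrict ∘ₗ K.subtype
  have hp : Function.Injective p := by
    rw [← LinearMap.ker_eq_bot, LinearMap.ker_eq_bot']
    rintro ⟨y, hy⟩ hpy
    have h1 : P y = 0 := congrArg Subtype.val hpy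
    exact Subtype.ext (h.eq_zero_of_W_eq_zero hy h1)
  have hKfin : FiniteDimensional ℂ K := FiniteDimensional.of_injective p hp
  have hI : (0 : ℝ) < I.im := by simp
  have hmaps : ∀ y ∈ K, (R I : H →ₗ[ℂ] H) y ∈ K := fun y hy => by
    have h1 : W y = 0 := hy
    change W (R I y) = 0
    rw [h.W_R hI, h1, map_zero]
  by_contra hne
  have hnt : Nontrivial K := ⟨⟨⟨x, hx⟩, 0, fun h0 => hne (congrArg Subtype.val h0)⟩⟩
  obtain ⟨μ, hμ⟩ := Module.End.exists_eigenvalue ((R I : H →ₗ[ℂ] H).restrict hmaps)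
  obtain ⟨v, hv⟩ := hμ.exists_hasEigenvector
  have h1 := congrArg Subtype.val hv.apply_eq_smul
  exact hv.2 (Subtype.ext (hR I hI μ v h1))

/-- By `W Z = I - P` and `P W = 0`, the vector `Z W x - x` lies in `ker W`. -/
theorem Z_W (h : WaveOps A B P R Q N F a a' b b' W Z)
    (hfin : FiniteDimensional ℂ (LinearMap.range (P : H →ₗ[ℂ] H)))
    (hR : ∀ w : ℂ, 0 < w.im → ∀ (μ : ℂ) (x : H), R w x = μ • x → x = 0) (x : H) :
    Z (W x) = x := by
  rw [← sub_eq_zero]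
  refine h.W_injective hfin hR ?_
  rw [map_sub, h.W_Z, h.proj_W, sub_zero, sub_self]

end WaveOps

/-! ### The Riesz projection of the whole discrete spectrum and its adjoint. -/

section DiscreteSpectrum

open Metric Complex

variable {H : Type*} [NormedAddCommGroup H] [InnerProductSpace ℂ H] {S : H →ₗ.[ℂ] H}
  {z w : ℂ} {r : ℝ}

theorem discreteProj_eq_sum (hF : (discreteSpec S).Finite) :
    discreteProj S = ∑ z ∈ hF.toFinset, rieszProj S z :=
  finsum_mem_eq_finite_toFinset_sum _ hF

theorem finiteDimensional_range_discreteProj (hF : (discreteSpec S).Finite) :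
    FiniteDimensional ℂ (LinearMap.range (discreteProj S : H →ₗ[ℂ] H)) := by
  have h1 : ∀ z : hF.toFinset,
      FiniteDimensional ℂ (LinearMap.range (rieszProj S z : H →ₗ[ℂ] H)) := fun z =>
    ((Set.Finite.mem_toFinset hF).1 z.2).2
  have h2 : FiniteDimensional ℂ
      (⨆ z : hF.toFinset, LinearMap.range (rieszProj S z : H →ₗ[ℂ] H) : Submodule ℂ H) :=
    Submodule.finiteDimensional_iSup _
  refine Submodule.finiteDimensional_of_le (S₂ := ⨆ z : hF.toFinset,
    LinearMap.range (rieszProj S z : H →ₗ[ℂ] H)) ?_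
  rintro _ ⟨x, rfl⟩
  rw [ContinuousLinearMap.coe_coe, discreteProj_eq_sum hF, sum_apply]
  refine Submodule.sum_mem _ fun z hz => ?_
  exact Submodule.mem_iSup_of_mem (⟨z, hz⟩ : hF.toFinset) ⟨x, rfl⟩

variable [CompleteSpace H]

theorem rieszProj_mul_discreteProj (hF : (discreteSpec S).Finite) (hz : z ∈ discreteSpec S) :
    rieszProj S z ∘L discreteProj S = rieszProj S z := by
  rw [discreteProj_eq_sum hF, ContinuousLinearMap.comp_finsetSum,
    Finset.sum_eq_single_of_mem z ((Set.Finite.mem_toFinset hF).2 hz)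
      fun w _ hw => rieszProj_mul_of_ne hw.symm, rieszProj_mul_self]

theorem discreteProj_mul_self (hF : (discreteSpec S).Finite) :
    discreteProj S ∘L discreteProj S = discreteProj S := by
  nth_rewrite 1 [discreteProj_eq_sum hF]
  rw [ContinuousLinearMap.finsetSum_comp, Finset.sum_congr rfl fun z hz =>
    rieszProj_mul_discreteProj hF ((Set.Finite.mem_toFinset hF).1 hz), ← discreteProj_eq_sum hF]

theorem resolv_comm_discreteProj (hF : (discreteSpec S).Finite) (hw : w ∉ spec S) :
    resolv S w ∘L discreteProj S = discreteProj S ∘L resolv S w := by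
  rw [discreteProj_eq_sum hF, ContinuousLinearMap.finsetSum_comp,
    ContinuousLinearMap.comp_finsetSum]
  exact Finset.sum_congr rfl fun z _ => resolv_comm_rieszProj hw

theorem exists_norm_resolv_mul_discreteProj_le (hF : (discreteSpec S).Finite) {δ : ℝ}
    (hδ : 0 < δ) : ∃ C, ∀ w, w ∉ spec S → (∀ z ∈ discreteSpec S, δ ≤ dist w z) →
      ‖resolv S w ∘L discreteProj S‖ ≤ C := by
  have h1 : ∀ z ∈ discreteSpec S, ∃ C, ∀ w, w ∉ spec S → δ ≤ dist w z →
      ‖resolv S w ∘L rieszProj S z‖ ≤ C := fun z hz => by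
    obtain ⟨r, hr⟩ := hz.1
    have h0 : 0 < min r (δ / 2) := lt_min hr.1 (half_pos hδ)
    exact norm_resolv_mul_rieszProj_le (hr.mono h0 (min_le_left _ _))
      ((min_le_right _ _).trans_lt (half_lt_self hδ))
  choose! C hC using h1
  refine ⟨∑ z ∈ hF.toFinset, C z, fun w hw hwz => ?_⟩
  rw [discreteProj_eq_sum hF, ContinuousLinearMap.comp_finsetSum]
  refine norm_sum_le_of_le _ fun z hz => ?_
  have hz' := (Set.Finite.mem_toFinset hF).1 hz
  exact hC z hz' w hw (hwz z hz')

theorem exists_norm_resolv_mul_one_sub_discreteProj_le (hF : (discreteSpec S).Finite)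
    (hz : z ∈ discreteSpec S) : ∃ C, ∀ᶠ w in 𝓝[≠] z,
      ‖resolv S w ∘L (1 - discreteProj S)‖ ≤ C := by
  obtain ⟨r, hr⟩ := hz.1
  obtain ⟨C, hC⟩ := norm_resolv_mul_one_sub_rieszProj_le hr (half_lt_self hr.1)
  refine ⟨C * ‖1 - discreteProj S‖, ?_⟩
  filter_upwards [self_mem_nhdsWithin, mem_nhdsWithin_of_mem_nhds
    (closedBall_mem_nhds z (half_pos hr.1))] with w hw hw'
  -- Since `P_z P = P_z`, one has `(1 - P_z)(1 - P) = 1 - P`, which reduces the bound to a single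
  -- point of the discrete spectrum.
  have h1 : resolv S w ∘L (1 - discreteProj S) =
      (resolv S w ∘L (1 - rieszProj S z)) ∘L (1 - discreteProj S) := by
    rw [ContinuousLinearMap.comp_assoc, ContinuousLinearMap.sub_comp,
      ContinuousLinearMap.comp_sub (rieszProj S z), rieszProj_mul_discreteProj hF hz]
    simp [ContinuousLinearMap.one_def]
  rw [h1]
  exact (ContinuousLinearMap.opNorm_comp_le _ _).trans
    (mul_le_mul_of_nonneg_right (hC w hw hw') (norm_nonneg _))

open ContinuousLinearMap in
-- `X^*` vanishes on the orthogonal complement of the range of `X`, so its range is the image of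
-- that finite-dimensional space.
theorem finiteDimensional_range_adjoint {X : H →L[ℂ] H}
    (hX : FiniteDimensional ℂ (LinearMap.range (X : H →ₗ[ℂ] H))) :
    FiniteDimensional ℂ (LinearMap.range (adjoint X : H →ₗ[ℂ] H)) := by
  refine Submodule.finiteDimensional_of_le
    (S₂ := (LinearMap.range (X : H →ₗ[ℂ] H)).map (adjoint X : H →ₗ[ℂ] H)) ?_
  rintro _ ⟨y, rfl⟩
  set p := (LinearMap.range (X : H →ₗ[ℂ] H)).starProjection y
  refine ⟨p, Submodule.starProjection_apply_mem _ _, ?_⟩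
  refine (sub_eq_zero.1 ?_).symm
  rw [← map_sub]
  refine ext_inner_right ℂ fun v => ?_
  rw [coe_coe, adjoint_inner_left, inner_zero_left]
  exact Submodule.inner_left_of_mem_orthogonal (LinearMap.mem_range_self (X : H →ₗ[ℂ] H) v)
    (Submodule.sub_starProjection_mem_orthogonal y)

theorem mem_discreteSpec_adjoint_iff (hS : Dense (S.domain : Set H)) (hne : ∃ w, w ∉ spec S) :
    starRingEnd ℂ z ∈ discreteSpec S† ↔ z ∈ discreteSpec S := by
  refine and_congr (exists_congr fun r => separates_adjoint_iff hS hne) ?_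
  rw [rieszProj_adjoint hS hne]
  refine ⟨fun h => ?_, finiteDimensional_range_adjoint⟩
  rw [← ContinuousLinearMap.adjoint_adjoint (rieszProj S z)]
  exact finiteDimensional_range_adjoint h

theorem discreteProj_adjoint (hS : Dense (S.domain : Set H)) (hne : ∃ w, w ∉ spec S)
    (hF : (discreteSpec S).Finite) :
    discreteProj S† = ContinuousLinearMap.adjoint (discreteProj S) := by
  have hm : ∀ z, starRingEnd ℂ z ∈ discreteSpec S† ↔ z ∈ discreteSpec S := fun z =>
    mem_discreteSpec_adjoint_iff hS hne
  have him : discreteSpec S† = (starRingEnd ℂ) '' discreteSpec S := by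
    ext z
    rw [Set.mem_image]
    constructor
    · intro hz
      exact ⟨starRingEnd ℂ z, (hm _).1 (by simpa using hz), by simp⟩
    · rintro ⟨w, hw, rfl⟩
      exact (hm w).2 hw
  rw [discreteProj, him, finsum_mem_image (starRingEnd ℂ).injective.injOn,
    finsum_mem_eq_finite_toFinset_sum _ hF, discreteProj_eq_sum hF, map_sum]
  exact Finset.sum_congr rfl fun z _ => rieszProj_adjoint hS hne z

end DiscreteSpectrum

/-! ### Extension of families that satisfy the resolvent identity. -/

section ResolventFamily

variable {H : Type*} [NormedAddCommGroup H] [InnerProductSpace ℂ H] [CompleteSpace H]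

/-- A locally bounded family that satisfies the resolvent identity has limits. -/
theorem exists_tendsto_of_resolvent_identity {f : ℂ → H →L[ℂ] H} {U : Set ℂ}
    (hf : ∀ z ∈ U, ∀ w ∈ U, f z - f w = (z - w) • (f z ∘L f w)) {x : ℂ} (hx : x ∈ closure U)
    (hb : ∃ C, ∀ᶠ z in 𝓝[U] x, ‖f z‖ ≤ C) : ∃ y, Tendsto f (𝓝[U] x) (𝓝 y) := by
  have : (𝓝[U] x).NeBot := mem_closure_iff_nhdsWithin_neBot.1 hx
  rw [← cauchy_map_iff_exists_tendsto, cauchy_map_iff', tendsto_uniformity_iff_dist_tendsto_zero]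
  obtain ⟨C, hC⟩ := hb
  have h1 : Tendsto (fun p : ℂ × ℂ => ‖p.1 - p.2‖ * (C * C)) (𝓝[U] x ×ˢ 𝓝[U] x) (𝓝 0) := by
    have h2 : Tendsto (fun p : ℂ × ℂ => p.1 - p.2) (𝓝[U] x ×ˢ 𝓝[U] x) (𝓝 (x - x)) :=
      (tendsto_fst.mono_right nhdsWithin_le_nhds).sub (tendsto_snd.mono_right nhdsWithin_le_nhds)
    simpa using h2.norm.mul_const (C * C)
  refine squeeze_zero' (Eventually.of_forall fun _ => dist_nonneg) ?_ h1
  have hU : ∀ᶠ z in 𝓝[U] x, ‖f z‖ ≤ C ∧ z ∈ U := hC.and self_mem_nhdsWithin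
  filter_upwards [hU.prod_mk hU] with p hp
  obtain ⟨⟨h1, h2⟩, h3, h4⟩ := hp
  rw [dist_eq_norm, hf _ h2 _ h4, norm_smul]
  have := (norm_nonneg _).trans h1
  gcongr
  exact (ContinuousLinearMap.opNorm_comp_le _ _).trans (by gcongr)

/-- The difference quotient is exactly `f z ∘ f x`, so continuity already gives the derivative. -/
theorem differentiableAt_of_resolvent_identity {f : ℂ → H →L[ℂ] H} {x : ℂ}
    (hf : ∀ᶠ z in 𝓝 x, f z - f x = (z - x) • (f z ∘L f x)) (hc : ContinuousAt f x) :
    DifferentiableAt ℂ f x := by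
  refine HasDerivAt.differentiableAt (f' := f x ∘L f x) ?_
  rw [hasDerivAt_iff_tendsto_slope]
  have h1 : Tendsto (fun z => f z ∘L f x) (𝓝[≠] x) (𝓝 (f x ∘L f x)) :=
    (((ContinuousLinearMap.compL ℂ H H H).flip (f x)).continuous.tendsto (f x)).comp
      (hc.tendsto.mono_left nhdsWithin_le_nhds)
  refine h1.congr' ?_
  filter_upwards [self_mem_nhdsWithin, mem_nhdsWithin_of_mem_nhds hf] with z hz hzf
  rw [slope_def_module, hzf, smul_smul, inv_mul_cancel₀ (sub_ne_zero.2 hz), one_smul]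

/-- An identity between continuous functions extends to limit points. -/
theorem eq_of_continuousAt_of_mem_closure {X Y : Type*} [TopologicalSpace X] [TopologicalSpace Y]
    [T2Space Y] {f g : X → Y} {U : Set X} {x : X} (hx : x ∈ closure U) (hf : ContinuousAt f x)
    (hg : ContinuousAt g x) (h : ∀ y ∈ U, f y = g y) : f x = g x := by
  have : (𝓝[U] x).NeBot := mem_closure_iff_nhdsWithin_neBot.1 hx
  refine tendsto_nhds_unique (hf.tendsto.mono_left (nhdsWithin_le_nhds (s := U)))
    ((hg.tendsto.mono_left nhdsWithin_le_nhds).congr' ?_)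
  filter_upwards [self_mem_nhdsWithin] with y hy using (h y hy).symm

omit [CompleteSpace H] in
theorem exists_uniform_bound_near_finite {f : ℂ → H →L[ℂ] H} {F : Set ℂ} (hF : F.Finite)
    (hf : ∀ μ ∈ F, ContinuousAt f μ) :
    ∃ M, ∀ᶠ δ : ℝ in 𝓝[>] 0, ∀ μ ∈ F, ∀ z, dist z μ < δ → ‖f z‖ ≤ M := by
  obtain ⟨M, hM⟩ := (hF.image fun μ => ‖f μ‖).bddAbove
  refine ⟨M + 1, (hF.eventually_all).2 fun μ hμ => ?_⟩
  have h1 : ∀ᶠ z in 𝓝 μ, ‖f z‖ < M + 1 :=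
    (hf μ hμ).norm.eventually_lt_const
      ((hM (Set.mem_image_of_mem _ hμ)).trans_lt (lt_add_one M))
  obtain ⟨ρ, hρ, h2⟩ := Metric.eventually_nhds_iff.1 h1
  filter_upwards [Ioo_mem_nhdsGT hρ] with δ hδ z hz
  exact (h2 (hz.trans hδ.2)).le

end ResolventFamily

/-! ### Regular and singular part of the resolvent of `L`. -/

section Construction

open Metric Complex ContinuousLinearMap

variable {H : Type*} [NormedAddCommGroup H] [InnerProductSpace ℂ H] [CompleteSpace H]

/-- The assumptions on the operators `T` and `L = T + B^* A`. -/
structure WaveHyp (T L : H →ₗ.[ℂ] H) (A B : H →L[ℂ] H) : Prop where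
  dense : Dense (T.domain : Set H)
  real : ∀ z ∈ spec T, z.im = 0
  eq : L = ((adjoint B ∘L A : H →L[ℂ] H) : H →ₗ[ℂ] H) +ᵥ T
  smooth_A : IsSmooth A T
  smooth_B : IsSmooth B T†
  bound : ∃ C : ℝ, ∀ z : ℂ, z.im ≠ 0 → ‖A ∘L resolv T z ∘L adjoint B‖ ≤ C
  finite : (discreteSpec L).Finite
  spec_diff : spec L \ discreteSpec L = spec T
  bound' : ∀ δ : ℝ, 0 < δ → ∃ C : ℝ, ∀ z : ℂ, z.im ≠ 0 →
    (∀ μ ∈ discreteSpec L, δ ≤ dist z μ) → ‖A ∘L resolv L z ∘L adjoint B‖ ≤ C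

namespace WaveHyp

variable {T L : H →ₗ.[ℂ] H} {A B : H →L[ℂ] H} {z w : ℂ}

theorem notMem_spec_T (h : WaveHyp T L A B) (hz : z.im ≠ 0) : z ∉ spec T :=
  fun h' => hz (h.real z h')

theorem notMem_spec_L (h : WaveHyp T L A B) (hz : z ∉ spec T) (hzF : z ∉ discreteSpec L) :
    z ∉ spec L := fun h' => hz (h.spec_diff ▸ ⟨h', hzF⟩)

theorem notMem_spec_T_of_mem (h : WaveHyp T L A B) (hz : z ∈ discreteSpec L) : z ∉ spec T := by
  rw [← h.spec_diff]
  exact fun h' => h'.2 hz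

theorem sub_left (h : WaveHyp T L A B) (hz : z ∉ spec T) (hz' : z ∉ spec L) (x : H) :
    resolv L z (adjoint B (A (resolv T z x))) = resolv T z x - resolv L z x := by
  have h1 := isResolventAt_resolv hz'
  have h2 := (isResolventAt_resolv hz).vadd_left (h.eq ▸ h1)
  rw [← h.eq] at h2
  exact (congrArg (fun X : H →L[ℂ] H => X x) h2).symm

theorem sub_right (h : WaveHyp T L A B) (hz : z ∉ spec T) (hz' : z ∉ spec L) (x : H) :
    resolv T z (adjoint B (A (resolv L z x))) = resolv T z x - resolv L z x := by
  have h1 := isResolventAt_resolv hz'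
  have h2 := (isResolventAt_resolv hz).vadd_right (h.eq ▸ h1)
  rw [← h.eq] at h2
  exact (congrArg (fun X : H →L[ℂ] H => X x) h2).symm

theorem proj_proj (h : WaveHyp T L A B) (x : H) :
    discreteProj L (discreteProj L x) = discreteProj L x :=
  congrArg (fun X : H →L[ℂ] H => X x) (discreteProj_mul_self h.finite)

theorem resolv_proj (h : WaveHyp T L A B) (hz : z ∉ spec L) (x : H) :
    resolv L z (discreteProj L x) = discreteProj L (resolv L z x) :=
  congrArg (fun X : H →L[ℂ] H => X x) (resolv_comm_discreteProj h.finite hz)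

variable (L) in
/-- The non-real points of the resolvent set. -/
def nonreal : Set ℂ := {z | z.im ≠ 0 ∧ z ∉ discreteSpec L}

theorem mem_closure_nonreal (h : WaveHyp T L A B) (z : ℂ) : z ∈ closure (nonreal L) := by
  have h1 : Tendsto (fun ε : ℝ => z + ε * I) (𝓝[>] 0) (𝓝 z) := by
    have hc : Continuous fun ε : ℝ => z + ε * I := by fun_prop
    have := hc.tendsto 0
    simp only [ofReal_zero, zero_mul, add_zero] at this
    exact this.mono_left nhdsWithin_le_nhds
  refine mem_closure_of_tendsto h1 ?_
  have hinj : Function.Injective fun ε : ℝ => z + ε * I := fun a b hab => by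
    simpa using hab
  -- Only finitely many `ε` bring `z + iε` onto the real axis or into the discrete spectrum.
  have hfin : ((fun ε : ℝ => z + ε * I) ⁻¹' (discreteSpec L ∪ {z.re + (0 : ℝ) * I})).Finite :=
    (h.finite.union (Set.finite_singleton _)).preimage hinj.injOn
  have hfin' : (((fun ε : ℝ => z + ε * I) ⁻¹'
      (discreteSpec L ∪ {z.re + (0 : ℝ) * I})) \ {0}).Finite := hfin.sdiff
  have h2 := hfin'.isClosed.isOpen_compl.mem_nhds (x := (0 : ℝ)) (by simp)
  filter_upwards [self_mem_nhdsWithin, mem_nhdsWithin_of_mem_nhds h2] with ε hε h3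
  have hε0 : ε ≠ 0 := ne_of_gt hε
  refine ⟨fun h4 => h3 ⟨Or.inr ?_, hε0⟩, fun h4 => h3 ⟨Or.inl h4, hε0⟩⟩
  have h5 : (z + ε * I).im = 0 := h4
  refine Complex.ext (by simp) ?_
  rw [h5]
  simp

theorem notMem_spec_of_nonreal (h : WaveHyp T L A B) (hz : z ∈ nonreal L) :
    z ∉ spec T ∧ z ∉ spec L :=
  ⟨h.notMem_spec_T hz.1, h.notMem_spec_L (h.notMem_spec_T hz.1) hz.2⟩

variable (L) in
/-- The part of the resolvent of `L` that is regular in the discrete spectrum. -/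
noncomputable def regPart : ℂ → H →L[ℂ] H :=
  extendFrom (nonreal L) fun z => resolv L z ∘L (1 - discreteProj L)

variable (L) in
/-- The part of the resolvent of `L` that is singular in the discrete spectrum. -/
noncomputable def singPart : ℂ → H →L[ℂ] H :=
  extendFrom (nonreal L) fun z => resolv L z ∘L discreteProj L

/-- Cutting the resolvent down by an idempotent that commutes with it preserves the resolvent
identity. It is used for `P` and for `I - P`. -/
theorem resolvent_identity_mul (h : WaveHyp T L A B) {E : H →L[ℂ] H} (hE : E ∘L E = E)
    (hc : ∀ z ∉ spec L, resolv L z ∘L E = E ∘L resolv L z) :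
    ∀ z ∈ nonreal L, ∀ w ∈ nonreal L, resolv L z ∘L E - resolv L w ∘L E =
      (z - w) • ((resolv L z ∘L E) ∘L (resolv L w ∘L E)) := fun z hz w hw => by
  have h1 := resolv_sub (h.notMem_spec_of_nonreal hz).2 (h.notMem_spec_of_nonreal hw).2
  rw [← sub_comp, h1, smul_comp, comp_assoc, comp_assoc, ← comp_assoc E,
    ← hc w (h.notMem_spec_of_nonreal hw).2, comp_assoc, hE]

theorem one_sub_proj_comp (h : WaveHyp T L A B) :
    (1 - discreteProj L) ∘L (1 - discreteProj L) = 1 - discreteProj L := by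
  ext x
  simp [h.proj_proj]

theorem continuousOn_resolv_mul (h : WaveHyp T L A B) (E : H →L[ℂ] H) :
    ContinuousOn (fun z => resolv L z ∘L E) (nonreal L) :=
  ContinuousOn.clm_comp (continuousOn_resolv fun _ hz => (h.notMem_spec_of_nonreal hz).2)
    continuousOn_const

theorem regPart_eq (h : WaveHyp T L A B) (hz : z ∈ nonreal L) :
    regPart L z = resolv L z ∘L (1 - discreteProj L) :=
  extendFrom_extends (h.continuousOn_resolv_mul _) z hz

theorem singPart_eq (h : WaveHyp T L A B) (hz : z ∈ nonreal L) :
    singPart L z = resolv L z ∘L discreteProj L :=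
  extendFrom_extends (h.continuousOn_resolv_mul _) z hz

theorem regPart_apply (h : WaveHyp T L A B) (hz : z ∈ nonreal L) (x : H) :
    regPart L z x = resolv L z x - discreteProj L (resolv L z x) := by
  rw [h.regPart_eq hz, ← h.resolv_proj (h.notMem_spec_of_nonreal hz).2]
  simp

theorem singPart_apply (h : WaveHyp T L A B) (hz : z ∈ nonreal L) (x : H) :
    singPart L z x = discreteProj L (resolv L z x) := by
  rw [h.singPart_eq hz, ← h.resolv_proj (h.notMem_spec_of_nonreal hz).2]
  rfl

/-- A locally bounded family satisfying the resolvent identity is Cauchy at limit points, so no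
Laurent expansion is needed. Boundedness at a point of the discrete spectrum comes from its Riesz
projection; elsewhere off `spec T` the resolvent of `L` is continuous. -/
theorem continuousAt_regPart (h : WaveHyp T L A B) (hz : z ∉ spec T) :
    ContinuousAt (regPart L) z := by
  refine (continuousOn_extendFrom (B := (spec T)ᶜ) (fun x _ => h.mem_closure_nonreal x)
    fun x hx => ?_).continuousAt ((isOpen_compl_spec T).mem_nhds hz)
  refine exists_tendsto_of_resolvent_identity (h.resolvent_identity_mul h.one_sub_proj_comp ?_)
    (h.mem_closure_nonreal x) ?_
  · intro z hz
    ext v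
    simp [h.resolv_proj hz]
  · by_cases hxF : x ∈ discreteSpec L
    · obtain ⟨C, hC⟩ := exists_norm_resolv_mul_one_sub_discreteProj_le h.finite hxF
      refine ⟨C, hC.filter_mono (nhdsWithin_mono _ fun y hy => ?_)⟩
      rintro rfl
      exact hy.2 hxF
    · have h1 : ContinuousAt (fun z => resolv L z ∘L (1 - discreteProj L)) x :=
        ((differentiableAt_resolv (h.notMem_spec_L hx hxF)).continuousAt).clm_comp
          continuousAt_const
      refine ⟨‖resolv L x ∘L (1 - discreteProj L)‖ + 1, ?_⟩
      have := h1.norm.eventually_lt_const (lt_add_one _)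
      exact (this.mono fun _ => le_of_lt).filter_mono nhdsWithin_le_nhds

/-- `R_V P` is bounded at positive distance from the discrete spectrum, even up to `spec T`. Hence
the singular part has limits at all but finitely many real points. -/
theorem continuousAt_singPart (h : WaveHyp T L A B) (hz : z ∉ discreteSpec L) :
    ContinuousAt (singPart L) z := by
  refine (continuousOn_extendFrom (B := (discreteSpec L)ᶜ) (fun x _ => h.mem_closure_nonreal x)
    fun x hx => ?_).continuousAt (h.finite.isClosed.isOpen_compl.mem_nhds hz)
  refine exists_tendsto_of_resolvent_identity
    (h.resolvent_identity_mul (discreteProj_mul_self h.finite) fun z hz =>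
      resolv_comm_discreteProj h.finite hz) (h.mem_closure_nonreal x) ?_
  obtain ⟨δ, hδ, hδ'⟩ := Metric.isOpen_iff.1 h.finite.isClosed.isOpen_compl x hx
  obtain ⟨C, hC⟩ := exists_norm_resolv_mul_discreteProj_le h.finite (half_pos hδ)
  refine ⟨C, ?_⟩
  filter_upwards [self_mem_nhdsWithin, mem_nhdsWithin_of_mem_nhds (ball_mem_nhds x (half_pos hδ))]
    with w hw hwx
  refine hC w (h.notMem_spec_of_nonreal hw).2 fun μ hμ => ?_
  by_contra hlt
  push Not at hlt
  refine hδ' (a := μ) ?_ hμ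
  rw [mem_ball] at hwx ⊢
  have := dist_triangle_left μ x w
  linarith

/-- The identity is extended by continuity in one variable at a time. -/
theorem regPart_sub (h : WaveHyp T L A B) (hz : z ∉ spec T) (hw : w ∉ spec T) :
    regPart L z - regPart L w = (z - w) • (regPart L z ∘L regPart L w) := by
  have h0 : ∀ z ∈ nonreal L, ∀ w ∈ nonreal L,
      regPart L z - regPart L w = (z - w) • (regPart L z ∘L regPart L w) := fun z hz w hw => by
    rw [h.regPart_eq hz, h.regPart_eq hw]
    refine h.resolvent_identity_mul h.one_sub_proj_comp ?_ z hz w hw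
    intro z hz
    ext v
    simp [h.resolv_proj hz]
  have h1 : ∀ z ∈ nonreal L, regPart L z - regPart L w =
      (z - w) • (regPart L z ∘L regPart L w) := fun z hz =>
    eq_of_continuousAt_of_mem_closure (f := fun w => regPart L z - regPart L w)
      (g := fun w => (z - w) • (regPart L z ∘L regPart L w)) (h.mem_closure_nonreal w)
      (continuousAt_const.sub (h.continuousAt_regPart hw))
      ((continuousAt_const.sub continuousAt_id).smul
        (continuousAt_const.clm_comp (h.continuousAt_regPart hw))) (h0 z hz)
  exact eq_of_continuousAt_of_mem_closure (f := fun z => regPart L z - regPart L w)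
    (g := fun z => (z - w) • (regPart L z ∘L regPart L w)) (h.mem_closure_nonreal z)
    ((h.continuousAt_regPart hz).sub continuousAt_const)
    ((continuousAt_id.sub continuousAt_const).smul
      ((h.continuousAt_regPart hz).clm_comp continuousAt_const)) h1

theorem differentiableAt_regPart (h : WaveHyp T L A B) (hz : z ∉ spec T) :
    DifferentiableAt ℂ (regPart L) z := by
  refine differentiableAt_of_resolvent_identity ?_ (h.continuousAt_regPart hz)
  filter_upwards [(isOpen_compl_spec T).mem_nhds hz] with w hw using h.regPart_sub hw hz

theorem continuousAt_resolv_T (hz : z ∉ spec T) : ContinuousAt (resolv T) z :=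
  (differentiableAt_resolv hz).continuousAt

theorem proj_regPart (h : WaveHyp T L A B) (hz : z ∉ spec T) (x : H) :
    discreteProj L (regPart L z x) = 0 := by
  refine eq_of_continuousAt_of_mem_closure (f := fun z => discreteProj L (regPart L z x))
    (g := fun _ => (0 : H)) (h.mem_closure_nonreal z) ?_ continuousAt_const fun w hw => ?_
  · exact (discreteProj L).continuous.continuousAt.comp
      ((h.continuousAt_regPart hz).clm_apply continuousAt_const)
  · rw [h.regPart_apply hw, map_sub, h.proj_proj, sub_self]

theorem regPart_proj (h : WaveHyp T L A B) (hz : z ∉ spec T) (x : H) :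
    regPart L z (discreteProj L x) = 0 := by
  refine eq_of_continuousAt_of_mem_closure (f := fun z => regPart L z (discreteProj L x))
    (g := fun _ => (0 : H)) (h.mem_closure_nonreal z)
    ((h.continuousAt_regPart hz).clm_apply continuousAt_const) continuousAt_const fun w hw => ?_
  rw [h.regPart_eq hw]
  simp [h.proj_proj]

theorem sub_regPart (h : WaveHyp T L A B) (hz : z ∉ spec T) (x : H) :
    regPart L z (adjoint B (A (resolv T z x))) =
      resolv T z x - discreteProj L (resolv T z x) - regPart L z x := by
  have hR : ContinuousAt (fun z => resolv T z x) z :=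
    (continuousAt_resolv_T hz).clm_apply continuousAt_const
  refine eq_of_continuousAt_of_mem_closure
    (f := fun z => regPart L z (adjoint B (A (resolv T z x))))
    (g := fun z => resolv T z x - discreteProj L (resolv T z x) - regPart L z x)
    (h.mem_closure_nonreal z) ?_ ?_ fun w hw => ?_
  · exact (h.continuousAt_regPart hz).clm_apply
      ((adjoint B).continuous.continuousAt.comp (A.continuous.continuousAt.comp hR))
  · exact (hR.sub ((discreteProj L).continuous.continuousAt.comp hR)).sub
      ((h.continuousAt_regPart hz).clm_apply continuousAt_const)
  · obtain ⟨h1, h2⟩ := h.notMem_spec_of_nonreal hw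
    rw [h.regPart_apply hw, h.regPart_apply hw, h.sub_left h1 h2, map_sub]
    abel

theorem sub_regPart' (h : WaveHyp T L A B) (hz : z ∉ spec T) (x : H) :
    resolv T z (adjoint B (A (regPart L z x))) =
      resolv T z x - resolv T z (discreteProj L x) - regPart L z x := by
  have hR := continuousAt_resolv_T hz
  have hQ := (h.continuousAt_regPart hz).clm_apply (continuousAt_const (y := x))
  refine eq_of_continuousAt_of_mem_closure
    (f := fun z => resolv T z (adjoint B (A (regPart L z x))))
    (g := fun z => resolv T z x - resolv T z (discreteProj L x) - regPart L z x)
    (h.mem_closure_nonreal z) ?_ ?_ fun w hw => ?_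
  · exact hR.clm_apply
      ((adjoint B).continuous.continuousAt.comp (A.continuous.continuousAt.comp hQ))
  · exact ((hR.clm_apply continuousAt_const).sub (hR.clm_apply continuousAt_const)).sub hQ
  · obtain ⟨h1, h2⟩ := h.notMem_spec_of_nonreal hw
    have h3 := h.sub_right h1 h2 (x - discreteProj L x)
    rw [h.regPart_eq hw]
    simp only [comp_apply, sub_apply, one_apply_eq_self]
    rw [h3]
    simp only [map_sub]

end WaveHyp

end Construction

/-! ### Hardy properties and bounds for the parts of the resolvent. -/

section Construction

open Metric Complex ContinuousLinearMap

variable {H : Type*} [NormedAddCommGroup H] [InnerProductSpace ℂ H] [CompleteSpace H]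

omit [CompleteSpace H] in
/-- A function that is bounded near a finite set and dominated by a Hardy function elsewhere. -/
theorem IsHardy.of_norm_le_off_finite {Y G : ℂ → H} {F : Set ℂ} (hF : F.Finite) (hY : IsHardy Y)
    (hG : DifferentiableOn ℂ G {z | 0 < z.im}) {δ C M : ℝ}
    (h : ∀ z : ℂ, 0 < z.im → (∀ μ ∈ F, δ ≤ dist z μ) → ‖G z‖ ≤ C * ‖Y z‖)
    (h' : ∀ z : ℂ, 0 < z.im → ∀ μ ∈ F, dist z μ < δ → ‖G z‖ ≤ M) : IsHardy G := by
  refine hY.of_norm_le_off hG (K := ⋃ μ ∈ F, ball μ δ)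
    ((Bornology.isBounded_biUnion hF).2 fun _ _ => isBounded_ball) (C := C) (M := M)
    (fun z hz hzK => h z hz fun μ hμ => ?_) fun z hz hzK => ?_
  · by_contra hlt
    exact hzK (Set.mem_biUnion hμ (mem_ball.2 (not_le.1 hlt)))
  · obtain ⟨μ, hμ, hzμ⟩ := Set.mem_iUnion₂.1 hzK
    exact h' z hz μ hμ hzμ

namespace WaveHyp

variable {T L : H →ₗ.[ℂ] H} {A B : H →L[ℂ] H} {z w : ℂ}

theorem hardy_resolv (h : WaveHyp T L A B) (x : H) : IsHardy fun z => A (resolv T z x) := by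
  obtain ⟨C, hC⟩ := h.smooth_A x
  refine ⟨fun z hz => ?_, C, fun ε hε => (hC ε hε).1⟩
  have h1 := differentiableAt_resolv (h.notMem_spec_T (z := z) (ne_of_gt hz))
  exact (A.differentiableAt.comp z
    (h1.clm_apply (differentiableAt_const x))).differentiableWithinAt

theorem sharp_resolv (h : WaveHyp T L A B) (hz : z.im ≠ 0) :
    sharp (resolv T) z = resolv T† z := by
  have h1 := resolv_adjoint h.dense (h.notMem_spec_T (z := starRingEnd ℂ z) (by simpa using hz))
  rw [starRingEnd_self_apply] at h1
  exact h1.symm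

theorem differentiableAt_sharp_apply {X : ℂ → H →L[ℂ] H}
    (hX : ∀ z : ℂ, z.im ≠ 0 → DifferentiableAt ℂ X z) (x : H) :
    DifferentiableOn ℂ (fun z => B (sharp X z x)) {z | 0 < z.im} := fun z hz => by
  have h1 : DifferentiableAt ℂ (sharp X) z :=
    differentiableAt_sharp (hX _ (by simpa using ne_of_gt hz))
  exact (B.differentiableAt.comp z
    (h1.clm_apply (differentiableAt_const x))).differentiableWithinAt

theorem hardy_sharp_resolv (h : WaveHyp T L A B) (x : H) :
    IsHardy fun z => B (sharp (resolv T) z x) := by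
  obtain ⟨C, hC⟩ := h.smooth_B x
  refine ⟨differentiableAt_sharp_apply (fun z hz => differentiableAt_resolv (h.notMem_spec_T hz)) x,
    C, fun ε hε => ?_⟩
  refine le_trans (le_of_eq ?_) (hC ε hε).1
  refine lintegral_congr fun k => ?_
  beta_reduce
  rw [h.sharp_resolv (by simpa using hε.ne')]

/-- The finite discrete spectrum lies off `spec T`, where both functions are continuous. -/
theorem exists_bound_near (h : WaveHyp T L A B) : ∃ δ > 0, ∃ M, ∀ μ ∈ discreteSpec L, ∀ z,
    dist z μ < δ → ‖resolv T z‖ ≤ M ∧ ‖regPart L z‖ ≤ M := by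
  obtain ⟨M₁, h1⟩ := exists_uniform_bound_near_finite (f := resolv T) h.finite fun μ hμ =>
    continuousAt_resolv_T (h.notMem_spec_T_of_mem hμ)
  obtain ⟨M₂, h2⟩ := exists_uniform_bound_near_finite (f := regPart L) h.finite fun μ hμ =>
    h.continuousAt_regPart (h.notMem_spec_T_of_mem hμ)
  obtain ⟨δ, ⟨h3, h4⟩, hδ⟩ := ((h1.and h2).and self_mem_nhdsWithin).exists
  exact ⟨δ, hδ, max M₁ M₂, fun μ hμ z hz => ⟨(h3 μ hμ z hz).trans (le_max_left _ _),
    (h4 μ hμ z hz).trans (le_max_right _ _)⟩⟩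

omit [CompleteSpace H] in
theorem mem_nonreal {δ : ℝ} (hδ : 0 < δ) (hz : z.im ≠ 0)
    (hzF : ∀ μ ∈ discreteSpec L, δ ≤ dist z μ) : z ∈ nonreal L :=
  ⟨hz, fun h' => by
    have := hzF z h'
    rw [dist_self] at this
    linarith⟩

/-- Away from the discrete spectrum, `A Q x = (1 - A R_V B^*) A R₀ y` with `y = (I - P) x`, and the
first factor is bounded by (iii). Near it `Q` itself is bounded, and a bounded function on a bounded
set does not affect membership in `H₂`. -/
theorem hardy_regPart (h : WaveHyp T L A B) (x : H) : IsHardy fun z => A (regPart L z x) := by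
  obtain ⟨δ, hδ, M, hM⟩ := h.exists_bound_near
  obtain ⟨C, hC⟩ := h.bound' δ hδ
  refine IsHardy.of_norm_le_off_finite h.finite (h.hardy_resolv (x - discreteProj L x))
    (fun z hz => ?_) (δ := δ) (C := 1 + C) (M := ‖A‖ * (M * ‖x‖)) (fun z hz hzF => ?_)
    fun z hz μ hμ hzμ => ?_
  · exact (A.differentiableAt.comp z
      ((h.differentiableAt_regPart (h.notMem_spec_T (ne_of_gt hz))).clm_apply
        (differentiableAt_const x))).differentiableWithinAt
  · have hn := mem_nonreal hδ hz.ne' hzF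
    obtain ⟨h1, h2⟩ := h.notMem_spec_of_nonreal hn
    set y := x - discreteProj L x
    have h3 : regPart L z x = resolv L z y := by
      rw [h.regPart_eq hn]
      simp [y]
    have h4 : A (regPart L z x) =
        A (resolv T z y) - (A ∘L resolv L z ∘L adjoint B) (A (resolv T z y)) := by
      simp only [comp_apply]
      rw [h3, h.sub_left h1 h2, map_sub A, sub_sub_cancel]
    rw [h4, add_mul, one_mul]
    refine (norm_sub_le _ _).trans (add_le_add_right ((le_opNorm _ _).trans ?_) _)
    gcongr
    exact hC z hz.ne' hzF
  · refine (le_opNorm _ _).trans ?_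
    gcongr
    refine (le_opNorm _ _).trans ?_
    gcongr
    exact (hM μ hμ z hzμ).2

/-- The adjoint version of `hardy_regPart`; the exceptional set becomes the conjugate of the
discrete spectrum. -/
theorem hardy_sharp_regPart (h : WaveHyp T L A B) (x : H) :
    IsHardy fun z => B (sharp (regPart L) z x) := by
  obtain ⟨δ, hδ, M, hM⟩ := h.exists_bound_near
  obtain ⟨C, hC⟩ := h.bound' δ hδ
  have hF : ((starRingEnd ℂ) '' discreteSpec L).Finite := h.finite.image _
  set y := x - adjoint (discreteProj L) x
  refine IsHardy.of_norm_le_off_finite hF (h.hardy_sharp_resolv y)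
    (differentiableAt_sharp_apply
      (fun z hz => h.differentiableAt_regPart (h.notMem_spec_T hz)) x)
    (δ := δ) (C := 1 + C) (M := ‖B‖ * (M * ‖x‖)) (fun z hz hzF => ?_) fun z hz μ hμ hzμ => ?_
  · have hz' : (starRingEnd ℂ z).im ≠ 0 := by simpa using hz.ne'
    have hzF' : ∀ μ ∈ discreteSpec L, δ ≤ dist (starRingEnd ℂ z) μ := fun μ hμ => by
      have := hzF _ (Set.mem_image_of_mem _ hμ)
      rwa [← Complex.dist_conj_conj, starRingEnd_self_apply] at this
    have hn := mem_nonreal hδ hz' hzF'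
    obtain ⟨h1, h2⟩ := h.notMem_spec_of_nonreal hn
    have h3 : sharp (regPart L) z x = adjoint (resolv L (starRingEnd ℂ z)) y := by
      refine ext_inner_left ℂ fun v => ?_
      rw [inner_sharp, h.regPart_apply hn, adjoint_inner_right, inner_sub_right,
        adjoint_inner_right, inner_sub_left]
    have h4 : B (sharp (regPart L) z x) = B (sharp (resolv T) z y) -
        adjoint (A ∘L resolv L (starRingEnd ℂ z) ∘L adjoint B) (B (sharp (resolv T) z y)) := by
      rw [h3, adjoint_comp, adjoint_comp, adjoint_adjoint]
      simp only [comp_apply, ← map_sub]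
      congr 1
      refine ext_inner_left ℂ fun v => ?_
      have h5 := h.sub_right h1 h2 v
      rw [inner_sub_right, inner_sharp, adjoint_inner_right, adjoint_inner_right,
        adjoint_inner_right, ← adjoint_inner_left B, inner_sharp, h5, inner_sub_left]
      abel
    rw [h4, add_mul, one_mul]
    refine (norm_sub_le _ _).trans (add_le_add_right ((le_opNorm _ _).trans ?_) _)
    gcongr
    rw [LinearIsometryEquiv.norm_map]
    exact hC _ hz' hzF'
  · obtain ⟨μ, hμ, rfl⟩ := hμ
    refine (le_opNorm _ _).trans ?_
    gcongr
    refine (le_opNorm _ _).trans ?_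
    gcongr
    rw [sharp, LinearIsometryEquiv.norm_map]
    refine (hM μ hμ _ ?_).2
    rwa [← Complex.dist_conj_conj, starRingEnd_self_apply]

theorem exists_bound_singPart (h : WaveHyp T L A B) {δ : ℝ} (hδ : 0 < δ) : ∃ C, ∀ z : ℂ,
    z.im ≠ 0 → (∀ μ ∈ discreteSpec L, δ ≤ dist z μ) → ‖singPart L z‖ ≤ C := by
  obtain ⟨C, hC⟩ := exists_norm_resolv_mul_discreteProj_le h.finite hδ
  refine ⟨C, fun z hz hzF => ?_⟩
  have hn := mem_nonreal hδ hz hzF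
  rw [h.singPart_eq hn]
  exact hC z (h.notMem_spec_of_nonreal hn).2 hzF

theorem sub_singPart (h : WaveHyp T L A B) (hz : z ∈ nonreal L) (x : H) :
    singPart L z (adjoint B (A (resolv T z x))) =
      discreteProj L (resolv T z x) - singPart L z x := by
  obtain ⟨h1, h2⟩ := h.notMem_spec_of_nonreal hz
  rw [h.singPart_apply hz, h.singPart_apply hz, h.sub_left h1 h2, map_sub]

theorem sub_singPart' (h : WaveHyp T L A B) (hz : z ∈ nonreal L) (x : H) :
    resolv T z (adjoint B (A (singPart L z x))) =
      resolv T z (discreteProj L x) - singPart L z x := by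
  obtain ⟨h1, h2⟩ := h.notMem_spec_of_nonreal hz
  rw [h.singPart_eq hz, comp_apply, h.sub_right h1 h2]

theorem singPart_of_proj (h : WaveHyp T L A B) (hz : z ∈ nonreal L) {x : H}
    (hx : discreteProj L x = 0) : singPart L z x = 0 := by
  rw [h.singPart_eq hz, comp_apply, hx, map_zero]

theorem norm_comp_comp_le (X : H →L[ℂ] H) : ‖A ∘L X ∘L adjoint B‖ ≤ ‖A‖ * (‖X‖ * ‖B‖) := by
  refine (opNorm_comp_le _ _).trans ?_
  gcongr
  refine (opNorm_comp_le _ _).trans ?_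
  rw [LinearIsometryEquiv.norm_map]

/-- When `P x = 0` the second resolvent identity reads `P R₀ x = N B^* A R₀ x`, and `N` is bounded
away from the discrete spectrum. -/
theorem hardy_proj_resolv (h : WaveHyp T L A B) {x : H} (hx : discreteProj L x = 0) :
    IsHardy fun z => A (discreteProj L (resolv T z x)) := by
  obtain ⟨δ, hδ, M, hM⟩ := h.exists_bound_near
  obtain ⟨C, hC⟩ := h.exists_bound_singPart hδ
  refine IsHardy.of_norm_le_off_finite h.finite (h.hardy_resolv x)
    (fun z hz => ?_) (δ := δ) (C := ‖A‖ * (C * ‖B‖)) (M := ‖A‖ * (‖discreteProj L‖ * (M * ‖x‖)))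
    (fun z hz hzF => ?_) fun z hz μ hμ hzμ => ?_
  · exact (A.differentiableAt.comp z ((discreteProj L).differentiableAt.comp z
      ((differentiableAt_resolv (h.notMem_spec_T (ne_of_gt hz))).clm_apply
        (differentiableAt_const x)))).differentiableWithinAt
  · have hn := mem_nonreal hδ hz.ne' hzF
    have h4 : A (discreteProj L (resolv T z x)) =
        (A ∘L singPart L z ∘L adjoint B) (A (resolv T z x)) := by
      simp only [comp_apply]
      rw [h.sub_singPart hn, h.singPart_of_proj hn hx, sub_zero]
    rw [h4]
    refine (le_opNorm _ _).trans ?_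
    gcongr
    refine (norm_comp_comp_le _).trans ?_
    gcongr
    exact hC z hz.ne' hzF
  · refine (le_opNorm _ _).trans ?_
    gcongr
    refine (le_opNorm _ _).trans ?_
    gcongr
    refine (le_opNorm _ _).trans ?_
    gcongr
    exact (hM μ hμ z hzμ).1

/-- Away from the discrete spectrum `Q = R_V - N`, with (iii) for the first term; near it `Q` is
bounded. -/
theorem exists_bound_regPart (h : WaveHyp T L A B) : ∃ C, ∀ z : ℂ, z.im ≠ 0 →
    ‖A ∘L regPart L z ∘L adjoint B‖ ≤ C := by
  obtain ⟨δ, hδ, M, hM⟩ := h.exists_bound_near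
  obtain ⟨C, hC⟩ := h.bound' δ hδ
  obtain ⟨C', hC'⟩ := h.exists_bound_singPart hδ
  refine ⟨max (C + ‖A‖ * (C' * ‖B‖)) (‖A‖ * (M * ‖B‖)), fun z hz => ?_⟩
  by_cases hzF : ∀ μ ∈ discreteSpec L, δ ≤ dist z μ
  · have hn := mem_nonreal hδ hz hzF
    refine le_max_of_le_left ?_
    have h1 : A ∘L regPart L z ∘L adjoint B =
        A ∘L resolv L z ∘L adjoint B - A ∘L singPart L z ∘L adjoint B := by
      rw [h.regPart_eq hn, h.singPart_eq hn]
      ext v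
      simp
    rw [h1]
    refine (norm_sub_le _ _).trans (add_le_add (hC z hz hzF) ((norm_comp_comp_le _).trans ?_))
    gcongr
    exact hC' z hz hzF
  · push Not at hzF
    obtain ⟨μ, hμ, hzμ⟩ := hzF
    refine le_max_of_le_right ((norm_comp_comp_le _).trans ?_)
    gcongr
    exact (hM μ hμ z hzμ).2

theorem waveData (h : WaveHyp T L A B) :
    WaveData A B (discreteProj L) (resolv T) (regPart L) (singPart L) (discreteSpec L) where
  finite := h.finite
  proj_proj := h.proj_proj
  proj_Q _ hz := h.proj_regPart (h.notMem_spec_T hz)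
  Q_proj _ hz := h.regPart_proj (h.notMem_spec_T hz)
  N_of_proj _ hz hzF _ hx := h.singPart_of_proj ⟨hz, hzF⟩ hx
  R_sub _ _ hz hw := resolv_sub (h.notMem_spec_T hz) (h.notMem_spec_T hw)
  Q_sub _ _ hz hw := h.regPart_sub (h.notMem_spec_T hz) (h.notMem_spec_T hw)
  R_sub_Q _ hz := h.sub_regPart (h.notMem_spec_T hz)
  R_sub_Q' _ hz := h.sub_regPart' (h.notMem_spec_T hz)
  R_sub_N _ hz hzF := h.sub_singPart ⟨hz, hzF⟩
  R_sub_N' _ hz hzF := h.sub_singPart' ⟨hz, hzF⟩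
  differentiableAt_R _ hz := differentiableAt_resolv (h.notMem_spec_T hz)
  differentiableAt_Q _ hz := h.differentiableAt_regPart (h.notMem_spec_T hz)
  continuousAt_N _ hz := h.continuousAt_singPart hz
  hardy_R := h.hardy_resolv
  hardy_Q := h.hardy_regPart
  hardy_sharp_R := h.hardy_sharp_resolv
  hardy_sharp_Q := h.hardy_sharp_regPart
  hardy_proj_R _ hx := h.hardy_proj_resolv hx
  bound_R := h.bound
  bound_Q := h.exists_bound_regPart

end WaveHyp

end Construction

/-! ### The stationary formulas and uniqueness. -/

section Stationary

open Metric Complex ContinuousLinearMap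

variable {H : Type*} [NormedAddCommGroup H] [InnerProductSpace ℂ H] [CompleteSpace H]

omit [InnerProductSpace ℂ H] [CompleteSpace H] in
theorem HasBdry.hasUpperBoundaryValues {F : ℂ → H} {f : Lp H 2 (volume : Measure ℝ)}
    (hf : HasBdry F f) : HasUpperBoundaryValues F := by
  filter_upwards [hf] with k hk using ⟨_, hk⟩

omit [InnerProductSpace ℂ H] [CompleteSpace H] in
theorem HasBdry.upperBoundaryValue_ae {F : ℂ → H} {f : Lp H 2 (volume : Measure ℝ)}
    (hf : HasBdry F f) : upperBoundaryValue F =ᵐ[volume] f := by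
  filter_upwards [hf] with k hk using hk.limUnder_eq

omit [CompleteSpace H] in
theorem HasBdry.inner_ae {F G : ℂ → H} {f g : Lp H 2 (volume : Measure ℝ)} (hf : HasBdry F f)
    (hg : HasBdry G g) : (fun k => inner ℂ (f k) (g k)) =ᵐ[volume]
      fun k => inner ℂ (upperBoundaryValue F k) (upperBoundaryValue G k) := by
  filter_upwards [hf.upperBoundaryValue_ae, hg.upperBoundaryValue_ae] with k h1 h2
  rw [h1, h2]

omit [CompleteSpace H] in
theorem HasBdry.integrable_inner {F G : ℂ → H} {f g : Lp H 2 (volume : Measure ℝ)}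
    (hf : HasBdry F f) (hg : HasBdry G g) :
    Integrable fun k => inner ℂ (upperBoundaryValue F k) (upperBoundaryValue G k) :=
  (L2.integrable_inner (𝕜 := ℂ) f g).congr (hf.inner_ae hg)

omit [CompleteSpace H] in
theorem HasBdry.integral_inner {F G : ℂ → H} {f g : Lp H 2 (volume : Measure ℝ)}
    (hf : HasBdry F f) (hg : HasBdry G g) :
    ∫ k, inner ℂ (upperBoundaryValue F k) (upperBoundaryValue G k) = inner ℂ f g := by
  rw [L2.inner_def]
  exact (integral_congr_ae (hf.inner_ae hg)).symm

omit [CompleteSpace H] in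
-- For `μ = 0` the resolvent is injective. Otherwise a nonzero `x` would be an eigenvector of `T`
-- for `w + μ⁻¹`, impossible both in the resolvent set and in the purely continuous spectrum.
theorem eq_zero_of_resolv_apply_eq_smul {T : H →ₗ.[ℂ] H} (hT : HasPurelyContinuousSpectrum T)
    {w : ℂ} (hw : w ∉ spec T) {μ : ℂ} {x : H} (hx : resolv T w x = μ • x) : x = 0 := by
  have hR := isResolventAt_resolv hw
  have h1 := hR.1 x
  rw [hx] at h1
  by_cases hμ : μ = 0
  · rw [hμ, zero_smul, smul_zero, add_zero] at h1
    exact T.graph_fst_eq_zero_snd h1 rfl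
  · by_contra hx0
    have h2 := T.graph.smul_mem μ⁻¹ h1
    have h3 : (x, (w + μ⁻¹) • x) ∈ T.graph := by
      convert h2 using 1
      rw [Prod.smul_mk, smul_add, smul_smul, smul_smul, smul_smul, inv_mul_cancel₀ hμ, one_smul,
        mul_right_comm, inv_mul_cancel₀ hμ, one_mul, add_smul, add_comm]
    obtain ⟨hxd, hTx⟩ := exists_of_mem_graph h3
    refine (hT (w + μ⁻¹) ?_).1 ⟨⟨x, hxd⟩, hx0, hTx⟩
    by_contra hns
    have h4 := (isResolventAt_resolv hns).2 _ _ h3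
    rw [sub_self, map_zero] at h4
    exact hx0 h4.symm

omit [CompleteSpace H] in
theorem mem_range_one_sub_iff {P : H →L[ℂ] H} (hP : ∀ x, P (P x) = P x) {x : H} :
    x ∈ LinearMap.range ((1 - P : H →L[ℂ] H) : H →ₗ[ℂ] H) ↔ P x = 0 := by
  constructor
  · rintro ⟨y, rfl⟩
    simp [hP]
  · intro h
    exact ⟨x, by simp [h]⟩

omit [CompleteSpace H] in
theorem mem_range_iff {P : H →L[ℂ] H} (hP : ∀ x, P (P x) = P x) {x : H} :
    x ∈ LinearMap.range (P : H →ₗ[ℂ] H) ↔ P x = x := by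
  constructor
  · rintro ⟨y, rfl⟩
    exact hP y
  · intro h
    exact ⟨x, h⟩

namespace WaveHyp

variable {T L : H →ₗ.[ℂ] H} {A B : H →L[ℂ] H} {z w : ℂ}

theorem exists_upper_mem_nonreal (h : WaveHyp T L A B) : ∃ w ∈ nonreal L, 0 < w.im := by
  obtain ⟨w, hw, hw'⟩ := mem_closure_iff.1 (h.mem_closure_nonreal I) _ isOpen_upperHalfPlane
    (by simp)
  exact ⟨w, hw', hw⟩

theorem dense_L (h : WaveHyp T L A B) : Dense (L.domain : Set H) := by
  rw [h.eq]
  exact h.dense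

theorem exists_notMem_spec_L (h : WaveHyp T L A B) : ∃ w, w ∉ spec L := by
  obtain ⟨w, hw, -⟩ := h.exists_upper_mem_nonreal
  exact ⟨w, (h.notMem_spec_of_nonreal hw).2⟩

theorem discreteProj_L_adjoint (h : WaveHyp T L A B) :
    discreteProj L† = adjoint (discreteProj L) :=
  discreteProj_adjoint h.dense_L h.exists_notMem_spec_L h.finite

theorem adjoint_proj_proj (h : WaveHyp T L A B) (x : H) :
    adjoint (discreteProj L) (adjoint (discreteProj L) x) = adjoint (discreteProj L) x :=
  ext_inner_left ℂ fun v => by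
    rw [adjoint_inner_right, adjoint_inner_right, adjoint_inner_right, h.proj_proj]

theorem mem_continuousSubspace_iff (h : WaveHyp T L A B) {x : H} :
    x ∈ continuousSubspace L ↔ discreteProj L x = 0 := mem_range_one_sub_iff h.proj_proj

theorem mem_discreteSubspace_iff (h : WaveHyp T L A B) {x : H} :
    x ∈ discreteSubspace L ↔ discreteProj L x = x := mem_range_iff h.proj_proj

theorem mem_continuousSubspace_adjoint_iff (h : WaveHyp T L A B) {x : H} :
    x ∈ continuousSubspace L† ↔ adjoint (discreteProj L) x = 0 := by
  rw [continuousSubspace, h.discreteProj_L_adjoint]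
  exact mem_range_one_sub_iff h.adjoint_proj_proj

theorem mem_discreteSubspace_adjoint_iff (h : WaveHyp T L A B) {x : H} :
    x ∈ discreteSubspace L† ↔ adjoint (discreteProj L) x = x := by
  rw [discreteSubspace, h.discreteProj_L_adjoint]
  exact mem_range_iff h.adjoint_proj_proj

/-- The discrete spectrum may meet the real axis in gaps of `spec T`, but only in finitely many
points. -/
theorem ae_eventually_nonreal (h : WaveHyp T L A B) : ∀ᵐ k : ℝ, ∀ᶠ ε : ℝ in 𝓝[>] 0,
    (k : ℂ) + ε * I ∈ nonreal L ∧ starRingEnd ℂ ((k : ℂ) + ε * I) ∈ nonreal L := by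
  have hF : ((fun k : ℝ => (k : ℂ)) ⁻¹' discreteSpec L).Finite :=
    h.finite.preimage ofReal_injective.injOn
  filter_upwards [hF.countable.ae_notMem volume] with k hk
  have hlim := tendsto_add_mul_I k
  have hlim' : Tendsto (fun ε : ℝ => starRingEnd ℂ ((k : ℂ) + ε * I)) (𝓝[>] 0) (𝓝 (k : ℂ)) := by
    have := (Complex.continuous_conj.tendsto (k : ℂ)).comp hlim
    rwa [conj_ofReal] at this
  have ho := h.finite.isClosed.isOpen_compl.mem_nhds (x := (k : ℂ)) hk
  filter_upwards [self_mem_nhdsWithin, hlim.eventually ho, hlim'.eventually ho] with ε hε h1 h2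
  have hε0 : ε ≠ 0 := ne_of_gt hε
  exact ⟨⟨by simpa using hε0, h1⟩, by simpa using hε0, h2⟩

section

variable {a a' b b' : H →L[ℂ] Lp H 2 (volume : Measure ℝ)} {W Z : H →L[ℂ] H}

theorem hasBdry_resolv_L (h : WaveHyp T L A B)
    (o : WaveOps A B (discreteProj L) (resolv T) (regPart L) (singPart L) (discreteSpec L)
      a a' b b' W Z) {x : H} (hx : discreteProj L x = 0) :
    HasBdry (fun z => A (resolv L z x)) (a' x) := by
  refine (o.bdry_a' x).congr ?_
  filter_upwards [h.ae_eventually_nonreal] with k hk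
  filter_upwards [hk] with ε hε
  rw [h.regPart_eq hε.1]
  simp [hx]

theorem hasBdry_resolv_adjoint_L (h : WaveHyp T L A B)
    (o : WaveOps A B (discreteProj L) (resolv T) (regPart L) (singPart L) (discreteSpec L)
      a a' b b' W Z) {x : H} (hx : adjoint (discreteProj L) x = 0) :
    HasBdry (fun z => B (resolv L† z x)) (b' x) := by
  refine (o.bdry_b' x).congr ?_
  filter_upwards [h.ae_eventually_nonreal] with k hk
  filter_upwards [hk] with ε hε
  have h1 := resolv_adjoint h.dense_L (h.notMem_spec_of_nonreal hε.2).2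
  rw [starRingEnd_self_apply] at h1
  rw [h1]
  congr 1
  refine ext_inner_left ℂ fun v => ?_
  rw [inner_sharp, h.regPart_apply hε.2, inner_sub_left, adjoint_inner_right,
    ← adjoint_inner_right (discreteProj L), hx, inner_zero_right, sub_zero]

theorem hasBdry_resolv_adjoint_T (h : WaveHyp T L A B)
    (o : WaveOps A B (discreteProj L) (resolv T) (regPart L) (singPart L) (discreteSpec L)
      a a' b b' W Z) (x : H) : HasBdry (fun z => B (resolv T† z x)) (b x) :=
  (o.bdry_b x).congr_upper fun z hz => by rw [h.sharp_resolv hz.ne']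

theorem isDirectWaveOperator (h : WaveHyp T L A B)
    (o : WaveOps A B (discreteProj L) (resolv T) (regPart L) (singPart L) (discreteSpec L)
      a a' b b' W Z) : IsDirectWaveOperator T L A B W := by
  refine ⟨fun φ ψ hψ => ?_, fun φ ψ hψ => ?_⟩
  · rw [h.mem_continuousSubspace_adjoint_iff] at hψ
    have h1 := o.bdry_a φ
    have h2 := h.hasBdry_resolv_adjoint_L o hψ
    refine ⟨h1.hasUpperBoundaryValues, h2.hasUpperBoundaryValues, h2.integrable_inner h1, ?_⟩
    rw [h2.integral_inner h1, o.inner_W, inner_sub_right,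
      ← adjoint_inner_left (discreteProj L), hψ, inner_zero_left, sub_zero]
  · rw [h.mem_discreteSubspace_adjoint_iff] at hψ
    rw [← hψ, adjoint_inner_left, o.proj_W, inner_zero_right]

theorem isInverseWaveOperator (h : WaveHyp T L A B)
    (o : WaveOps A B (discreteProj L) (resolv T) (regPart L) (singPart L) (discreteSpec L)
      a a' b b' W Z) : IsInverseWaveOperator T L A B Z := by
  refine ⟨fun φ hφ ψ => ?_, fun φ hφ ψ => ?_⟩
  · rw [h.mem_continuousSubspace_iff] at hφ
    have h1 := h.hasBdry_resolv_L o hφ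
    have h2 := h.hasBdry_resolv_adjoint_T o ψ
    refine ⟨h1.hasUpperBoundaryValues, h2.hasUpperBoundaryValues, h2.integrable_inner h1, ?_⟩
    rw [h2.integral_inner h1, o.inner_Z, hφ, sub_zero]
  · rw [h.mem_discreteSubspace_iff] at hφ
    rw [← hφ, o.Z_proj, inner_zero_right]

end

theorem isDirectWaveOperator_unique (h : WaveHyp T L A B) {W W' : H →L[ℂ] H}
    (hW : IsDirectWaveOperator T L A B W) (hW' : IsDirectWaveOperator T L A B W') : W = W' := by
  ext φ
  refine ext_inner_left ℂ fun ψ => ?_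
  have h1 : ψ - adjoint (discreteProj L) ψ ∈ continuousSubspace L† := by
    rw [h.mem_continuousSubspace_adjoint_iff, map_sub, h.adjoint_proj_proj, sub_self]
  have h2 : adjoint (discreteProj L) ψ ∈ discreteSubspace L† := by
    rw [h.mem_discreteSubspace_adjoint_iff, h.adjoint_proj_proj]
  -- The two clauses prescribe the form on complementary subspaces, so splitting `ψ` by `P^*`
  -- determines `W`.
  rw [← sub_add_cancel ψ (adjoint (discreteProj L) ψ), inner_add_left, inner_add_left,
    hW.2 φ _ h2, hW'.2 φ _ h2, (hW.1 φ _ h1).2.2.2, (hW'.1 φ _ h1).2.2.2]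

theorem isInverseWaveOperator_unique (h : WaveHyp T L A B) {Z Z' : H →L[ℂ] H}
    (hZ : IsInverseWaveOperator T L A B Z) (hZ' : IsInverseWaveOperator T L A B Z') : Z = Z' := by
  ext φ
  refine ext_inner_left ℂ fun ψ => ?_
  have h1 : φ - discreteProj L φ ∈ continuousSubspace L := by
    rw [h.mem_continuousSubspace_iff, map_sub, h.proj_proj, sub_self]
  have h2 : discreteProj L φ ∈ discreteSubspace L := by
    rw [h.mem_discreteSubspace_iff, h.proj_proj]
  rw [← sub_add_cancel φ (discreteProj L φ), map_add, map_add, inner_add_right, inner_add_right,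
    hZ.2 _ h2 ψ, hZ'.2 _ h2 ψ, (hZ.1 _ h1 ψ).2.2.2, (hZ'.1 _ h1 ψ).2.2.2]

end WaveHyp

/-- The algebraic properties that the wave operators have: `W` maps `H` onto the complement of the
discrete subspace, `Z` inverts it, and they intertwine `T` and `L`. -/
structure Intertwines (T L : H →ₗ.[ℂ] H) (P W Z : H →L[ℂ] H) : Prop where
  proj_proj : ∀ x, P (P x) = P x
  Z_W : ∀ x, Z (W x) = x
  W_Z : ∀ x, W (Z x) = x - P x
  proj_W : ∀ x, P (W x) = 0
  Z_proj : ∀ x, Z (P x) = 0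
  resolv_proj : ∀ z ∉ spec L, ∀ x, resolv L z (P x) = P (resolv L z x)
  exists_resolv : ∃ w, w ∉ spec T ∧ w ∉ spec L ∧ ∀ x, W (resolv T w x) = resolv L w (W x)

/-! ### Similarity of `T` and `L_c`, including domains. -/

namespace Intertwines

variable {T L : H →ₗ.[ℂ] H} {P W Z : H →L[ℂ] H}

omit [CompleteSpace H] in
theorem mem_graph_W (h : Intertwines T L P W Z) {x y : H} (hxy : (x, y) ∈ T.graph) :
    (W x, W y) ∈ L.graph := by
  obtain ⟨w, hw, hw', hW⟩ := h.exists_resolv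
  have h1 := (isResolventAt_resolv hw).2 x y hxy
  have h2 := (isResolventAt_resolv hw').1 (W (y - w • x))
  rw [← hW, h1] at h2
  convert h2 using 2
  rw [map_sub, map_smul, sub_add_cancel]

omit [CompleteSpace H] in
theorem mem_graph_Z (h : Intertwines T L P W Z) {x y : H} (hxy : (x, y) ∈ L.graph) :
    (Z x, Z y) ∈ T.graph := by
  obtain ⟨w, hw, hw', hW⟩ := h.exists_resolv
  have h1 := (isResolventAt_resolv hw').2 x y hxy
  have h2 := (isResolventAt_resolv hw).1 (Z (y - w • x))
  -- Inserting `Z W = I` turns the relation for `W` into `R₀(w) Z = Z R_V(w)`; the `P` part is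
  -- annihilated by `Z`.
  have h3 : resolv T w (Z (y - w • x)) = Z x := by
    rw [← h.Z_W (resolv T w _), hW, h.W_Z, map_sub, h.resolv_proj w hw', map_sub, h.Z_proj,
      sub_zero, h1]
  rw [h3] at h2
  convert h2 using 2
  rw [map_sub, map_smul, sub_add_cancel]

omit [CompleteSpace H] in
theorem resolv_W (h : Intertwines T L P W Z) {z : ℂ} (hz : z ∉ spec T) (hz' : z ∉ spec L) :
    resolv L z ∘L W = W ∘L resolv T z := by
  ext x
  have h1 := h.mem_graph_W ((isResolventAt_resolv hz).1 x)
  have h2 := (isResolventAt_resolv hz').2 _ _ h1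
  rw [map_add, map_smul, add_sub_cancel_right] at h2
  exact h2

omit [CompleteSpace H] in
-- Mapping the graph point by `Z` and back by `W` gives `(x, y - P y)` in the same graph, so `y = y
-- - P y`.
theorem proj_eq_zero (h : Intertwines T L P W Z) {x y : H} (hxy : (x, y) ∈ L.graph)
    (hx : P x = 0) : P y = 0 := by
  have h1 := h.mem_graph_W (h.mem_graph_Z hxy)
  rw [h.W_Z, h.W_Z, hx, sub_zero] at h1
  have h2 := L.mem_graph_snd_inj hxy h1 rfl
  rw [h2, map_sub, h.proj_proj, sub_self]

omit [CompleteSpace H] in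
theorem domRestrict_eq (h : Intertwines T L P W Z) {K : Submodule ℂ H}
    (hK : ∀ x ∈ K, P x = 0) : L.domRestrict K = (conjugate W T Z).domRestrict K := by
  have key : ∀ x ∈ K, ∀ hx : Z x ∈ T.domain, (x, W (T ⟨Z x, hx⟩)) ∈ L.graph := by
    intro x hxK hx
    have h1 := h.mem_graph_W (mem_graph_of_mem (S := T) hx rfl)
    rwa [h.W_Z, hK x hxK, sub_zero] at h1
  refine LinearPMap.ext ?_ ?_
  · ext x
    rw [LinearPMap.domRestrict_domain, LinearPMap.domRestrict_domain]
    refine and_congr_right fun hxK => ⟨fun hx => ?_, fun hx => ?_⟩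
    · exact (exists_of_mem_graph (h.mem_graph_Z (mem_graph_of_mem (S := L) hx rfl))).1
    · exact (exists_of_mem_graph (key x hxK hx)).1
  · intro x hx hx'
    have h1 := key x hx'.1 hx'.2
    obtain ⟨h2, h3⟩ := exists_of_mem_graph h1
    exact h3

end Intertwines

end Stationary

/-! ### Convergence of the implicit Euler scheme for commuting contractions. -/

section EulerScheme

open Complex

variable {H : Type*} [NormedAddCommGroup H] [InnerProductSpace ℂ H]

theorem norm_pow_apply_le {X : H →L[ℂ] H} (hX : ∀ x, ‖X x‖ ≤ ‖x‖) (n : ℕ) (x : H) :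
    ‖(X ^ n) x‖ ≤ ‖x‖ := by
  induction n with
  | zero => simp
  | succ n ih => rw [pow_succ']; exact (hX _).trans ih

/-- Telescoping sum; commutation brings every difference `X - Y` next to the vector, and the
remaining factors are contractions. -/
theorem norm_pow_sub_pow_apply_le {X Y : H →L[ℂ] H} (hX : ∀ x, ‖X x‖ ≤ ‖x‖)
    (hY : ∀ x, ‖Y x‖ ≤ ‖x‖) (hXY : Commute X Y) (n : ℕ) (x : H) :
    ‖(X ^ n) x - (Y ^ n) x‖ ≤ n * ‖X x - Y x‖ := by
  induction n with
  | zero => simp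
  | succ n ih =>
    have h1 : (X ^ (n + 1)) x - (Y ^ (n + 1)) x =
        X ((X ^ n) x - (Y ^ n) x) + (Y ^ n) (X x - Y x) := by
      have h2 := congrArg (fun Z : H →L[ℂ] H => Z x) (hXY.pow_right n).eq
      simp only [mul_apply_eq_comp] at h2
      rw [pow_succ', pow_succ Y, map_sub, map_sub, mul_apply_eq_comp, mul_apply_eq_comp, h2]
      abel
    rw [h1]
    refine (norm_add_le _ _).trans ?_
    have h3 := (hX ((X ^ n) x - (Y ^ n) x)).trans ih
    have h4 := norm_pow_apply_le hY n (X x - Y x)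
    rw [Nat.cast_succ, add_one_mul]
    linarith

/-- A sequence of contractions that is a Cauchy sequence on a dense set converges strongly. -/
theorem exists_tendsto_of_dense [CompleteSpace H] {a : ℕ → H →L[ℂ] H} (ha : ∀ n x, ‖a n x‖ ≤ ‖x‖)
    {D : Set H} (hD : Dense D) (hc : ∀ x ∈ D, CauchySeq fun n => a n x) :
    ∃ U : H →L[ℂ] H, ∀ x, Tendsto (fun n => a n x) atTop (𝓝 (U x)) := by
  have h1 : ∀ x, ∃ y, Tendsto (fun n => a n x) atTop (𝓝 y) := fun x => by
    refine cauchySeq_tendsto_of_complete (Metric.cauchySeq_iff.2 fun ε hε => ?_)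
    obtain ⟨y, hy, hxy⟩ := hD.exists_dist_lt x (show 0 < ε / 3 by linarith)
    obtain ⟨N, hN⟩ := Metric.cauchySeq_iff.1 (hc y hy) (ε / 3) (by linarith)
    refine ⟨N, fun m hm n hn => ?_⟩
    have h2 : ∀ k, dist (a k x) (a k y) < ε / 3 := fun k => by
      rw [dist_eq_norm, ← map_sub]
      exact (ha k _).trans_lt (by rwa [← dist_eq_norm])
    have h3 := dist_triangle4_right (a m x) (a n x) (a m y) (a n y)
    have h4 := h2 m
    have h5 := h2 n
    have h6 := hN m hm n hn
    linarith
  choose f hf using h1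
  refine ⟨continuousLinearMapOfTendsto a (f := f) (tendsto_pi_nhds.2 hf), hf⟩

/-- A family of commuting contractions `V s` that behaves like `(1 - i s T)⁻¹` for an
operator `T` with graph `G`. -/
structure EulerFamily (G : H → H → Prop) (V : ℝ → H →L[ℂ] H) : Prop where
  norm_le : ∀ s x, ‖V s x‖ ≤ ‖x‖
  comm : ∀ s t, Commute (V s) (V t)
  eq : ∀ s x y, G x y → V s x = x + (I * s : ℂ) • V s y
  dense : Dense {x | ∃ y z, G x y ∧ G y z}

namespace EulerFamily

variable {G : H → H → Prop} {V : ℝ → H →L[ℂ] H} {x y z : H}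

theorem norm_I_mul (s : ℝ) : ‖(I * s : ℂ)‖ = |s| := by simp

theorem norm_pow_sub_le (h : EulerFamily G V) (s : ℝ) (hy : G y z) (m : ℕ) :
    ‖(V s ^ m) y - y‖ ≤ m * (|s| * ‖z‖) := by
  have h1 := norm_pow_sub_pow_apply_le (h.norm_le s) (Y := 1) (by simp) (Commute.one_right _) m y
  rw [one_pow] at h1
  refine h1.trans ?_
  gcongr
  rw [h.eq s y z hy, one_apply_eq_self, add_sub_cancel_left, norm_smul, norm_I_mul]
  gcongr
  exact h.norm_le s z

/-- First-order Taylor expansion of `m` steps on the domain of the square, with quadratic error in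
the total time `m |s|`. -/
theorem norm_pow_sub_sub_le (h : EulerFamily G V) (s : ℝ) (hx : G x y) (hy : G y z) (m : ℕ) :
    ‖(V s ^ m) x - x - (I * s * m : ℂ) • y‖ ≤ (m * |s|) ^ 2 * ‖z‖ := by
  induction m with
  | zero => simp
  | succ m ih =>
    have h1 : (V s ^ (m + 1)) x - x - (I * s * (m + 1 : ℕ) : ℂ) • y =
        ((V s ^ m) x - x - (I * s * m : ℂ) • y) + (I * s : ℂ) • ((V s ^ (m + 1)) y - y) := by
      rw [pow_succ, mul_apply_eq_comp, mul_apply_eq_comp, h.eq s x y hx, map_add, map_smul]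
      push_cast
      module
    rw [h1]
    refine (norm_add_le _ _).trans ?_
    rw [norm_smul, norm_I_mul]
    have h2 := mul_le_mul_of_nonneg_left (h.norm_pow_sub_le s hy (m + 1)) (abs_nonneg s)
    have h3 : (0 : ℝ) ≤ |s| ^ 2 * ‖z‖ := by positivity
    rw [Nat.cast_succ] at h2 ⊢
    nlinarith [mul_nonneg (Nat.cast_nonneg (α := ℝ) m) h3]

theorem norm_pow_le (h : EulerFamily G V) (s : ℝ) (n : ℕ) (x : H) : ‖(V s ^ n) x‖ ≤ ‖x‖ :=
  norm_pow_apply_le (h.norm_le s) n x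

/-- One step of length `t / n` and `m` steps of length `t / (m n)` both agree with `x + i (t / n) y`
up to `(t / n)² ‖z‖`. Repeating this `n` times gives the factor `n⁻¹`. -/
theorem norm_refine_le (h : EulerFamily G V) (t : ℝ) (hx : G x y) (hy : G y z) {m n : ℕ}
    (hm : m ≠ 0) (hn : n ≠ 0) :
    ‖(V (t / (m * n : ℕ)) ^ (m * n)) x - (V (t / n) ^ n) x‖ ≤ 2 * t ^ 2 * ‖z‖ * (n : ℝ)⁻¹ := by
  have hm0 : (m : ℝ) ≠ 0 := by exact_mod_cast hm
  have hn0 : (n : ℝ) ≠ 0 := by exact_mod_cast hn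
  rw [pow_mul]
  refine (norm_pow_sub_pow_apply_le (fun x => h.norm_pow_le _ m x) (h.norm_le _)
    ((h.comm _ _).pow_left m) n x).trans ?_
  have h1 := h.norm_pow_sub_sub_le (t / (m * n : ℕ)) hx hy m
  have h2 := h.norm_pow_sub_sub_le (t / n) hx hy 1
  have e1 : (I * (t / (m * n : ℕ) : ℝ) * m : ℂ) = I * (t / n : ℝ) := by
    have : (m : ℂ) ≠ 0 := by exact_mod_cast hm
    have : (n : ℂ) ≠ 0 := by exact_mod_cast hn
    push_cast
    field_simp
  have e2 : (m : ℝ) * |t / (m * n : ℕ)| = |t| / n := by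
    rw [abs_div, Nat.abs_cast]
    push_cast
    field_simp
  rw [e1, e2] at h1
  rw [pow_one, Nat.cast_one, mul_one, Nat.cast_one, one_mul, abs_div, Nat.abs_cast] at h2
  have h3 : ‖(V (t / (m * n : ℕ)) ^ m) x - V (t / n) x‖ ≤ 2 * ((|t| / n) ^ 2 * ‖z‖) := by
    have e3 : (V (t / (m * n : ℕ)) ^ m) x - V (t / n) x =
        ((V (t / (m * n : ℕ)) ^ m) x - x - (I * (t / n : ℝ) : ℂ) • y) -
        (V (t / n) x - x - (I * (t / n : ℝ) : ℂ) • y) := by abel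
    rw [e3]
    exact (norm_sub_le _ _).trans (by linarith)
  calc _ ≤ (n : ℝ) * (2 * ((|t| / n) ^ 2 * ‖z‖)) := by gcongr
    _ = _ := by
      rw [div_pow, sq_abs]
      field_simp

theorem exists_exp [CompleteSpace H] (h : EulerFamily G V) (t : ℝ) : ∃ U : H →L[ℂ] H,
    ∀ x, Tendsto (fun n : ℕ => (V (t / n) ^ n) x) atTop (𝓝 (U x)) := by
  refine exists_tendsto_of_dense (fun n x => h.norm_pow_le _ n x) h.dense ?_
  rintro x ⟨y, z, hx, hy⟩
  have h0 : Tendsto (fun n : ℕ => 2 * (2 * t ^ 2 * ‖z‖ * (n : ℝ)⁻¹)) atTop (𝓝 0) := by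
    simpa using (tendsto_inv_atTop_nhds_zero_nat (𝕜 := ℝ)).const_mul (2 * t ^ 2 * ‖z‖)
      |>.const_mul 2
  refine Metric.cauchySeq_iff'.2 fun ε hε => ?_
  obtain ⟨N, hN, hN0⟩ := ((h0.eventually_lt_const hε).and (eventually_ne_atTop 0)).exists
  refine ⟨N, fun n hn => ?_⟩
  have hn0 : n ≠ 0 := by omega
  -- The schemes with `n` and `N` steps are compared through their common refinement with `n N`
  -- steps.
  have h1 := h.norm_refine_le t hx hy hN0 hn0
  have h2 := h.norm_refine_le t hx hy hn0 hN0
  rw [mul_comm N n] at h1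
  have h3 : (n : ℝ)⁻¹ ≤ (N : ℝ)⁻¹ := by
    have : (0 : ℝ) < N := by exact_mod_cast Nat.pos_of_ne_zero hN0
    gcongr
  have h4 : 2 * t ^ 2 * ‖z‖ * (n : ℝ)⁻¹ ≤ 2 * t ^ 2 * ‖z‖ * (N : ℝ)⁻¹ := by gcongr
  have h5 := dist_triangle_left ((V (t / n) ^ n) x) ((V (t / N) ^ N) x)
    ((V (t / (n * N : ℕ)) ^ (n * N)) x)
  simp only [dist_eq_norm] at h5 ⊢
  linarith

theorem norm_exp_le (h : EulerFamily G V) {t : ℝ} {U : H →L[ℂ] H}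
    (hU : ∀ x, Tendsto (fun n : ℕ => (V (t / n) ^ n) x) atTop (𝓝 (U x))) (x : H) :
    ‖U x‖ ≤ ‖x‖ :=
  le_of_tendsto (hU x).norm (Eventually.of_forall fun _ => h.norm_pow_le _ _ x)

theorem exp_exp_neg (h : EulerFamily G V) {t : ℝ} {U U' : H →L[ℂ] H}
    (hU : ∀ x, Tendsto (fun n : ℕ => (V (t / n) ^ n) x) atTop (𝓝 (U x)))
    (hU' : ∀ x, Tendsto (fun n : ℕ => (V (-t / n) ^ n) x) atTop (𝓝 (U' x))) (x : H) :
    U (U' x) = x := by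
  have key : ∀ x ∈ {x | ∃ y z, G x y ∧ G y z}, U (U' x) = x := by
    rintro x ⟨y, z, hx, hy⟩
    have h1 : Tendsto (fun n : ℕ => (V (t / n) ^ n) ((V (-t / n) ^ n) x)) atTop
        (𝓝 (U (U' x))) := by
      have h2 : Tendsto (fun n : ℕ => (V (t / n) ^ n) ((V (-t / n) ^ n) x - U' x)) atTop (𝓝 0) := by
        have h3 : Tendsto (fun n : ℕ => ‖(V (-t / n) ^ n) x - U' x‖) atTop (𝓝 0) := by
          simpa using ((hU' x).sub_const (U' x)).norm
        exact squeeze_zero_norm (fun n => h.norm_pow_le _ _ _) h3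
      have h4 := h2.add (hU (U' x))
      simpa using h4
    refine tendsto_nhds_unique h1 ?_
    rw [tendsto_iff_norm_sub_tendsto_zero]
    have h0 : Tendsto (fun n : ℕ => t ^ 2 * ‖z‖ * (n : ℝ)⁻¹) atTop (𝓝 0) := by
      simpa using (tendsto_inv_atTop_nhds_zero_nat (𝕜 := ℝ)).const_mul (t ^ 2 * ‖z‖)
    refine squeeze_zero' (Eventually.of_forall fun _ => norm_nonneg _) ?_ h0
    filter_upwards [eventually_ne_atTop 0] with n hn
    have hn0 : (n : ℝ) ≠ 0 := by exact_mod_cast hn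
    have h5 : (V (t / n) ^ n) ((V (-t / n) ^ n) x) = ((V (t / n) * V (-t / n)) ^ n) x := by
      rw [(h.comm _ _).mul_pow]; rfl
    have hs : ∀ s : ℝ, ‖(V s * V (-s)) x - x‖ ≤ s ^ 2 * ‖z‖ := fun s => by
      have e1 := h.eq s x y hx
      have e2 := h.eq (-s) x y hx
      have e3 := h.eq (-s) y z hy
      -- Formally `(1 - isT)⁻¹ (1 + isT)⁻¹ - 1` is of second order in `s`, so `n` factors with `s =
      -- t / n` differ from the identity by order `1 / n`.
      have e4 : (V s * V (-s)) x - x = (I * s : ℂ) • V s ((I * s : ℂ) • V (-s) z) := by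
        have e5 : (I * s : ℂ) • V (-s) z = y - V (-s) y := by
          rw [e3]; push_cast; module
        rw [e5, mul_apply_eq_comp, e2, map_add, map_smul, e1, map_sub]
        push_cast
        module
      rw [e4, norm_smul, norm_I_mul, ← sq_abs, pow_two, mul_assoc]
      gcongr
      refine (h.norm_le _ _).trans ?_
      rw [norm_smul, norm_I_mul]
      gcongr
      exact h.norm_le _ _
    have h6 := norm_pow_sub_pow_apply_le (X := V (t / n) * V (-t / n)) (Y := 1)
      (fun x => (h.norm_le _ _).trans (h.norm_le _ _)) (by simp) (Commute.one_right _) n x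
    rw [h5]
    rw [one_pow] at h6
    refine h6.trans ?_
    have h7 := hs (t / n)
    rw [← neg_div] at h7
    calc _ ≤ (n : ℝ) * ((t / n) ^ 2 * ‖z‖) := by gcongr; exact h7
      _ = _ := by
        rw [div_pow]
        field_simp
  have hcont : Continuous fun x => U (U' x) := U.continuous.comp U'.continuous
  exact congrFun (hcont.ext_on h.dense continuous_id key) x

end EulerFamily

end EulerScheme

/-! ### Euler steps of a selfadjoint operator. -/

section SelfAdjoint

open Complex

variable {H : Type*} [NormedAddCommGroup H] [InnerProductSpace ℂ H]

theorem eulerStep_apply_sub {S : H →ₗ.[ℂ] H} {c : ℂ} (hc : c ≠ 0 → c⁻¹ ∉ spec S) {x y : H}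
    (hxy : (x, y) ∈ S.graph) : eulerStep S c (x - c • y) = x := by
  by_cases h0 : c = 0
  · simp [eulerStep, h0]
  · rw [eulerStep_eq h0 (hc h0)]
    have h1 := (isResolventAt_resolv (hc h0)).2 _ _ hxy
    rw [smul_apply, ← map_smul]
    rw [← h1]
    congr 1
    rw [smul_sub, smul_smul, neg_mul, inv_mul_cancel₀ h0, h1]
    module

theorem mem_graph_eulerStep {S : H →ₗ.[ℂ] H} {c : ℂ} (h0 : c ≠ 0) (hc : c⁻¹ ∉ spec S) (x : H) :
    (eulerStep S c x, c⁻¹ • (eulerStep S c x - x)) ∈ S.graph := by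
  rw [eulerStep_eq h0 hc]
  have h1 := S.graph.smul_mem (-c⁻¹) ((isResolventAt_resolv hc).1 x)
  convert h1 using 1
  rw [Prod.smul_mk, smul_apply]
  congr 1
  module

theorem eulerStep_commute {S : H →ₗ.[ℂ] H} {c d : ℂ} (hc : c ≠ 0 → c⁻¹ ∉ spec S)
    (hd : d ≠ 0 → d⁻¹ ∉ spec S) : Commute (eulerStep S c) (eulerStep S d) := by
  by_cases h0 : c = 0
  · rw [eulerStep, if_pos h0]; exact Commute.one_left _
  by_cases h1 : d = 0
  · rw [eulerStep.eq_1 S d, if_pos h1]; exact Commute.one_right _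
  rw [eulerStep_eq h0 (hc h0), eulerStep_eq h1 (hd h1)]
  have h2 : Commute (resolv S c⁻¹) (resolv S d⁻¹) :=
    (isResolventAt_resolv (hc h0)).comm (isResolventAt_resolv (hd h1))
  exact (h2.smul_left _).smul_right _

theorem eulerFamily_of_selfAdjoint [CompleteSpace H] {T : H →ₗ.[ℂ] H}
    (hT : Dense (T.domain : Set H)) (hsa : IsSelfAdjoint T) (hreal : ∀ z ∈ spec T, z.im = 0) :
    EulerFamily (fun x y => (x, y) ∈ T.graph) fun s => eulerStep T (I * s) := by
  have hns : ∀ s : ℝ, (I * s : ℂ) ≠ 0 → (I * s : ℂ)⁻¹ ∉ spec T := fun s hs h => by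
    have h1 := hreal _ h
    have hs' : s ≠ 0 := by
      rintro rfl
      simp at hs
    simp [Complex.inv_im, hs'] at h1
  have hadj : T† = T := hsa
  have hsymm : ∀ x y, (x, y) ∈ T.graph → inner ℂ y x = inner ℂ x y := fun x y hxy => by
    have hxy' := hxy
    rw [← hadj] at hxy'
    exact (mem_graph_adjoint_iff hT).1 hxy' x y hxy
  have hnorm : ∀ (s : ℝ) x, ‖eulerStep T (I * s) x‖ ≤ ‖x‖ := fun s x => by
    by_cases h0 : (I * s : ℂ) = 0
    · simp [eulerStep, h0]
    have h1 := mem_graph_eulerStep h0 (hns s h0) x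
    set u := eulerStep T (I * s) x
    set v := (I * s : ℂ)⁻¹ • (u - x) with hv
    have h2 : x = u - (I * s : ℂ) • v := by
      rw [hv, smul_smul, mul_inv_cancel₀ h0, one_smul, sub_sub_cancel]
    have h3 := hsymm u v h1
    have h4 : (inner ℂ u v).im = 0 := by
      have := inner_conj_symm (𝕜 := ℂ) u v
      rw [h3] at this
      exact Complex.conj_eq_iff_im.1 this
    -- With `v = T u` and `(T u, u)` real, the cross term in `‖u - i s v‖²` vanishes; this is
    -- contractivity.
    have h5 : ‖x‖ ^ 2 = ‖u‖ ^ 2 + ‖(I * s : ℂ) • v‖ ^ 2 := by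
      rw [h2, @norm_sub_sq ℂ, inner_smul_right]
      simp [h4]
    exact le_of_sq_le_sq (by nlinarith [sq_nonneg ‖(I * s : ℂ) • v‖]) (norm_nonneg x)
  have heq : ∀ (s : ℝ) x y, (x, y) ∈ T.graph →
      eulerStep T (I * s) x = x + (I * s : ℂ) • eulerStep T (I * s) y := fun s x y hxy => by
    have h1 := eulerStep_apply_sub (hns s) hxy
    rw [map_sub, map_smul] at h1
    rw [← sub_eq_iff_eq_add, h1]
  refine ⟨hnorm, fun s t => eulerStep_commute (hns s) (hns t), heq, ?_⟩
  have hI0 : (I * (1 : ℝ) : ℂ) ≠ 0 := by simp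
  set X := eulerStep T (I * (1 : ℝ)) with hX
  have hg := mem_graph_eulerStep hI0 (hns 1 hI0)
  -- The range of `(1 - iT)⁻¹` contains the dense domain, so the range of its square, which lies in
  -- the domain of `T²`, is dense too.
  have hr : DenseRange X := by
    refine hT.mono ?_
    intro x hx
    exact ⟨_, eulerStep_apply_sub (hns 1) (mem_graph_of_mem hx rfl)⟩
  have hr2 : DenseRange (X ∘ X) := hr.comp hr X.continuous
  refine hr2.mono ?_
  rintro _ ⟨x, rfl⟩
  exact ⟨_, _, hg (X x), T.graph.smul_mem _ (T.graph.sub_mem (hg (X x)) (hg x))⟩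

end SelfAdjoint

/-! ### Compressed multipliers on the Hardy space and their decay. -/

section Decay

open Metric Complex ContinuousLinearMap

variable {E : Type*} [NormedAddCommGroup E] [InnerProductSpace ℂ E] [CompleteSpace E]

theorem starProjection_of_mem {f : Lp E 2 (volume : Measure ℝ)} (hf : f ∈ hardySpace E) :
    (hardySpace E).starProjection f = f := Submodule.starProjection_eq_self_iff.2 hf

theorem starProjection_kern_lower {w : ℂ} (hw : w.im < 0) (u : E) :
    (hardySpace E).starProjection (kern w u) = 0 := by
  rw [Submodule.starProjection_apply_eq_zero_iff, Submodule.mem_orthogonal']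
  exact fun f hf => inner_kern_lower_of_mem hf hw u

omit [CompleteSpace E] in
-- Partial fractions. The kernel at `conj v` is killed by the projection onto the Hardy space, so
-- upper kernels become eigenvectors of the compression.
theorem mulInv_kern {w v : ℂ} (hw : 0 < w.im) (hv : 0 < v.im) (u : E) :
    mulInv v (kern w u) = (v - starRingEnd ℂ w)⁻¹ • (kern (starRingEnd ℂ v) u - kern w u) := by
  have hv' : (starRingEnd ℂ v).im ≠ 0 := by simpa using hv.ne'
  refine Lp.ext ?_
  filter_upwards [coeFn_mulInv hv.ne' (kern w u), coeFn_kern hw.ne' u, coeFn_kern hv' u,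
    Lp.coeFn_smul (v - starRingEnd ℂ w)⁻¹ (kern (starRingEnd ℂ v) u - kern w u),
    Lp.coeFn_sub (kern (starRingEnd ℂ v) u) (kern w u)] with k h1 h2 h3 h4 h5
  rw [h1, h4, Pi.smul_apply, h5, Pi.sub_apply, h2, h3, starRingEnd_self_apply, ← sub_smul,
    smul_smul, smul_smul]
  congr 1
  have n1 : (k : ℂ) - v ≠ 0 := ofReal_sub_ne_zero k hv.ne'
  have n2 : (k : ℂ) - starRingEnd ℂ w ≠ 0 := ofReal_sub_ne_zero k (by simpa using hw.ne')
  have n3 : v - starRingEnd ℂ w ≠ 0 := fun h => by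
    have := congrArg Complex.im h
    simp at this
    linarith
  rw [inv_sub_inv n1 n2]
  field_simp
  ring

variable (E) in
/-- The compression to the Hardy space of the multiplication by `(1 + i s k)⁻¹`. -/
noncomputable def compress (s : ℝ) : Lp E 2 (volume : Measure ℝ) →L[ℂ] Lp E 2 (volume : Measure ℝ) :=
  (I * s : ℂ)⁻¹ • ((hardySpace E).starProjection ∘L mulInv (I / s))

theorem norm_compress_le {s : ℝ} (hs : 0 < s) (f : Lp E 2 (volume : Measure ℝ)) :
    ‖compress E s f‖ ≤ ‖f‖ := by
  have him : (I / s : ℂ).im = s⁻¹ := by simp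
  rw [compress, smul_apply, norm_smul, comp_apply]
  have h1 := norm_mulInv_le (w := I / s) (by rw [him]; positivity) f
  rw [him, abs_of_pos (by positivity), inv_inv] at h1
  have h2 := (Submodule.norm_starProjection_apply_le (hardySpace E) (mulInv (I / s) f)).trans h1
  calc _ ≤ ‖(I * s : ℂ)⁻¹‖ * (s * ‖f‖) := by gcongr
    _ = _ := by
      rw [norm_inv, norm_mul, norm_I, one_mul, norm_real, Real.norm_of_nonneg hs.le]
      field_simp

theorem norm_compress_pow_le {s : ℝ} (hs : 0 < s) (n : ℕ) (f : Lp E 2 (volume : Measure ℝ)) :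
    ‖(compress E s ^ n) f‖ ≤ ‖f‖ := by
  induction n with
  | zero => simp
  | succ n ih =>
    rw [pow_succ', mul_apply_eq_comp]
    exact (norm_compress_le hs _).trans ih

/-- The eigenvalue is `(1 + i s w̄)⁻¹`, and the real part of `1 + i s w̄` is `1 + s Im w`.
Bernoulli's inequality makes the bound for the `n`-th power with `s = t / n` independent of `n`. -/
theorem norm_compress_pow_kern_le {t : ℝ} (ht : 0 < t) {n : ℕ} (hn : n ≠ 0) {w : ℂ} (hw : 0 < w.im)
    (u : E) : ‖(compress E (t / n) ^ n) (kern w u)‖ ≤ (1 + t * w.im)⁻¹ * ‖kern w u‖ := by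
  have hn0 : (0 : ℝ) < n := by exact_mod_cast Nat.pos_of_ne_zero hn
  set s := t / n with hs
  have hs0 : 0 < s := by positivity
  have hI : (0 : ℝ) < (I / s : ℂ).im := by simp; positivity
  set c : ℂ := (I * s : ℂ)⁻¹ * -(I / s - starRingEnd ℂ w)⁻¹ with hc
  have h1 : compress E s (kern w u) = c • kern w u := by
    rw [compress, smul_apply, comp_apply, mulInv_kern hw hI, map_smul, map_sub,
      starProjection_kern_lower (by rw [conj_im]; linarith), starProjection_of_mem
      (kern_mem_hardySpace hw u), zero_sub, smul_neg, ← neg_smul, smul_smul]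
  have h2 : ∀ m : ℕ, (compress E s ^ m) (kern w u) = c ^ m • kern w u := fun m => by
    induction m with
    | zero => simp
    | succ m ih => rw [pow_succ, mul_apply_eq_comp, h1, map_smul, ih, smul_smul, pow_succ']
  have h3 : ‖c‖ ≤ (1 + s * w.im)⁻¹ := by
    have h4 : c = (-((I * s) * (I / s - starRingEnd ℂ w)))⁻¹ := by
      rw [hc, mul_neg, ← mul_inv, ← inv_neg]
    rw [h4, norm_inv]
    have hy : 0 < 1 + s * w.im := by positivity
    gcongr
    have h5 : (-((I * s) * (I / s - starRingEnd ℂ w))).re = 1 + s * w.im := by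
      have : (s : ℂ) ≠ 0 := by exact_mod_cast hs0.ne'
      have h6 : -((I * s) * (I / s - starRingEnd ℂ w)) = 1 + I * s * starRingEnd ℂ w := by
        rw [mul_sub, show I * s * (I / s) = I * I by field_simp, I_mul_I]
        ring
      rw [h6]
      simp
    rw [← h5]
    exact re_le_norm _
  rw [h2, norm_smul, norm_pow]
  gcongr
  calc ‖c‖ ^ n ≤ ((1 + s * w.im)⁻¹) ^ n := by gcongr
    _ = ((1 + s * w.im) ^ n)⁻¹ := inv_pow _ _
    _ ≤ _ := by
      have h7 := one_add_mul_le_pow (a := s * w.im) (by nlinarith [mul_pos hs0 hw]) n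
      have h8 : (n : ℝ) * (s * w.im) = t * w.im := by
        rw [hs]; field_simp
      rw [h8] at h7
      have : 0 < 1 + t * w.im := by positivity
      gcongr

/-- Density of the span of the kernels and contractivity. Uniformity in `n` allows the later limit
`n → ∞` at fixed `t`. -/
theorem eventually_norm_compress_pow_le {f : Lp E 2 (volume : Measure ℝ)} (hf : f ∈ hardySpace E)
    {ε : ℝ} (hε : 0 < ε) : ∀ᶠ t : ℝ in atTop, ∀ n : ℕ, n ≠ 0 →
      ‖(compress E (t / n) ^ n) f‖ ≤ ε := by
  have hspan : ∀ f ∈ Submodule.span ℂ {g | ∃ w : ℂ, 0 < w.im ∧ ∃ u : E, g = kern w u},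
      ∀ ε : ℝ, 0 < ε → ∀ᶠ t : ℝ in atTop, ∀ n : ℕ, n ≠ 0 →
        ‖(compress E (t / n) ^ n) f‖ ≤ ε := by
    intro f hf
    induction hf using Submodule.span_induction with
    | mem f hf =>
      obtain ⟨w, hw, u, rfl⟩ := hf
      intro ε hε
      have h1 : Tendsto (fun t : ℝ => (1 + t * w.im)⁻¹ * ‖kern w u‖) atTop (𝓝 0) := by
        have h2 : Tendsto (fun t : ℝ => 1 + t * w.im) atTop atTop :=
          tendsto_atTop_add_const_left _ _ (tendsto_id.atTop_mul_const hw)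
        simpa using h2.inv_tendsto_atTop.mul_const ‖kern w u‖
      filter_upwards [h1.eventually_le_const hε, eventually_gt_atTop 0] with t h3 ht n hn
      exact (norm_compress_pow_kern_le ht hn hw u).trans h3
    | zero =>
      intro ε hε
      refine Eventually.of_forall fun t n _ => ?_
      rw [map_zero, norm_zero]
      exact hε.le
    | add f g _ _ hf hg =>
      intro ε hε
      filter_upwards [hf (ε / 2) (half_pos hε), hg (ε / 2) (half_pos hε)] with t h1 h2 n hn
      rw [map_add]
      refine (norm_add_le _ _).trans ?_
      have := h1 n hn
      have := h2 n hn
      linarith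
    | smul c f _ hf =>
      intro ε hε
      have hc : 0 < ‖c‖ + 1 := by positivity
      filter_upwards [hf (ε / (‖c‖ + 1)) (by positivity)] with t h1 n hn
      rw [map_smul, norm_smul]
      calc _ ≤ (‖c‖ + 1) * (ε / (‖c‖ + 1)) := by
            gcongr
            · linarith
            · exact h1 n hn
        _ = ε := by field_simp
  obtain ⟨g, hg, hfg⟩ := Metric.mem_closure_iff.1 hf (ε / 2) (half_pos hε)
  filter_upwards [hspan g hg (ε / 2) (half_pos hε), eventually_gt_atTop 0] with t h1 ht n hn
  have hn0 : (0 : ℝ) < n := by exact_mod_cast Nat.pos_of_ne_zero hn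
  have h2 := norm_compress_pow_le (E := E) (show 0 < t / n by positivity) n (f - g)
  rw [map_sub, ← dist_eq_norm] at h2
  have h3 := h1 n hn
  have h4 := norm_le_norm_add_norm_sub' ((compress E (t / n) ^ n) f) ((compress E (t / n) ^ n) g)
  rw [dist_eq_norm] at h2 hfg
  linarith

end Decay

/-! ### Decay along the unperturbed evolution. -/

namespace WaveHyp

open Metric Complex ContinuousLinearMap

variable {H : Type*} [NormedAddCommGroup H] [InnerProductSpace ℂ H] [CompleteSpace H]
variable {T L : H →ₗ.[ℂ] H} {A B : H →L[ℂ] H} {z w : ℂ}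
  {a a' b b' : H →L[ℂ] Lp H 2 (volume : Measure ℝ)} {W Z : H →L[ℂ] H} {U : ℝ → H →L[ℂ] H}

/-- For `c = -is` the Euler step is `(is)⁻¹ R₀(i / s)`. Projecting `a_R` onto the Hardy space
removes the lower kernel. -/
theorem compress_a (h : WaveHyp T L A B)
    (o : WaveOps A B (discreteProj L) (resolv T) (regPart L) (singPart L) (discreteSpec L)
      a a' b b' W Z) {s : ℝ} (hs : 0 < s) (x : H) :
    a (eulerStep T (I * (-s : ℝ)) x) = compress H s (a x) := by
  have hI : (0 : ℝ) < (I / s : ℂ).im := by simp; positivity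
  have hs0 : (s : ℂ) ≠ 0 := by exact_mod_cast hs.ne'
  have hc : (I * (-s : ℝ) : ℂ) ≠ 0 := by simpa using hs.ne'
  have hinv : (I * (-s : ℝ) : ℂ)⁻¹ = I / s := by
    refine inv_eq_of_mul_eq_one_right ?_
    rw [show (I * (-s : ℝ) : ℂ) * (I / s) = -(I * I) by push_cast; field_simp, I_mul_I, neg_neg]
  have h1 : eulerStep T (I * (-s : ℝ)) = (I * s : ℂ)⁻¹ • resolv T (I / s) := by
    rw [eulerStep_eq hc (by rw [hinv]; exact h.notMem_spec_T hI.ne'), hinv]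
    congr 1
    rw [← hinv, ← inv_neg]
    push_cast
    ring_nf
  have h2 := congrArg (hardySpace H).starProjection (o.a_R hI.ne' x)
  rw [starProjection_of_mem ((o.hardy_R _).mem_hardySpace (o.bdry_a _)), map_sub,
    starProjection_kern_lower (by rw [conj_im]; linarith), sub_zero] at h2
  rw [h1, smul_apply, map_smul, h2, compress, smul_apply, comp_apply]

theorem tendsto_a_exp (h : WaveHyp T L A B)
    (o : WaveOps A B (discreteProj L) (resolv T) (regPart L) (singPart L) (discreteSpec L)
      a a' b b' W Z)
    (hU : ∀ t x, Tendsto (fun n : ℕ => (eulerStep T (I * (t / n : ℝ)) ^ n) x) atTop (𝓝 (U t x)))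
    (x : H) : Tendsto (fun t => a (U (-t) x)) atTop (𝓝 0) := by
  have h1 : ∀ s : ℝ, 0 < s → ∀ n : ℕ, ∀ x, a ((eulerStep T (I * (-s : ℝ)) ^ n) x) =
      (compress H s ^ n) (a x) := fun s hs n => by
    induction n with
    | zero => simp
    | succ n ih => intro x; rw [pow_succ, mul_apply_eq_comp, ih, h.compress_a o hs]; rfl
  refine Metric.tendsto_nhds.2 fun ε hε => ?_
  filter_upwards [eventually_norm_compress_pow_le
    ((o.hardy_R x).mem_hardySpace (o.bdry_a x)) (half_pos hε), eventually_gt_atTop 0] with t h2 ht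
  rw [dist_zero_right]
  refine lt_of_le_of_lt ?_ (half_lt_self hε)
  refine le_of_tendsto (((a.continuous.tendsto _).comp (hU (-t) x)).norm) ?_
  filter_upwards [eventually_ne_atTop 0] with n hn
  have hn0 : (0 : ℝ) < n := by exact_mod_cast Nat.pos_of_ne_zero hn
  have h3 := h1 (t / n) (by positivity) n x
  rw [Function.comp_apply, neg_div, h3]
  exact h2 n hn

theorem resolv_exp (h : WaveHyp T L A B)
    (hU : ∀ t x, Tendsto (fun n : ℕ => (eulerStep T (I * (t / n : ℝ)) ^ n) x) atTop (𝓝 (U t x)))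
    (hz : z ∉ spec T) (t : ℝ) (x : H) : resolv T z (U t x) = U t (resolv T z x) := by
  refine tendsto_nhds_unique (((resolv T z).continuous.tendsto _).comp (hU t x)) ?_
  refine (hU t (resolv T z x)).congr fun n => ?_
  have h1 : Commute (eulerStep T (I * (t / n : ℝ))) (resolv T z) := by
    by_cases h0 : (I * (t / n : ℝ) : ℂ) = 0
    · rw [eulerStep, if_pos h0]; exact Commute.one_left _
    · have h2 : (I * (t / n : ℝ) : ℂ)⁻¹ ∉ spec T := fun h' => by
        have h3 := h.real _ h'
        have h4 : (t / n : ℝ) ≠ 0 := fun h5 => h0 (by rw [h5]; simp)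
        rw [Complex.inv_im, neg_div, neg_eq_zero, div_eq_zero_iff, normSq_eq_zero] at h3
        rcases h3 with h3 | h3
        · rw [mul_im, ofReal_re, ofReal_im, I_re, I_im] at h3
          exact h4 (by linarith)
        · exact h0 h3
      rw [eulerStep_eq h0 h2]
      have h3 : Commute (resolv T (I * (t / n : ℝ))⁻¹) (resolv T z) :=
        (isResolventAt_resolv h2).comm (isResolventAt_resolv hz)
      exact h3.smul_left _
  exact congrArg (fun X : H →L[ℂ] H => X x) (h1.pow_left n).eq

/-- At `z = i` the value `A R₀(i) y` is a bounded operator applied to `a y`, so `tendsto_a_exp`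
gives norm convergence. The resolvent identity transfers it to every `z` off `spec T`. -/
theorem tendsto_A_resolv_exp (h : WaveHyp T L A B)
    (o : WaveOps A B (discreteProj L) (resolv T) (regPart L) (singPart L) (discreteSpec L)
      a a' b b' W Z)
    (hU : ∀ t x, Tendsto (fun n : ℕ => (eulerStep T (I * (t / n : ℝ)) ^ n) x) atTop (𝓝 (U t x)))
    (hz : z ∉ spec T) (x : H) : Tendsto (fun t => A (resolv T z (U (-t) x))) atTop (𝓝 0) := by
  have hI : (0 : ℝ) < I.im := by simp
  -- `K` sends `u` to the kernel at `i`; its adjoint expresses the reproducing formula as an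
  -- operator identity rather than a weak one.
  obtain ⟨K, hK⟩ := exists_bdry_clm (K := H)
    (X := fun z => (z - starRingEnd ℂ I)⁻¹ • (1 : H →L[ℂ] H)) fun u => isHardy_kern hI u
  have hK' : ∀ u, K u = kern I u := fun u => (hK u).unique (hasBdry_kern hI.ne' u)
  have h1 : ∀ y, A (resolv T I y) = (2 * Real.pi * I : ℂ)⁻¹ • adjoint K (a y) := fun y => by
    refine ext_inner_left ℂ fun u => ?_
    rw [inner_smul_right, adjoint_inner_right, hK', o.inner_kern_a hI,
      inv_mul_cancel_left₀ two_pi_I_ne_zero]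
  have h2 : ∀ x, Tendsto (fun t => A (resolv T I (U (-t) x))) atTop (𝓝 0) := fun x => by
    simp_rw [h1]
    have := (((adjoint K).continuous.tendsto 0).comp (h.tendsto_a_exp o hU x)).const_smul
      (2 * Real.pi * I : ℂ)⁻¹
    simpa using this
  have h3 : ∀ y, resolv T z y = resolv T I y + (z - I) • resolv T I (resolv T z y) := fun y => by
    have h4 := resolv_sub hz (h.notMem_spec_T hI.ne')
    rw [(isResolventAt_resolv hz).comm (isResolventAt_resolv (h.notMem_spec_T hI.ne')),
      sub_eq_iff_eq_add'] at h4
    exact congrArg (fun X : H →L[ℂ] H => X y) h4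
  have h5 : ∀ t, A (resolv T z (U (-t) x)) = A (resolv T I (U (-t) x)) +
      (z - I) • A (resolv T I (U (-t) (resolv T z x))) := fun t => by
    rw [h3, map_add, map_smul, h.resolv_exp hU hz]
  simp_rw [h5]
  simpa using (h2 x).add ((h2 (resolv T z x)).const_smul (z - I))

/-- The discrete points are regular for `T`, so `R₀` integrates to zero around them and the Riesz
projection becomes a contour integral of `R_V B^* A R₀`. The previous lemma makes the integrand tend
to zero, and dominated convergence applies. -/
theorem tendsto_discreteProj_exp (h : WaveHyp T L A B)
    (o : WaveOps A B (discreteProj L) (resolv T) (regPart L) (singPart L) (discreteSpec L)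
      a a' b b' W Z)
    (hU : ∀ t x, Tendsto (fun n : ℕ => (eulerStep T (I * (t / n : ℝ)) ^ n) x) atTop (𝓝 (U t x)))
    (hU1 : ∀ t x, ‖U t x‖ ≤ ‖x‖) (x : H) :
    Tendsto (fun t => discreteProj L (U (-t) x)) atTop (𝓝 0) := by
  simp_rw [discreteProj_eq_sum h.finite, sum_apply]
  rw [← Finset.sum_const_zero (s := h.finite.toFinset)]
  refine tendsto_finsetSum _ fun μ hμ => ?_
  rw [Set.Finite.mem_toFinset] at hμ
  obtain ⟨r, hr⟩ := hμ.1
  have hT : ∀ ζ ∈ closedBall μ r, ζ ∉ spec T := fun ζ hζ => by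
    by_cases hζμ : ζ = μ
    · rw [hζμ]; exact h.notMem_spec_T_of_mem hμ
    · intro h'
      rw [← h.spec_diff] at h'
      exact hr.notMem hζ hζμ h'.1
  have hS : ∀ ζ ∈ sphere μ r, ζ ∉ spec L := fun ζ hζ => hr.notMem_of_mem_sphere hζ
  have hTc : ContinuousOn (resolv T) (sphere μ r) :=
    continuousOn_resolv fun ζ hζ => hT ζ (sphere_subset_closedBall hζ)
  have hLc : ContinuousOn (resolv L) (sphere μ r) := continuousOn_resolv hS
  have hform : ∀ v, rieszProj L μ v = (2 * (Real.pi : ℂ) * I)⁻¹ •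
      ∮ ζ in C(μ, r), resolv L ζ (adjoint B (A (resolv T ζ v))) := fun v => by
    have e1 := circleIntegral_clm_comp (ContinuousLinearMap.apply ℂ H v) hr.circleIntegrable
    have e2 : (∮ ζ in C(μ, r), resolv T ζ v) = 0 := by
      refine DiffContOnCl.circleIntegral_eq_zero hr.1.le ?_
      refine DifferentiableOn.diffContOnCl_ball (U := (spec T)ᶜ) (fun ζ hζ => ?_) hT
      exact ((differentiableAt_resolv hζ).clm_apply
        (differentiableAt_const v)).differentiableWithinAt
    have e3 : (∮ ζ in C(μ, r), resolv L ζ (adjoint B (A (resolv T ζ v)))) =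
        (∮ ζ in C(μ, r), resolv T ζ v) - ∮ ζ in C(μ, r), resolv L ζ v := by
      rw [← circleIntegral.integral_sub
        ((hTc.clm_apply continuousOn_const).circleIntegrable hr.1.le)
        ((hLc.clm_apply continuousOn_const).circleIntegrable hr.1.le)]
      exact circleIntegral.integral_congr hr.1.le fun ζ hζ =>
        h.sub_left (hT ζ (sphere_subset_closedBall hζ)) (hS ζ hζ) v
    simp only [apply_apply] at e1
    rw [rieszProj_eq hr, e3, e2, zero_sub, e1, smul_neg]
    rfl
  simp_rw [hform]
  have h0 : 𝓝 (0 : H) = 𝓝 ((2 * (Real.pi : ℂ) * I)⁻¹ • (0 : H)) := by rw [smul_zero]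
  rw [h0]
  refine Tendsto.const_smul ?_ _
  obtain ⟨M, hM⟩ := ((isCompact_sphere μ r).image_of_continuousOn hLc).isBounded.exists_norm_le
  obtain ⟨N, hN⟩ := ((isCompact_sphere μ r).image_of_continuousOn hTc).isBounded.exists_norm_le
  have hmem : ∀ θ, circleMap μ r θ ∈ sphere μ r := fun θ => circleMap_mem_sphere μ hr.1.le θ
  have hlim := intervalIntegral.tendsto_integral_filter_of_dominated_convergence
    (μ := volume) (a := 0) (b := 2 * Real.pi) (l := atTop)
    (F := fun (t : ℝ) θ => deriv (circleMap μ r) θ • resolv L (circleMap μ r θ)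
      (adjoint B (A (resolv T (circleMap μ r θ) (U (-t) x))))) (f := fun _ => (0 : H))
    (fun _ => r * (M * (‖adjoint B‖ * (‖A‖ * (N * ‖x‖))))) ?_ ?_ ?_ ?_
  · simpa [circleIntegral] using hlim
  · refine Eventually.of_forall fun t => Continuous.aestronglyMeasurable ?_
    have c1 : Continuous fun θ => resolv L (circleMap μ r θ) :=
      hLc.comp_continuous (continuous_circleMap μ r) hmem
    have c2 : Continuous fun θ => resolv T (circleMap μ r θ) :=
      hTc.comp_continuous (continuous_circleMap μ r) hmem
    have c3 : Continuous fun θ => deriv (circleMap μ r) θ := by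
      simp_rw [deriv_circleMap]
      fun_prop
    exact c3.smul (c1.clm_apply ((adjoint B).continuous.comp
      (A.continuous.comp (c2.clm_apply continuous_const))))
  · refine Eventually.of_forall fun t => ae_of_all _ fun θ _ => ?_
    rw [norm_smul]
    have e1 : ‖deriv (circleMap μ r) θ‖ = r := by
      simp [deriv_circleMap, abs_of_pos hr.1]
    rw [e1]
    have := hr.1.le
    gcongr
    refine (le_opNorm _ _).trans ?_
    have hMθ := hM _ (Set.mem_image_of_mem _ (hmem θ))
    have hNθ := hN _ (Set.mem_image_of_mem _ (hmem θ))
    have hM0 := (norm_nonneg _).trans hMθ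
    gcongr
    refine (le_opNorm _ _).trans ?_
    gcongr
    refine (le_opNorm _ _).trans ?_
    gcongr
    refine (le_opNorm _ _).trans ?_
    have hN0 := (norm_nonneg _).trans hNθ
    gcongr
    exact hU1 _ _
  · exact intervalIntegrable_const
  · refine ae_of_all _ fun θ _ => ?_
    have e1 := h.tendsto_A_resolv_exp o hU (hT _ (sphere_subset_closedBall (hmem θ))) x
    have e2 := (((resolv L (circleMap μ r θ) ∘L adjoint B).continuous.tendsto 0).comp e1).const_smul
      (deriv (circleMap μ r) θ)
    simpa using e2

end WaveHyp

/-! ### The Euler scheme for a bounded generator. -/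

section BanachAlgebra

variable {𝔸 : Type*} [NormedRing 𝔸] [NormedAlgebra ℂ 𝔸] [CompleteSpace 𝔸]

omit [NormedAlgebra ℂ 𝔸] [CompleteSpace 𝔸] in
theorem norm_one_add_pow_sub_one_le (e : 𝔸) (n : ℕ) :
    ‖(1 + e) ^ n - 1‖ ≤ (1 + ‖e‖) ^ n - 1 := by
  induction n with
  | zero => simp
  | succ n ih =>
    have h1 : (1 + e) ^ (n + 1) - 1 = ((1 + e) ^ n - 1) + ((1 + e) ^ n - 1) * e + e := by
      rw [pow_succ]; noncomm_ring
    have h2 : ‖((1 + e) ^ n - 1) * e‖ ≤ ((1 + ‖e‖) ^ n - 1) * ‖e‖ :=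
      (norm_mul_le _ _).trans (by gcongr)
    have h3 := norm_add₃_le (a := (1 + e) ^ n - 1) (b := ((1 + e) ^ n - 1) * e) (c := e)
    rw [h1, pow_succ]
    linarith

omit [NormedAlgebra ℂ 𝔸] [CompleteSpace 𝔸] in
-- The error is dominated by `exp (n ‖e n‖) - 1`.
theorem tendsto_one_add_pow {e : ℕ → 𝔸} (he : Tendsto (fun n : ℕ => (n : ℝ) * ‖e n‖) atTop (𝓝 0)) :
    Tendsto (fun n => (1 + e n) ^ n) atTop (𝓝 1) := by
  rw [tendsto_iff_norm_sub_tendsto_zero]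
  have h1 : Tendsto (fun n : ℕ => Real.exp ((n : ℝ) * ‖e n‖) - 1) atTop (𝓝 0) := by
    simpa using ((Real.continuous_exp.tendsto 0).comp he).sub_const 1
  refine squeeze_zero (fun _ => norm_nonneg _) (fun n => ?_) h1
  refine (norm_one_add_pow_sub_one_le _ _).trans (sub_le_sub_right ?_ _)
  rw [Real.exp_nat_mul]
  gcongr
  rw [add_comm]
  exact Real.add_one_le_exp _

/-- The implicit Euler scheme for the exponential function of a Banach algebra. -/
theorem tendsto_pow_of_mul_one_sub {x : 𝔸} {b : ℕ → 𝔸}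
    (hb : ∀ᶠ n : ℕ in atTop, b n * (1 - (n : ℂ)⁻¹ • x) = 1) :
    Tendsto (fun n => b n ^ n) atTop (𝓝 (NormedSpace.exp x)) := by
  -- The factor `g s = (1 - s x) exp (s x)` is `1 + o(s)`, so `g (1/n) ^ n → 1`. Since `b n ^ n * g
  -- (1/n) ^ n = exp x`, a left inverse of `1 - x / n` suffices.
  let g : ℂ → 𝔸 := fun s => (1 - s • x) * NormedSpace.exp (s • x)
  have hg : HasDerivAt g 0 0 := by
    have h1 : HasDerivAt (fun s : ℂ => 1 - s • x) (-((1 : ℂ) • x)) 0 :=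
      ((hasDerivAt_id (0 : ℂ)).smul_const x).const_sub 1
    have h2 := hasDerivAt_exp_smul_const x (0 : ℂ)
    have h3 := h1.mul h2
    have h4 : HasDerivAt g _ 0 := h3
    simpa using h4
  have hg0 : g 0 = 1 := by simp [g]
  have hne : Tendsto (fun n : ℕ => (n : ℂ)⁻¹) atTop (𝓝[≠] 0) := by
    rw [tendsto_nhdsWithin_iff]
    refine ⟨tendsto_inv_atTop_nhds_zero_nat, ?_⟩
    filter_upwards [eventually_ne_atTop 0] with n hn
    simpa using hn
  have h4 : Tendsto (fun n : ℕ => (n : ℝ) * ‖g (n : ℂ)⁻¹ - 1‖) atTop (𝓝 0) := by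
    have h5 := ((hasDerivAt_iff_tendsto_slope.1 hg).comp hne).norm
    rw [norm_zero] at h5
    refine h5.congr fun n => ?_
    rw [Function.comp_apply, slope_def_module, hg0, norm_smul, sub_zero, inv_inv]
    simp
  have h6 : Tendsto (fun n : ℕ => g (n : ℂ)⁻¹ ^ n) atTop (𝓝 1) := by
    have := tendsto_one_add_pow h4
    simpa using this
  have h7 : Tendsto (fun n : ℕ => Ring.inverse (g (n : ℂ)⁻¹ ^ n)) atTop (𝓝 1) := by
    have := (NormedRing.inverse_continuousAt (1 : 𝔸ˣ)).tendsto.comp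
      (by rw [Units.val_one]; exact h6)
    simpa [Function.comp_def] using this
  have h8 : ∀ᶠ n : ℕ in atTop, IsUnit (g (n : ℂ)⁻¹ ^ n) :=
    h6.eventually (Units.isOpen.mem_nhds isUnit_one)
  have h9 := h7.const_mul (NormedSpace.exp x)
  rw [mul_one] at h9
  refine h9.congr' ?_
  filter_upwards [hb, h8, eventually_ne_atTop 0] with n hbn hu hn
  have hn0 : (n : ℂ) ≠ 0 := by exact_mod_cast hn
  set y := (n : ℂ)⁻¹ • x
  have hbp : ∀ m : ℕ, b n ^ m * (1 - y) ^ m = 1 := fun m => by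
    induction m with
    | zero => simp
    | succ m ih =>
      rw [pow_succ', pow_succ, mul_assoc, ← mul_assoc (b n ^ m), ih, one_mul, hbn]
  let : NormedAlgebra ℚ 𝔸 := NormedAlgebra.restrictScalars ℚ ℂ 𝔸
  have hc : Commute (1 - y) (NormedSpace.exp y) :=
    (Commute.one_left _).sub_left (Commute.refl y).exp_right
  have e1 : b n ^ n * g (n : ℂ)⁻¹ ^ n = NormedSpace.exp x := by
    change b n ^ n * ((1 - y) * NormedSpace.exp y) ^ n = _
    rw [hc.mul_pow, ← mul_assoc, hbp, one_mul, ← NormedSpace.exp_nsmul]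
    congr 1
    rw [← Nat.cast_smul_eq_nsmul ℂ, smul_smul, mul_inv_cancel₀ hn0, one_smul]
  rw [← e1, mul_assoc, Ring.mul_inverse_cancel _ hu, mul_one]

end BanachAlgebra

/-! ### The exponential of `L` from those of `T` and of the finite-dimensional part. -/

section Exponential

open Complex ContinuousLinearMap

variable {H : Type*} [NormedAddCommGroup H] [InnerProductSpace ℂ H] [CompleteSpace H]
  {T L : H →ₗ.[ℂ] H} {P W Z : H →L[ℂ] H}

namespace Intertwines

omit [CompleteSpace H] in
-- `D` is the bounded operator `L P`. On the finite-dimensional range of `P` the resolvent is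
-- injective, hence invertible, and its inverse there is `L - w`.
theorem exists_part (h : Intertwines T L P W Z)
    (hfin : FiniteDimensional ℂ (LinearMap.range (P : H →ₗ[ℂ] H))) :
    ∃ D : H →L[ℂ] H, ∀ x, (P x, D x) ∈ L.graph ∧ P (D x) = D x := by
  obtain ⟨w, -, hw, -⟩ := h.exists_resolv
  have hR := isResolventAt_resolv hw
  set K := LinearMap.range (P : H →ₗ[ℂ] H) with hK
  have hmaps : ∀ y ∈ K, (resolv L w : H →ₗ[ℂ] H) y ∈ K := by
    rintro _ ⟨x, rfl⟩
    exact ⟨resolv L w x, (h.resolv_proj w hw x).symm⟩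
  have hinj : Function.Injective ((resolv L w : H →ₗ[ℂ] H).restrict hmaps) := by
    rw [← LinearMap.ker_eq_bot, LinearMap.ker_eq_bot']
    rintro ⟨y, hy⟩ h0
    have h1 : resolv L w y = 0 := congrArg Subtype.val h0
    have h2 := hR.1 y
    rw [h1, smul_zero, add_zero] at h2
    exact Subtype.ext (L.graph_fst_eq_zero_snd h2 rfl)
  let J := LinearEquiv.ofInjectiveEndo _ hinj
  let D₀ : K →L[ℂ] H := LinearMap.toContinuousLinearMap (K.subtype ∘ₗ J.symm.toLinearMap)
  let p : H →L[ℂ] K := P.codRestrict K fun x => ⟨x, rfl⟩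
  refine ⟨D₀ ∘L p + w • P, fun x => ?_⟩
  have h1 : resolv L w (D₀ (p x)) = P x :=
    congrArg Subtype.val (J.apply_symm_apply (p x))
  have h2 := hR.1 (D₀ (p x))
  rw [h1] at h2
  refine ⟨h2, ?_⟩
  have h3 : D₀ (p x) ∈ K := (J.symm (p x)).2
  rw [mem_range_iff h.proj_proj] at h3
  simp only [add_apply, comp_apply, smul_apply, map_add, map_smul, h3, h.proj_proj]

omit [CompleteSpace H] in
theorem eulerStep_proj (h : Intertwines T L P W Z) {c : ℂ} (hc : c ≠ 0 → c⁻¹ ∉ spec L) (x : H) :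
    eulerStep L c (P x) = P (eulerStep L c x) := by
  by_cases h0 : c = 0
  · simp [eulerStep, h0]
  · rw [eulerStep_eq h0 (hc h0), smul_apply, smul_apply, h.resolv_proj _ (hc h0), map_smul]

omit [CompleteSpace H] in
theorem eulerStep_W (h : Intertwines T L P W Z) {c : ℂ} (hc : c ≠ 0 → c⁻¹ ∉ spec L)
    (hc' : c ≠ 0 → c⁻¹ ∉ spec T) (x : H) : eulerStep L c (W x) = W (eulerStep T c x) := by
  by_cases h0 : c = 0
  · simp [eulerStep, h0]
  · have h1 := congrArg (fun X : H →L[ℂ] H => X x) (h.resolv_W (hc' h0) (hc h0))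
    rw [eulerStep_eq h0 (hc h0), eulerStep_eq h0 (hc' h0), smul_apply, smul_apply, map_smul]
    exact congrArg _ h1

omit [CompleteSpace H] in
theorem eulerStep_pow_W (h : Intertwines T L P W Z) {c : ℂ} (hc : c ≠ 0 → c⁻¹ ∉ spec L)
    (hc' : c ≠ 0 → c⁻¹ ∉ spec T) (n : ℕ) (x : H) :
    (eulerStep L c ^ n) (W x) = W ((eulerStep T c ^ n) x) := by
  induction n generalizing x with
  | zero => simp
  | succ n ih =>
    rw [pow_succ, mul_apply_eq_comp, h.eulerStep_W hc hc', ih, pow_succ, mul_apply_eq_comp]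

/-- The exponential function of `L` in terms of that of `T`. -/
theorem exists_isExp (h : Intertwines T L P W Z)
    (hfin : FiniteDimensional ℂ (LinearMap.range (P : H →ₗ[ℂ] H))) (t : ℝ)
    (hL : ∀ᶠ n : ℕ in atTop, (I * t / n : ℂ) ≠ 0 → (I * t / n : ℂ)⁻¹ ∉ spec L)
    (hT : ∀ᶠ n : ℕ in atTop, (I * t / n : ℂ) ≠ 0 → (I * t / n : ℂ)⁻¹ ∉ spec T) {U : H →L[ℂ] H}
    (hU : IsExp T t U) : ∃ Y : H →L[ℂ] H, IsExp L t (W ∘L U ∘L Z + Y ∘L P) := by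
  obtain ⟨D, hD⟩ := h.exists_part hfin
  -- The Euler step on the range of `P`, completed by the identity on the complement, so that it
  -- inverts `1 - (it / n) D` on the whole space.
  let Y : ℕ → H →L[ℂ] H := fun n => eulerStep L (I * t / n) ∘L P + (1 - P)
  have hY : ∀ᶠ n : ℕ in atTop, Y n * (1 - (n : ℂ)⁻¹ • ((I * t : ℂ) • D)) = 1 := by
    filter_upwards [hL] with n hn
    ext x
    have h1 := eulerStep_apply_sub hn (hD x).1
    have h2 : (n : ℂ)⁻¹ • ((I * t : ℂ) • D) = (I * t / n : ℂ) • D := by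
      rw [smul_smul]; congr 1; ring
    rw [h2]
    simp only [Y, mul_apply_eq_comp, add_apply, comp_apply, sub_apply, one_apply_eq_self, smul_apply,
      map_sub, map_smul, (hD x).2] at h1 ⊢
    rw [sub_self, add_zero, add_sub_right_comm, h1, add_sub_cancel]
  have hlim := tendsto_pow_of_mul_one_sub hY
  refine ⟨NormedSpace.exp ((I * t : ℂ) • D), fun x => ?_⟩
  have h3 : Tendsto (fun n => (Y n ^ n) (P x)) atTop
      (𝓝 (NormedSpace.exp ((I * t : ℂ) • D) (P x))) :=
    ((ContinuousLinearMap.apply ℂ H (P x)).continuous.tendsto _).comp hlim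
  have h4 := ((W.continuous.tendsto _).comp (hU (Z x))).add h3
  refine h4.congr' ?_
  filter_upwards [hL, hT] with n hn hn'
  have hYP : ∀ m : ℕ, (Y n ^ m) (P x) = (eulerStep L (I * t / n) ^ m) (P x) := fun m => by
    have key : ∀ m : ℕ, (Y n ^ m) (P x) = (eulerStep L (I * t / n) ^ m) (P x) ∧
        P ((Y n ^ m) (P x)) = (Y n ^ m) (P x) := fun m => by
      induction m with
      | zero => simp [h.proj_proj]
      | succ m ih =>
        have e1 : (Y n ^ (m + 1)) (P x) = eulerStep L (I * t / n) ((Y n ^ m) (P x)) := by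
          rw [pow_succ', mul_apply_eq_comp]
          simp only [Y, add_apply, comp_apply, sub_apply, one_apply_eq_self]
          rw [ih.2, sub_self, add_zero]
        rw [e1]
        refine ⟨?_, ?_⟩
        · rw [ih.1, pow_succ', mul_apply_eq_comp]
        · rw [← h.eulerStep_proj hn, ih.2]
    exact (key m).1
  rw [Function.comp_apply, hYP, ← h.eulerStep_pow_W hn hn', ← map_add, h.W_Z, sub_add_cancel]

end Intertwines

end Exponential

/-! ### The wave operators as strong limits. -/

section WaveOperators

open Complex ContinuousLinearMap

variable {H : Type*} [NormedAddCommGroup H] [InnerProductSpace ℂ H] [CompleteSpace H]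
  {T L : H →ₗ.[ℂ] H} {A B W Z : H →L[ℂ] H} {a a' b b' : H →L[ℂ] Lp H 2 (volume : Measure ℝ)}

namespace WaveHyp

theorem notMem_spec_T_of_notMem (h : WaveHyp T L A B) {z : ℂ} (hz : z ∉ spec L) : z ∉ spec T :=
  fun h' => hz (h.spec_diff.symm ▸ h' : z ∈ spec L \ discreteSpec L).1

theorem intertwines (h : WaveHyp T L A B) (hT : HasPurelyContinuousSpectrum T)
    (o : WaveOps A B (discreteProj L) (resolv T) (regPart L) (singPart L) (discreteSpec L)
      a a' b b' W Z) : Intertwines T L (discreteProj L) W Z where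
  proj_proj := h.proj_proj
  Z_W := o.Z_W (finiteDimensional_range_discreteProj h.finite) fun _ hw _ _ hx =>
    eq_zero_of_resolv_apply_eq_smul hT (h.notMem_spec_T hw.ne') hx
  W_Z := o.W_Z
  proj_W := o.proj_W
  Z_proj := o.Z_proj
  resolv_proj _ hz := h.resolv_proj hz
  exists_resolv := by
    obtain ⟨w, hw, him⟩ := h.exists_upper_mem_nonreal
    obtain ⟨h1, h2⟩ := h.notMem_spec_of_nonreal hw
    refine ⟨w, h1, h2, fun x => ?_⟩
    rw [o.W_R him, h.regPart_apply hw, ← h.resolv_proj h2, o.proj_W, map_zero, sub_zero]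

/-- The points `n / (it)` are non-real and leave the bounded discrete spectrum as `n` grows; for `t
= 0` there is nothing to prove. -/
theorem eventually_inv_notMem_spec_L (h : WaveHyp T L A B) (t : ℝ) :
    ∀ᶠ n : ℕ in atTop, (I * t / n : ℂ) ≠ 0 → (I * t / n : ℂ)⁻¹ ∉ spec L := by
  obtain ⟨r, hr⟩ := h.finite.isBounded.exists_norm_le
  filter_upwards [eventually_gt_atTop ⌈r * |t|⌉₊] with n hn h0
  have ht : 0 < |t| := by
    rw [abs_pos]
    rintro rfl
    simp at h0
  refine h.notMem_spec_L (h.notMem_spec_T ?_) fun hd => ?_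
  · rw [inv_im]
    have : (I * t / n : ℂ).im ≠ 0 := fun him => h0 (Complex.ext (by simp [div_natCast_re]) him)
    exact div_ne_zero (neg_ne_zero.2 this) (by simpa using h0)
  · have h1 := hr _ hd
    rw [norm_inv, norm_div, norm_mul, norm_I, one_mul, norm_real, Real.norm_eq_abs, inv_div,
      norm_natCast, div_le_iff₀ ht] at h1
    exact h1.not_gt (Nat.lt_of_ceil_lt hn)

theorem eventually_inv_notMem_spec_T (h : WaveHyp T L A B) (t : ℝ) :
    ∀ᶠ n : ℕ in atTop, (I * t / n : ℂ) ≠ 0 → (I * t / n : ℂ)⁻¹ ∉ spec T := by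
  filter_upwards [h.eventually_inv_notMem_spec_L t] with n hn h0
  exact h.notMem_spec_T_of_notMem (hn h0)

/-- The wave operators as strong limits. -/
theorem exists_isExp_tendsto (h : WaveHyp T L A B) (hT : HasPurelyContinuousSpectrum T)
    (o : WaveOps A B (discreteProj L) (resolv T) (regPart L) (singPart L) (discreteSpec L)
      a a' b b' W Z) (hsa : IsSelfAdjoint T) : ∃ UT UL : ℝ → H →L[ℂ] H,
        (∀ t : ℝ, IsExp T t (UT t)) ∧ (∀ t : ℝ, IsExp L t (UL t)) ∧
        (∀ φ : H, Tendsto (fun t : ℝ => UL t ((1 - discreteProj L) (UT (-t) φ)))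
          atTop (𝓝 (W φ))) ∧
        (∀ φ : H, Tendsto (fun t : ℝ => UT t (UL (-t) ((1 - discreteProj L) φ)))
          atTop (𝓝 (Z φ))) := by
  have hE := eulerFamily_of_selfAdjoint h.dense hsa h.real
  have hi := h.intertwines hT o
  choose U hU using hE.exists_exp
  have hUT : ∀ t, IsExp T t (U t) := fun t φ => (hU t φ).congr fun n => by
    rw [ofReal_div, ofReal_natCast, mul_div_assoc]
  choose Y hY using fun t => hi.exists_isExp (finiteDimensional_range_discreteProj h.finite) t
    (h.eventually_inv_notMem_spec_L t) (h.eventually_inv_notMem_spec_T t) (hUT t)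
  have hneg : ∀ t x, U t (U (-t) x) = x := fun t x => hE.exp_exp_neg (hU t) (hU (-t)) x
  have hle : ∀ t x, ‖U t x‖ ≤ ‖x‖ := fun t x => hE.norm_exp_le (hU t) x
  have hP : ∀ x, Tendsto (fun t => discreteProj L (U (-t) x)) atTop (𝓝 0) := fun x =>
    h.tendsto_discreteProj_exp o hU hle x
  have hWe : ∀ x, W x = x - discreteProj L x - (2 * Real.pi * I : ℂ)⁻¹ • adjoint b' (a x) :=
    fun x => ext_inner_left ℂ fun y => by
      rw [o.inner_W, inner_sub_right _ (x - discreteProj L x), inner_smul_right,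
        adjoint_inner_right]
  -- `W - I = -P - (2πi)⁻¹ b'^* a`, and both terms vanish along `exp(-itT) x`.
  have hWx : ∀ x, Tendsto (fun t => W (U (-t) x) - U (-t) x) atTop (𝓝 0) := fun x => by
    have h1 := (((adjoint b').continuous.tendsto _).comp (h.tendsto_a_exp o hU x)).const_smul
      (2 * Real.pi * I : ℂ)⁻¹
    rw [map_zero, smul_zero] at h1
    have h2 := (hP x).neg.sub h1
    rw [neg_zero, sub_zero] at h2
    refine h2.congr fun t => ?_
    rw [hWe, Function.comp_apply]
    abel
  -- Apply `Z` to the previous limit and use `Z W = I`.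
  have hZx : ∀ x, Tendsto (fun t => Z (U (-t) x) - U (-t) x) atTop (𝓝 0) := fun x => by
    have h1 := ((Z.continuous.tendsto _).comp (hWx x)).neg
    rw [map_zero, neg_zero] at h1
    refine h1.congr fun t => ?_
    rw [Function.comp_apply, map_sub, hi.Z_W, neg_sub]
  -- On the range of `I - P` the exponential of `L` is `W exp(itT) Z`; together with `exp(itT)
  -- exp(-itT) = I` this turns the two limits above into those for `W` and `Z`.
  have key : ∀ t x, (W ∘L U t ∘L Z + Y t ∘L discreteProj L) ((1 - discreteProj L) x) =
      W (U t (Z x)) := fun t x => by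
    simp [hi.proj_proj, hi.Z_proj]
  have hcontr : ∀ x : ℝ → H, Tendsto x atTop (𝓝 0) →
      Tendsto (fun t => U t (x t)) atTop (𝓝 0) := fun x hx =>
    squeeze_zero_norm (fun t => hle t (x t)) (tendsto_zero_iff_norm_tendsto_zero.1 hx)
  refine ⟨U, fun t => W ∘L U t ∘L Z + Y t ∘L discreteProj L, hUT, hY, fun φ => ?_, fun φ => ?_⟩
  · simp_rw [key]
    have h1 := (hcontr _ (hZx φ)).add_const φ
    rw [zero_add] at h1
    refine (W.continuous.tendsto _).comp (h1.congr fun t => ?_)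
    rw [map_sub, hneg, sub_add_cancel]
  · simp_rw [key]
    have h1 := (hcontr _ (hWx (Z φ))).add_const (Z φ)
    rw [zero_add] at h1
    refine h1.congr fun t => ?_
    rw [map_sub, hneg, sub_add_cancel]

end WaveHyp

end WaveOperators

end KatoModel

open KatoModel

theorem theorem2 {H : Type*} [NormedAddCommGroup H] [InnerProductSpace ℂ H] [CompleteSpace H]
    (T : H →ₗ.[ℂ] H) (A B V : H →L[ℂ] H) (L : H →ₗ.[ℂ] H)
    -- `T` is closed and densely defined, with purely continuous real spectrum
    (hT_closed : T.IsClosed) (hT_dense : Dense (T.domain : Set H))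
    (hT_real : ∀ z ∈ spec T, z.im = 0) (hT_cont : HasPurelyContinuousSpectrum T)
    -- `V = B^* A` and `L = T + V` on the domain of `T`
    (hV : V = ContinuousLinearMap.adjoint B ∘L A)
    (hL : L = (V : H →ₗ[ℂ] H) +ᵥ T)
    -- smoothness
    (hA : IsSmooth A T) (hB : IsSmooth B T†)
    -- `Q₀(z) = A R₀(z) B^*` is bounded off the real axis
    (hQ₀ : ∃ C : ℝ, ∀ z : ℂ, z.im ≠ 0 →
      ‖A ∘L resolv T z ∘L ContinuousLinearMap.adjoint B‖ ≤ C)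
    -- (i) the resolvent of `L` is meromorphic off the spectrum of `T`, its poles being the
    -- eigenvalues of `L`, which have finite algebraic multiplicity
    (hi_mero : MeromorphicOn (resolv L) (spec T)ᶜ)
    (hi_poles : ∀ z ∉ spec T, meromorphicOrderAt (resolv L) z < 0 ↔ IsEigenvalue L z)
    (hi_mult : ∀ z ∉ spec T, IsEigenvalue L z →
      FiniteDimensional ℂ (LinearMap.range (rieszProj L z : H →ₗ[ℂ] H)))
    -- (ii) the discrete spectrum of `L` is finite, the rest of the spectrum is that of `T`
    (hii_fin : (discreteSpec L).Finite)
    (hii_cont : spec L \ discreteSpec L = spec T)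
    -- (iii) `Q_V(z) = A R_V(z) B^*` is bounded off the real axis away from the discrete spectrum
    (hiii : ∀ δ : ℝ, 0 < δ → ∃ C : ℝ, ∀ z : ℂ, z.im ≠ 0 → (∀ μ ∈ discreteSpec L, δ ≤ dist z μ) →
      ‖A ∘L resolv L z ∘L ContinuousLinearMap.adjoint B‖ ≤ C) :
    -- the wave operators exist and are unique
    (∃! W : H →L[ℂ] H, IsDirectWaveOperator T L A B W) ∧
    (∃! Z : H →L[ℂ] H, IsInverseWaveOperator T L A B Z) ∧
    ∀ W Z : H →L[ℂ] H, IsDirectWaveOperator T L A B W → IsInverseWaveOperator T L A B Z →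
      -- `W` is an isomorphism of `H` onto `H_c`, inverted by the restriction of `Z` to `H_c`
      (Z ∘L W = 1 ∧ W ∘L Z = 1 - discreteProj L ∧
        LinearMap.range (W : H →ₗ[ℂ] H) = continuousSubspace L ∧
        LinearMap.ker (Z : H →ₗ[ℂ] H) = discreteSubspace L) ∧
      -- `H_c` is invariant under `L`, and `L_c = W T Z`, with equality of domains
      (∀ x : L.domain, (x : H) ∈ continuousSubspace L → L x ∈ continuousSubspace L) ∧
      L.domRestrict (continuousSubspace L) =
        (conjugate W T Z).domRestrict (continuousSubspace L) ∧
      -- `W` intertwines the resolvents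
      (∀ z ∉ spec L, resolv L z ∘L W = W ∘L resolv T z) ∧
      -- time-dependent representations for selfadjoint `T`
      (IsSelfAdjoint T → ∃ UT UL : ℝ → H →L[ℂ] H,
        (∀ t : ℝ, IsExp T t (UT t)) ∧ (∀ t : ℝ, IsExp L t (UL t)) ∧
        (∀ φ : H, Tendsto (fun t : ℝ => UL t ((1 - discreteProj L) (UT (-t) φ)))
          atTop (𝓝 (W φ))) ∧
        (∀ φ : H, Tendsto (fun t : ℝ => UT t (UL (-t) ((1 - discreteProj L) φ)))
          atTop (𝓝 (Z φ)))) := by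
  subst hV
  have h : WaveHyp T L A B := ⟨hT_dense, hT_real, hL, hA, hB, hQ₀, hii_fin, hii_cont, hiii⟩
  obtain ⟨a, a', b, b', W, Z, o⟩ := h.waveData.exists_waveOps
  have hW := h.isDirectWaveOperator o
  have hZ := h.isInverseWaveOperator o
  have hi := h.intertwines hT_cont o
  refine ⟨⟨W, hW, fun _ hW' => h.isDirectWaveOperator_unique hW' hW⟩,
    ⟨Z, hZ, fun _ hZ' => h.isInverseWaveOperator_unique hZ' hZ⟩, fun W' Z' hW' hZ' => ?_⟩
  obtain rfl := h.isDirectWaveOperator_unique hW hW'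
  obtain rfl := h.isInverseWaveOperator_unique hZ hZ'
  refine ⟨⟨?_, ?_, ?_, ?_⟩, ?_, ?_, ?_, h.exists_isExp_tendsto hT_cont o⟩
  · ext x
    exact hi.Z_W x
  · ext x
    exact hi.W_Z x
  · ext x
    rw [h.mem_continuousSubspace_iff]
    constructor
    · rintro ⟨y, rfl⟩
      exact hi.proj_W y
    · intro hx
      exact ⟨Z x, by simpa [hx] using hi.W_Z x⟩
  · ext x
    rw [h.mem_discreteSubspace_iff, LinearMap.mem_ker]
    constructor
    · intro hx
      have h1 := hi.W_Z x
      rw [show Z x = 0 from hx, map_zero] at h1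
      exact (sub_eq_zero.1 h1.symm).symm
    · intro hx
      rw [← hx]
      exact hi.Z_proj x
  · intro x hx
    rw [h.mem_continuousSubspace_iff] at hx ⊢
    exact hi.proj_eq_zero (L.mem_graph x) hx
  · exact hi.domRestrict_eq fun x hx => h.mem_continuousSubspace_iff.1 hx
  · exact fun z hz => hi.resolv_W (h.notMem_spec_T_of_notMem hz) hz
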